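/- **Theorem 10.4.** All objects are smooth. Let $M$ be an $n$-dimensional manifold with a statistical structure $(g,\nabla)$: $g$ is a Riemannian metric and $\nabla$ a torsion-free connection with $(\nabla_Xg)(Y,Z)=(\nabla_Yg)(X,Z)$. Let $\overline\nabla$ be the conjugate connection, $g(\nabla_XY,Z)+g(Y,\overline\nabla_XZ)=Xg(Y,Z)$, let $\hat\nabla$ be the Levi-Civita connection of $g$, $K_XY=\nabla_XY-\hat\nabla_XY$, $E=\operatorname{tr}_gK(\cdot,\cdot)$, and let $R,\overline R$ be the curvature tensors of $\nabla,\overline\nabla$. The extensions of $g,\nabla,\overline\nabla$ to tensor fields are denoted by the same letters, $|s|^2=g(s,s)$, and $(\nabla s)(X,\dots)=(\nabla_Xs)(\dots)$. Set $$\nabla^*\nabla s=-\operatorname{tr}_g(\overline\nabla_{\cdot}(\nabla s))(\cdot)+\nabla_Es,\qquad \overline\nabla^*\overline\nabla s=-\operatorname{tr}_g(\nabla_{\cdot}(\overline\nabla s))(\cdot)-\overline\nabla_Es .$$ Let $\Delta=\delta d+d\delta$ be the Hodge Laplacian, where $\delta\omega=-\operatorname{tr}_g\hat\nabla\omega(\cdot,\cdot,\dots)$.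 Let $\Delta^\nabla f=-\operatorname{tr}\{Y\mapsto\nabla_Y\operatorname{grad}f\}$ on functions and $\Delta^\nabla=\delta^{\overline\nabla}d+d\delta^{\overline\nabla}$ on forms, where $\delta^{\overline\nabla}\omega=-\operatorname{tr}_g\overline\nabla\omega(\cdot,\cdot,\dots)$. For a $k$-form $\omega$ put $$(\mathcal W^{R+\overline R}\omega)(X_1,\dots,X_k)=\sum_{i=1}^k\sum_{j=1}^n\bigl((R+\overline R)(e_j,X_i)\,\omega\bigr)(X_1,\dots,e_j,\dots,X_k)$$ ($e_j$ in the $i$-th place, $(e_j)$ an orthonormal frame, endomorphisms acting on $\omega$ as derivations). Finally, $K_E\omega$ and $S_E\omega$ denote the actions on $\omega$, as derivations, of the endomorphisms $Y\mapsto K_EY$ and $Y\mapsto\nabla_YE$; thus $S_E=\nabla_E-\mathcal L_E$. (a) For every tensor field $s$ of any type $(l,k)$, $$\Delta|s|^2=g(\nabla^*\nabla s,s)+g(\overline\nabla^*\overline\nabla s,s)-g(\nabla s,\nabla s)-g(\overline\nabla s,\overline\nabla s),$$ $$\Delta^\nabla|s|^2=g(\nabla^*\nabla s,s)+g(\overline\nabla^*\overline\nabla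 s,s)-g(\nabla s,\nabla s)-g(\overline\nabla s,\overline\nabla s)-g(\nabla_Es,s)-g(\overline\nabla_Es,s).$$ (b) For every differential form $\omega$, $$\Delta|\omega|^2=2g(\Delta\omega,\omega)-g(\mathcal W^{R+\overline R}\omega,\omega)-g(\nabla\omega,\nabla\omega)-g(\overline\nabla\omega,\overline\nabla\omega)-2g(K_E\omega,\omega),$$ $$\Delta^\nabla|\omega|^2=2g(\Delta^\nabla\omega,\omega)-g(\mathcal W^{R+\overline R}\omega,\omega)-g(\nabla\omega,\nabla\omega)-g(\overline\nabla\omega,\overline\nabla\omega)-2g(S_E\omega,\omega),$$ and, equivalently to the last formula, $$\Delta^\nabla|\omega|^2=2g(\Delta\omega,\omega)-g(\mathcal W^{R+\overline R}\omega,\omega)-g(\nabla\omega,\nabla\omega)-g(\overline\nabla\omega,\overline\nabla\omega)-2g(\nabla_E\omega,\omega).$$ -/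

import Mathlib

open Bundle FiberBundle
open scoped Manifold ContDiff

noncomputable section

namespace StatGeom

variable {n : ℕ} {M : Type*} [TopologicalSpace M]
  [ChartedSpace (EuclideanSpace ℝ (Fin n)) M] [IsManifold (𝓡 n) ∞ M]

/-! ### Fields on a smooth `n`-manifold `M` -/

variable (n M) in
/-- (Not necessarily continuous) vector fields. -/
abbrev VField := (x : M) → TangentSpace (𝓡 n) x

variable (n M) in
/-- (Not necessarily continuous) fields of covectors. -/
abbrev CoField := (x : M) → (TangentSpace (𝓡 n) x →L[ℝ] ℝ)

variable (n M) in
/-- Raw fields of functions of `k` tangent vectors and `l` cotangent vectors. The tensor fields of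
type `(l, k)` are those which satisfy `IsTensorField` below. -/
abbrev RawField (l k : ℕ) :=
  (x : M) → (Fin k → TangentSpace (𝓡 n) x) → (Fin l → (TangentSpace (𝓡 n) x →L[ℝ] ℝ)) → ℝ

variable (n M) in
/-- Smooth Riemannian metrics. -/
abbrev Metric := ContMDiffRiemannianMetric (𝓡 n) ∞ (EuclideanSpace ℝ (Fin n))
  (fun x : M ↦ TangentSpace (𝓡 n) x)

variable (n M) in
/-- Linear connections. -/
abbrev Connection := CovariantDerivative (𝓡 n) (EuclideanSpace ℝ (Fin n))
  (fun x : M ↦ TangentSpace (𝓡 n) x)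

variable (n M) in
/-- Raw operators `(Y, x, v) ↦ (∇_v Y)(x)`. They serve to write down the conjugate connection and
the Levi-Civita connection by explicit formulas. -/
abbrev RawConn := VField n M → (x : M) → TangentSpace (𝓡 n) x → TangentSpace (𝓡 n) x

/-- The operator of a connection. -/
def opOf (D : Connection n M) : RawConn n M := fun Y x v ↦ D Y x v

/-- `v` extended to a vector field around `x`: in the chart at `x` it has constant components. -/
def ext {x : M} (v : TangentSpace (𝓡 n) x) : VField n M :=
  extend (EuclideanSpace ℝ (Fin n)) v

/-- `θ` extended to a field of covectors around `x`: in the chart at `x` it has constant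
components. -/
def coext {x : M} (θ : TangentSpace (𝓡 n) x →L[ℝ] ℝ) : CoField n M :=
  extend (E := fun x : M ↦ (TangentSpace (𝓡 n) x →L[ℝ] ℝ)) (EuclideanSpace ℝ (Fin n) →L[ℝ] ℝ) θ

/-- The directional derivative `v f` of a function. -/
def dirDeriv (f : M → ℝ) (x : M) (v : TangentSpace (𝓡 n) x) : ℝ := mvfderiv (𝓡 n) f x v

/-- `Y` is smooth at `x`. -/
def SmoothVAt (Y : VField n M) (x : M) : Prop :=
  ContMDiffAt (𝓡 n) ((𝓡 n).prod 𝓘(ℝ, EuclideanSpace ℝ (Fin n))) ∞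
    (fun x' ↦ TotalSpace.mk' (EuclideanSpace ℝ (Fin n)) x' (Y x')) x

/-- `θ` is smooth at `x`. -/
def SmoothCoAt (θ : CoField n M) (x : M) : Prop :=
  ContMDiffAt (𝓡 n) ((𝓡 n).prod 𝓘(ℝ, EuclideanSpace ℝ (Fin n) →L[ℝ] ℝ)) ∞
    (fun x' ↦ TotalSpace.mk' (E := fun x : M ↦ (TangentSpace (𝓡 n) x →L[ℝ] ℝ))
      (EuclideanSpace ℝ (Fin n) →L[ℝ] ℝ) x' (θ x')) x

/-- Smooth tensor fields of type `(l, k)`: at each point multilinear in `k` vectors and `l`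
covectors, with smooth values on smooth arguments. -/
structure IsTensorField {l k : ℕ} (s : RawField n M l k) : Prop where
  multilinear : ∀ x : M, ∃ S : MultilinearMap ℝ (fun _ : Fin k ↦ TangentSpace (𝓡 n) x)
      (MultilinearMap ℝ (fun _ : Fin l ↦ (TangentSpace (𝓡 n) x →L[ℝ] ℝ)) ℝ),
    ∀ y θ, s x y θ = S y θ
  smooth : ∀ (x : M) (Y : Fin k → VField n M) (Θ : Fin l → CoField n M),
    (∀ i, SmoothVAt (Y i) x) → (∀ j, SmoothCoAt (Θ j) x) →
      ContMDiffAt (𝓡 n) 𝓘(ℝ) ∞ (fun x' ↦ s x' (fun i ↦ Y i x') (fun j ↦ Θ j x')) x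

/-- Smooth differential forms of degree `k`. -/
structure IsForm {k : ℕ} (η : RawField n M 0 k) : Prop extends IsTensorField η where
  alternating : ∀ x y θ i j, i ≠ j → y i = y j → η x y θ = 0

/-! ### Covariant derivatives and exterior derivative -/

/-- The covariant derivative of a field of covectors,
`(∇_v θ)(z) = v (θ(Z)) - θ(∇_v Z)`, the components being taken in the coordinate frame of the
chart at `x`. -/
def covDual (cov : RawConn n M) (θ : CoField n M) (x : M) (v : TangentSpace (𝓡 n) x) :
    TangentSpace (𝓡 n) x →L[ℝ] ℝ :=
  let b : Fin n → TangentSpace (𝓡 n) x := fun i ↦ EuclideanSpace.single i (1 : ℝ)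
  let β : Fin n → (TangentSpace (𝓡 n) x →L[ℝ] ℝ) :=
    fun i ↦ (EuclideanSpace.proj i : EuclideanSpace ℝ (Fin n) →L[ℝ] ℝ)
  ∑ i, (dirDeriv (fun x' ↦ θ x' (ext (b i) x')) x v - θ x (cov (ext (b i)) x v)) • β i

/-- The covariant derivative `∇s`, a field of type `(l, k + 1)`:
`(∇s)(X, Y₁, …, Yₖ, θ₁, …, θₗ) = (∇_X s)(Y₁, …, Yₖ, θ₁, …, θₗ)
  = X(s(Y, θ)) - ∑ᵢ s(…, ∇_X Yᵢ, …, θ) - ∑ⱼ s(Y, …, ∇_X θⱼ, …)`. -/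
def covDeriv (cov : RawConn n M) {l k : ℕ} (s : RawField n M l k) : RawField n M l (k + 1) :=
  fun x y θ ↦
    let X : TangentSpace (𝓡 n) x := y 0
    let z : Fin k → TangentSpace (𝓡 n) x := fun i ↦ y i.succ
    dirDeriv (fun x' ↦ s x' (fun i ↦ ext (z i) x') (fun j ↦ coext (θ j) x')) x X
      - ∑ i, s x (Function.update z i (cov (ext (z i)) x X)) θ
      - ∑ j, s x z (Function.update θ j (covDual cov (coext (θ j)) x X))

/-- Insertion of a vector field in the first place, `ι_X S = S(X, …)`. -/
def insertFirst (X : VField n M) {l k : ℕ} (S : RawField n M l (k + 1)) : RawField n M l k :=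
  fun x y θ ↦ S x (Fin.cons (X x) y) θ

/-- `∇_X s`. -/
def covAlong (cov : RawConn n M) (X : VField n M) {l k : ℕ} (s : RawField n M l k) :
    RawField n M l k := insertFirst X (covDeriv cov s)

/-- The exterior derivative. The values of `dη` at `x` are computed with the fields that have
constant components in the chart at `x`; their Lie brackets vanish around `x`, so that
`dη(Y₀, …, Yₖ) = ∑ᵢ (-1)^i Yᵢ(η(Y₀, …, Ŷᵢ, …, Yₖ))`. -/
def extD {k : ℕ} (η : RawField n M 0 k) : RawField n M 0 (k + 1) :=
  fun x y θ ↦ ∑ i : Fin (k + 1), (-1 : ℝ) ^ (i : ℕ) *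
    dirDeriv (fun x' ↦ η x' (fun j ↦ ext (y (i.succAbove j)) x') (fun j ↦ coext (θ j) x')) x (y i)

/-- The curvature tensor `R(u, v)w = ∇_u ∇_v w - ∇_v ∇_u w - ∇_[u, v] w`. -/
def curvature (cov : RawConn n M) (x : M) (u v w : TangentSpace (𝓡 n) x) :
    TangentSpace (𝓡 n) x :=
  cov (fun x' ↦ cov (ext w) x' (ext v x')) x u - cov (fun x' ↦ cov (ext w) x' (ext u x')) x v
    - cov (ext w) x (VectorField.mlieBracket (𝓡 n) (ext u) (ext v) x)

/-! ### Metric notions -/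

/-- Orthonormal bases of `T_x M`. -/
def IsOrthonormalFrame (g : Metric n M) (x : M) (e : Fin n → TangentSpace (𝓡 n) x) : Prop :=
  ∀ i j, g.inner x (e i) (e j) = if i = j then 1 else 0

theorem exists_orthonormalFrame (g : Metric n M) (x : M) :
    ∃ e : Fin n → TangentSpace (𝓡 n) x, IsOrthonormalFrame g x e := by
  let core : InnerProductSpace.Core ℝ (TangentSpace (𝓡 n) x) :=
    { inner := fun u v ↦ g.inner x u v
      conj_inner_symm := fun u v ↦ by simpa using g.symm x v u
      re_inner_nonneg := fun u ↦ by
        by_cases h : u = 0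
        · simp [h]
        · simpa using (g.pos x u h).le
      add_left := fun u v w ↦ by simp
      smul_left := fun u v r ↦ by simp
      definite := fun u hu ↦ by
        by_contra h
        exact (g.pos x u h).ne' hu }
  let _ : NormedAddCommGroup (TangentSpace (𝓡 n) x) := core.toNormedAddCommGroup
  let _ : InnerProductSpace ℝ (TangentSpace (𝓡 n) x) := InnerProductSpace.ofCore core.toCore
  have : FiniteDimensional ℝ (TangentSpace (𝓡 n) x) :=
    inferInstanceAs (FiniteDimensional ℝ (EuclideanSpace ℝ (Fin n)))
  have hn : Module.finrank ℝ (TangentSpace (𝓡 n) x) = n :=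
    finrank_euclideanSpace_fin (𝕜 := ℝ) (n := n)
  let b := (stdOrthonormalBasis ℝ (TangentSpace (𝓡 n) x)).reindex (finCongr hn)
  exact ⟨b, fun i j ↦ orthonormal_iff_ite.1 b.orthonormal i j⟩

/-- An orthonormal basis of `T_x M`. The traces and scalar products below do not depend on the
choice. -/
def frame (g : Metric n M) (x : M) : Fin n → TangentSpace (𝓡 n) x :=
  (exists_orthonormalFrame g x).choose

/-- `g` as a tensor field of type `(0, 2)`. -/
def metricTensor (g : Metric n M) : RawField n M 0 2 := fun x y _ ↦ g.inner x (y 0) (y 1)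

/-- The scalar product `g(s, t)` of tensor fields. -/
def tensorInner (g : Metric n M) {l k : ℕ} (s t : RawField n M l k) : M → ℝ :=
  fun x ↦ ∑ a : Fin k → Fin n, ∑ b : Fin l → Fin n,
    s x (fun i ↦ frame g x (a i)) (fun j ↦ g.inner x (frame g x (b j)))
      * t x (fun i ↦ frame g x (a i)) (fun j ↦ g.inner x (frame g x (b j)))

/-- The trace `tr_g S(·, ·, …)` over the first two places. -/
def traceFirst (g : Metric n M) {l k : ℕ} (S : RawField n M l (k + 2)) : RawField n M l k :=
  fun x y θ ↦ ∑ i, S x (Fin.cons (frame g x i) (Fin.cons (frame g x i) y)) θ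

/-- The conjugate connection: `g(∇_X Y, Z) + g(Y, ∇̄_X Z) = X g(Y, Z)`. -/
def conj (g : Metric n M) (cov : RawConn n M) : RawConn n M :=
  fun Z x v ↦ ∑ i,
    (dirDeriv (fun x' ↦ g.inner x' (ext (frame g x i) x') (Z x')) x v
      - g.inner x (cov (ext (frame g x i)) x v) (Z x)) • frame g x i

/-- The right hand side of the formula of Koszul for `2 g(∇_X Y, Z)`. -/
def koszul (g : Metric n M) (X Y Z : VField n M) (x : M) : ℝ :=
  dirDeriv (fun x' ↦ g.inner x' (Y x') (Z x')) x (X x)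
    + dirDeriv (fun x' ↦ g.inner x' (Z x') (X x')) x (Y x)
    - dirDeriv (fun x' ↦ g.inner x' (X x') (Y x')) x (Z x)
    + g.inner x (VectorField.mlieBracket (𝓡 n) X Y x) (Z x)
    - g.inner x (VectorField.mlieBracket (𝓡 n) Y Z x) (X x)
    + g.inner x (VectorField.mlieBracket (𝓡 n) Z X x) (Y x)

/-- The Levi-Civita connection. -/
def leviCivita (g : Metric n M) : RawConn n M :=
  fun Y x v ↦ ∑ i, ((1 / 2 : ℝ) * koszul g (ext v) Y (ext (frame g x i)) x) • frame g x i

/-- The difference tensor `K_u v = ∇_u v - ∇̂_u v`. -/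
def diffTensor (g : Metric n M) (cov : RawConn n M) (x : M) (u v : TangentSpace (𝓡 n) x) :
    TangentSpace (𝓡 n) x :=
  cov (ext v) x u - leviCivita g (ext v) x u

/-- The vector field `E = tr_g K(·, ·)`. -/
def vecE (g : Metric n M) (cov : RawConn n M) : VField n M :=
  fun x ↦ ∑ i, diffTensor g cov x (frame g x i) (frame g x i)

/-- Statistical structures: `∇` is a smooth torsion-free connection with
`(∇_X g)(Y, Z) = (∇_Y g)(X, Z)`. -/
structure IsStatistical (g : Metric n M) (D : Connection n M) : Prop where
  smooth : ContMDiffCovariantDerivativeOn (EuclideanSpace ℝ (Fin n)) ∞ D.toFun Set.univ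
  torsion_free : D.torsion = 0
  codazzi : ∀ (x : M) (X Y Z : TangentSpace (𝓡 n) x),
    covDeriv (opOf D) (metricTensor g) x ![X, Y, Z] ![]
      = covDeriv (opOf D) (metricTensor g) x ![Y, X, Z] ![]

/-- The curvature sum `R + R̄` of a connection and its conjugate. -/
def curvatureSum (g : Metric n M) (D : Connection n M) (x : M)
    (u v w : TangentSpace (𝓡 n) x) : TangentSpace (𝓡 n) x :=
  curvature (opOf D) x u v w + curvature (conj g (opOf D)) x u v w

/-! ### Differential operators -/

/-- The formal adjoint `∇*S = -tr_g (∇̄_· S)(·) + S(E)`. -/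
def formalAdjoint (g : Metric n M) (cov : RawConn n M) {l k : ℕ} (S : RawField n M l (k + 1)) :
    RawField n M l k :=
  -traceFirst g (covDeriv (conj g cov) S) + insertFirst (vecE g cov) S

/-- `∇*∇ s`. -/
def roughLaplacian (g : Metric n M) (cov : RawConn n M) {l k : ℕ} (s : RawField n M l k) :
    RawField n M l k :=
  formalAdjoint g cov (covDeriv cov s)

/-- The codifferential relative to a connection, `δ^∇ η = -tr_g ∇η(·, ·, …)`. -/
def codiff (g : Metric n M) (cov : RawConn n M) {k : ℕ} (η : RawField n M 0 (k + 1)) :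
    RawField n M 0 k :=
  -traceFirst g (covDeriv cov η)

/-- `δ d + d δ`, where `δ` is the codifferential relative to the given connection; on functions
it is `δ d`. -/
def formLaplacian (g : Metric n M) (cov : RawConn n M) :
    {k : ℕ} → RawField n M 0 k → RawField n M 0 k
  | 0, f => codiff g cov (extD f)
  | _ + 1, η => codiff g cov (extD η) + extD (codiff g cov η)

/-- The Hodge Laplacian `Δ = δ d + d δ` on forms; the codifferential `δ` of the metric is the one
relative to the Levi-Civita connection. -/
def hodgeLaplacian (g : Metric n M) {k : ℕ} (η : RawField n M 0 k) : RawField n M 0 k :=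
  formLaplacian g (leviCivita g) η

/-- The Hodge Laplacian on functions. -/
def hodgeLaplacianFun (g : Metric n M) (f : M → ℝ) : M → ℝ :=
  fun x ↦ hodgeLaplacian g (k := 0) (fun x' _ _ ↦ f x') x ![] ![]

/-- The Laplacian `Δ^∇ = δ^∇̄ d + d δ^∇̄` on forms. -/
def statLaplacian (g : Metric n M) (D : Connection n M) {k : ℕ} (η : RawField n M 0 k) :
    RawField n M 0 k :=
  formLaplacian g (conj g (opOf D)) η

/-- The gradient of a function. -/
def grad (g : Metric n M) (f : M → ℝ) : VField n M :=
  fun x ↦ ∑ i, dirDeriv f x (frame g x i) • frame g x i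

/-- The divergence `div^∇ X = tr (Y ↦ ∇_Y X)`. -/
def divergence (D : Connection n M) (X : VField n M) : M → ℝ :=
  fun x ↦ LinearMap.trace ℝ (TangentSpace (𝓡 n) x) (D X x).toLinearMap

/-- The Laplacian `Δ^∇ f = -div^∇ grad f` on functions. -/
def statLaplacianFun (g : Metric n M) (D : Connection n M) (f : M → ℝ) : M → ℝ :=
  fun x ↦ -divergence D (grad g f) x

/-- The derivation induced on covariant tensors by a field `A` of endomorphisms:
`(Aη)(Y₁, …, Yₖ) = -∑ᵢ η(Y₁, …, A Yᵢ, …, Yₖ)`. -/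
def derivAction (A : (x : M) → TangentSpace (𝓡 n) x → TangentSpace (𝓡 n) x) {k : ℕ}
    (η : RawField n M 0 k) : RawField n M 0 k :=
  fun x y θ ↦ -∑ i, η x (Function.update y i (A x (y i))) θ

/-- The Weitzenböck curvature operator of a curvature tensor `R`:
`(W^R η)(X₁, …, Xₖ) = ∑ᵢ ∑ⱼ (R(eⱼ, Xᵢ)η)(X₁, …, eⱼ, …, Xₖ)` with `eⱼ` at the `i`-th place, where
`R(eⱼ, Xᵢ)` acts on `η` as a derivation. -/
def weitzenbock (g : Metric n M)
    (R : (x : M) → TangentSpace (𝓡 n) x → TangentSpace (𝓡 n) x → TangentSpace (𝓡 n) x →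
      TangentSpace (𝓡 n) x) {k : ℕ} (η : RawField n M 0 k) : RawField n M 0 k :=
  fun x y θ ↦ ∑ i : Fin k, ∑ j : Fin n,
    -∑ m : Fin k,
      let z := Function.update y i (frame g x j)
      η x (Function.update z m (R x (frame g x j) (y i) (z m))) θ

end StatGeom

end

open StatGeom

open Bundle FiberBundle
open scoped Manifold ContDiff

noncomputable section

namespace StatGeom

variable {n : ℕ} {M : Type*} [TopologicalSpace M]
  [ChartedSpace (EuclideanSpace ℝ (Fin n)) M] [IsManifold (𝓡 n) ∞ M]

open Filter Topology

set_option linter.unusedSectionVars false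

/-! ### Directional derivatives and smooth fields -/

/-! Write `∇̄` for the conjugate of `∇`, `∇̂` for the mean of the two and `K` for half their
difference. Since `∇` is torsion-free, the Codazzi equation says that `∇̄` is torsion-free too
(`torsionFree_conj`). So `∇̂` is torsion-free and metric, hence the Levi-Civita connection
(`leviCivita_eq_avg`). Thus `∇ = ∇̂ + K` and `∇̄ = ∇̂ - K`, where `K` is symmetric and each `K_X` is
self-adjoint.

Part (a) rests on the conjugate Leibniz rule `X g(s, t) = g(∇_X s, t) + g(s, ∇̄_X t)` for tensor
fields of every type (`dirDeriv_tensorInner`). In an orthonormal frame the coefficients of `∇` and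
`∇̄` are negative transposes of each other, so the frame terms cancel. Applied twice to `|s|²`, each
time pairing a connection with its conjugate, the rule produces `∇̄∇s`, `∇∇̄s` and the two squared
lengths. Replacing `∇_e e` and `∇̄_e e` by `∇̂_e e ± K(e, e)` leaves exactly the terms in `E` of the
two rough Laplacians (`hodgeLaplacianFun_inner_self`). Moreover `Δ^∇ f = Δ f - E f`
(`statLaplacianFun_eq`), which gives the second formula.

For (b) the sum of the rough Laplacians is computed on forms (`roughLaplacian_add`). The cross terms
of `∇̂` and `K` drop out of `∇̄∇ + ∇∇̄ = 2(∇̂∇̂ - KK)` and of `∇∇ + ∇̄∇̄ = 2(∇̂∇̂ + KK)`. By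
`formLaplacian_eq` the Hodge Laplacian is minus the trace of `∇̂∇̂` plus commutators of second
derivatives. The Ricci identity for `∇` and for `∇̄` (`covDeriv_covDeriv_comm`) turns `W^(R+R̄)`
into twice the commutators of `∇̂∇̂` and of `KK`. What remains is an algebraic identity between the
trace of `KK`, its commutators and `K_E` (`sum_diffAct_diffAct`), which uses only that `K` is
symmetric and self-adjoint and that the form is alternating.

Finally `δ^∇̄ = δ - ι_E` on forms (`codiff_conj_eq`), so Cartan's formula gives `Δ^∇ = Δ - L_E = Δ -
∇_E + S_E` (`statLaplacian_eq`). Together with `∇_E - ∇̄_E = 2K_E` this makes the last two formulas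
equivalent. -/

theorem dirDeriv_add_vec (f : M → ℝ) (x : M) (v w : TangentSpace (𝓡 n) x) :
    dirDeriv f x (v + w) = dirDeriv f x v + dirDeriv f x w := map_add _ _ _

theorem dirDeriv_smul_vec (f : M → ℝ) (x : M) (c : ℝ) (v : TangentSpace (𝓡 n) x) :
    dirDeriv f x (c • v) = c * dirDeriv f x v := map_smul _ _ _

theorem dirDeriv_sum_vec {ι : Type*} (t : Finset ι) (f : M → ℝ) (x : M)
    (v : ι → TangentSpace (𝓡 n) x) :
    dirDeriv f x (∑ i ∈ t, v i) = ∑ i ∈ t, dirDeriv f x (v i) := map_sum _ _ _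

theorem dirDeriv_congr {f h : M → ℝ} {x : M} (hfh : f =ᶠ[𝓝 x] h) (v : TangentSpace (𝓡 n) x) :
    dirDeriv f x v = dirDeriv h x v := by
  unfold dirDeriv mvfderiv
  have := hfh.mfderiv_eq (I := 𝓡 n) (I' := 𝓘(ℝ))
  simp only [ContinuousLinearMap.comp_apply]
  rw [this]; rfl

theorem dirDeriv_const (c : ℝ) (x : M) (v : TangentSpace (𝓡 n) x) :
    dirDeriv (fun _ : M ↦ c) x v = 0 := by
  unfold dirDeriv; rw [mvfderiv_const]; rfl

theorem dirDeriv_add {f h : M → ℝ} {x : M} (hf : MDifferentiableAt (𝓡 n) 𝓘(ℝ) f x)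
    (hh : MDifferentiableAt (𝓡 n) 𝓘(ℝ) h x) (v : TangentSpace (𝓡 n) x) :
    dirDeriv (fun x' ↦ f x' + h x') x v = dirDeriv f x v + dirDeriv h x v := by
  unfold dirDeriv; rw [mvfderiv_fun_add hf hh]; rfl

theorem dirDeriv_sub {f h : M → ℝ} {x : M} (hf : MDifferentiableAt (𝓡 n) 𝓘(ℝ) f x)
    (hh : MDifferentiableAt (𝓡 n) 𝓘(ℝ) h x) (v : TangentSpace (𝓡 n) x) :
    dirDeriv (fun x' ↦ f x' - h x') x v = dirDeriv f x v - dirDeriv h x v := by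
  unfold dirDeriv; rw [mvfderiv_fun_sub hf hh]; rfl

theorem dirDeriv_neg {f : M → ℝ} {x : M} (v : TangentSpace (𝓡 n) x) :
    dirDeriv (fun x' ↦ -f x') x v = -dirDeriv f x v := by
  unfold dirDeriv; rw [mvfderiv_fun_neg]; rfl

theorem dirDeriv_mul {f h : M → ℝ} {x : M} (hf : MDifferentiableAt (𝓡 n) 𝓘(ℝ) f x)
    (hh : MDifferentiableAt (𝓡 n) 𝓘(ℝ) h x) (v : TangentSpace (𝓡 n) x) :
    dirDeriv (fun x' ↦ f x' * h x') x v = dirDeriv f x v * h x + f x * dirDeriv h x v := by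
  unfold dirDeriv; rw [mvfderiv_fun_mul hf hh]
  simp only [add_apply, smul_apply, smul_eq_mul]
  ring

theorem mdifferentiableAt_sum {ι : Type*} (t : Finset ι) {f : ι → M → ℝ} {x : M}
    (hf : ∀ i ∈ t, MDifferentiableAt (𝓡 n) 𝓘(ℝ) (f i) x) :
    MDifferentiableAt (𝓡 n) 𝓘(ℝ) (fun x' ↦ ∑ i ∈ t, f i x') x := by
  classical
  induction t using Finset.induction_on with
  | empty => simpa using mdifferentiableAt_const
  | insert a t ha ih =>
    simp only [Finset.sum_insert ha]
    exact (hf a (by simp)).add (ih fun i hi ↦ hf i (by simp [hi]))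

theorem dirDeriv_sum {ι : Type*} (t : Finset ι) {f : ι → M → ℝ} {x : M}
    (hf : ∀ i ∈ t, MDifferentiableAt (𝓡 n) 𝓘(ℝ) (f i) x) (v : TangentSpace (𝓡 n) x) :
    dirDeriv (fun x' ↦ ∑ i ∈ t, f i x') x v = ∑ i ∈ t, dirDeriv (f i) x v := by
  classical
  induction t using Finset.induction_on with
  | empty => simpa using dirDeriv_const 0 x v
  | insert a t ha ih =>
    simp only [Finset.sum_insert ha]
    rw [dirDeriv_add (hf a (by simp)), ih fun i hi ↦ hf i (by simp [hi])]
    exact mdifferentiableAt_sum t fun i hi ↦ hf i (by simp [hi])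

theorem dirDeriv_const_mul {f : M → ℝ} {x : M} (c : ℝ) (hf : MDifferentiableAt (𝓡 n) 𝓘(ℝ) f x)
    (v : TangentSpace (𝓡 n) x) :
    dirDeriv (fun x' ↦ c * f x') x v = c * dirDeriv f x v := by
  rw [dirDeriv_mul mdifferentiableAt_const hf, dirDeriv_const]; ring

/-- `f` is smooth at `x`. -/
abbrev SmoothAt (f : M → ℝ) (x : M) : Prop := ContMDiffAt (𝓡 n) 𝓘(ℝ) ∞ f x

/-- `Y` is differentiable at `x`. -/
abbrev DiffVAt (Y : VField n M) (x : M) : Prop :=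
  MDifferentiableAt (𝓡 n) ((𝓡 n).prod 𝓘(ℝ, EuclideanSpace ℝ (Fin n)))
    (fun x' ↦ TotalSpace.mk' (EuclideanSpace ℝ (Fin n)) x' (Y x')) x

/-- `θ` is differentiable at `x`. -/
abbrev DiffCoAt (θ : CoField n M) (x : M) : Prop :=
  MDifferentiableAt (𝓡 n) ((𝓡 n).prod 𝓘(ℝ, EuclideanSpace ℝ (Fin n) →L[ℝ] ℝ))
    (fun x' ↦ TotalSpace.mk' (E := fun x : M ↦ (TangentSpace (𝓡 n) x →L[ℝ] ℝ))
      (EuclideanSpace ℝ (Fin n) →L[ℝ] ℝ) x' (θ x')) x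

theorem SmoothAt.diff {f : M → ℝ} {x : M} (h : SmoothAt (n := n) f x) :
    MDifferentiableAt (𝓡 n) 𝓘(ℝ) f x := ContMDiffAt.mdifferentiableAt h (by simp)

theorem SmoothVAt.diff {Y : VField n M} {x : M} (h : SmoothVAt Y x) : DiffVAt Y x :=
  ContMDiffAt.mdifferentiableAt h (by simp)

theorem SmoothCoAt.diff {θ : CoField n M} {x : M} (h : SmoothCoAt θ x) : DiffCoAt θ x :=
  ContMDiffAt.mdifferentiableAt h (by simp)

theorem SmoothVAt.congr {Y Z : VField n M} {x : M} (h : SmoothVAt Y x)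
    (hYZ : ∀ᶠ y in 𝓝 x, Z y = Y y) :
    SmoothVAt Z x :=
  ContMDiffAt.congr_of_eventuallyEq h (hYZ.mono fun y hy ↦ by simp [hy])

theorem SmoothCoAt.congr {θ ψ : CoField n M} {x : M} (h : SmoothCoAt θ x)
    (hψ : ∀ᶠ y in 𝓝 x, ψ y = θ y) : SmoothCoAt ψ x :=
  ContMDiffAt.congr_of_eventuallyEq h (hψ.mono fun y hy ↦ by simp [hy])

theorem SmoothVAt.add {Y Z : VField n M} {x : M} (hY : SmoothVAt Y x) (hZ : SmoothVAt Z x) :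
    SmoothVAt (fun y ↦ Y y + Z y) x := ContMDiffAt.add_section hY hZ

theorem SmoothVAt.sub {Y Z : VField n M} {x : M} (hY : SmoothVAt Y x) (hZ : SmoothVAt Z x) :
    SmoothVAt (fun y ↦ Y y - Z y) x := ContMDiffAt.sub_section hY hZ

theorem SmoothVAt.smul {f : M → ℝ} {Y : VField n M} {x : M} (hf : SmoothAt (n := n) f x)
    (hY : SmoothVAt Y x) : SmoothVAt (fun y ↦ f y • Y y) x := ContMDiffAt.smul_section hf hY

theorem SmoothVAt.sum {ι : Type*} {t : Finset ι} {Y : ι → VField n M} {x : M}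
    (hY : ∀ i ∈ t, SmoothVAt (Y i) x) : SmoothVAt (fun y ↦ ∑ i ∈ t, Y i y) x :=
  ContMDiffAt.sum_section hY

theorem SmoothCoAt.sum_smul {ι : Type*} {t : Finset ι} {f : ι → M → ℝ} {θ : ι → CoField n M}
    {x : M} (hf : ∀ i ∈ t, SmoothAt (n := n) (f i) x) (hθ : ∀ i ∈ t, SmoothCoAt (θ i) x) :
    SmoothCoAt (fun y ↦ ∑ i ∈ t, f i y • θ i y) x :=
  ContMDiffAt.sum_section (V := fun x : M ↦ (TangentSpace (𝓡 n) x →L[ℝ] ℝ))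
    fun i hi ↦ ContMDiffAt.smul_section (hf i hi) (hθ i hi)

theorem smoothVAt_ext {x : M} (v : TangentSpace (𝓡 n) x) : SmoothVAt (ext v) x :=
  contMDiffAt_extend ..

/-- `f` is smooth around `x`. -/
def SmoothNear (f : M → ℝ) (x : M) : Prop := ∀ᶠ y in 𝓝 x, SmoothAt (n := n) f y

/-- `Y` is smooth around `x`. -/
def SmoothVNear (Y : VField n M) (x : M) : Prop := ∀ᶠ y in 𝓝 x, SmoothVAt Y y

/-- `θ` is smooth around `x`. -/
def SmoothCoNear (θ : CoField n M) (x : M) : Prop := ∀ᶠ y in 𝓝 x, SmoothCoAt θ y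

theorem SmoothVNear.at {Y : VField n M} {x : M} (h : SmoothVNear Y x) : SmoothVAt Y x :=
  h.self_of_nhds

theorem SmoothCoNear.at {Y : CoField n M} {x : M} (h : SmoothCoNear Y x) : SmoothCoAt Y x :=
  h.self_of_nhds

theorem SmoothVNear.nhds {Y : VField n M} {x : M} (h : SmoothVNear Y x) :
    ∀ᶠ y in 𝓝 x, SmoothVNear Y y := eventually_eventually_nhds.2 h

theorem SmoothCoNear.nhds {Y : CoField n M} {x : M} (h : SmoothCoNear Y x) :
    ∀ᶠ y in 𝓝 x, SmoothCoNear Y y := eventually_eventually_nhds.2 h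

theorem smoothVNear_ext {x : M} (v : TangentSpace (𝓡 n) x) : SmoothVNear (ext v) x := by
  obtain ⟨s, hs, h⟩ := exists_contMDiffOn_extend (k := ∞) (𝓡 n) (EuclideanSpace ℝ (Fin n)) v
  filter_upwards [eventually_mem_nhds_iff.2 hs] with y hy using h.contMDiffAt hy

theorem smoothCoNear_coext {x : M} (θ : TangentSpace (𝓡 n) x →L[ℝ] ℝ) :
    SmoothCoNear (coext θ) x := by
  obtain ⟨s, hs, h⟩ := exists_contMDiffOn_extend (k := ∞)
    (V := fun x : M ↦ (TangentSpace (𝓡 n) x →L[ℝ] ℝ)) (𝓡 n) (EuclideanSpace ℝ (Fin n) →L[ℝ] ℝ) θ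
  filter_upwards [eventually_mem_nhds_iff.2 hs] with y hy using h.contMDiffAt hy

@[simp] theorem ext_self {x : M} (v : TangentSpace (𝓡 n) x) : ext v x = v := extend_apply_self _ _

@[simp] theorem coext_self {x : M} (θ : TangentSpace (𝓡 n) x →L[ℝ] ℝ) : coext θ x = θ :=
  extend_apply_self (E := fun x : M ↦ (TangentSpace (𝓡 n) x →L[ℝ] ℝ)) _ _

theorem SmoothCoAt.apply {θ : CoField n M} {Y : VField n M} {x : M} (hθ : SmoothCoAt θ x)
    (hY : SmoothVAt Y x) : SmoothAt (n := n) (fun y ↦ θ y (Y y)) x := by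
  have := ContMDiffAt.clm_bundle_apply (E₂ := Bundle.Trivial M ℝ) (F₂ := ℝ) hθ hY
  simpa [contMDiffAt_section] using this

theorem DiffCoAt.apply {θ : CoField n M} {Y : VField n M} {x : M} (hθ : DiffCoAt θ x)
    (hY : DiffVAt Y x) : MDifferentiableAt (𝓡 n) 𝓘(ℝ) (fun y ↦ θ y (Y y)) x := by
  have := MDifferentiableAt.clm_bundle_apply (E₂ := Bundle.Trivial M ℝ) (F₂ := ℝ) hθ hY
  simpa [mdifferentiableAt_section] using this

theorem SmoothVAt.flat (g : Metric n M) {Y : VField n M} {x : M} (hY : SmoothVAt Y x) :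
    SmoothCoAt (fun y ↦ g.inner y (Y y)) x :=
  ContMDiffAt.clm_bundle_apply (E₂ := fun x : M ↦ (TangentSpace (𝓡 n) x →L[ℝ] ℝ))
    (g.contMDiff x) hY

theorem DiffVAt.flat (g : Metric n M) {Y : VField n M} {x : M} (hY : DiffVAt Y x) :
    DiffCoAt (fun y ↦ g.inner y (Y y)) x :=
  MDifferentiableAt.clm_bundle_apply (E₂ := fun x : M ↦ (TangentSpace (𝓡 n) x →L[ℝ] ℝ))
    ((g.contMDiff x).mdifferentiableAt (by simp)) hY

theorem SmoothVAt.inner (g : Metric n M) {Y Z : VField n M} {x : M} (hY : SmoothVAt Y x)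
    (hZ : SmoothVAt Z x) : SmoothAt (n := n) (fun y ↦ g.inner y (Y y) (Z y)) x := (hY.flat g).apply hZ

theorem DiffVAt.inner (g : Metric n M) {Y Z : VField n M} {x : M} (hY : DiffVAt Y x)
    (hZ : DiffVAt Z x) : MDifferentiableAt (𝓡 n) 𝓘(ℝ) (fun y ↦ g.inner y (Y y) (Z y)) x :=
  (DiffVAt.flat g hY).apply hZ

theorem SmoothAt.dirDeriv {f : M → ℝ} {W : VField n M} {x : M} (hf : SmoothAt (n := n) f x)
    (hW : SmoothVAt W x) : SmoothAt (n := n) (fun y ↦ dirDeriv f y (W y)) x := by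
  have h1 := ContMDiffAt.mfderiv_const (I := 𝓡 n) (I' := 𝓘(ℝ)) (m := ∞) hf (by simp)
  have h2 : ContMDiffAt (𝓡 n) ((𝓡 n).prod 𝓘(ℝ, EuclideanSpace ℝ (Fin n))) ∞
    (fun x' ↦ (TotalSpace.mk' (EuclideanSpace ℝ (Fin n)) x' (W x') :
      TangentBundle (𝓡 n) M)) x := hW
  have h3 := ContMDiffAt.clm_apply_of_inCoordinates (IB₂ := 𝓘(ℝ)) (E₂ := fun x : ℝ ↦ TangentSpace 𝓘(ℝ) x)
    (b₂ := f) h1 h2 hf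
  have h4 := (Bundle.contMDiffAt_totalSpace.1 h3).2
  simp only [trivializationAt_model_space_apply] at h4
  exact h4

/-! ### Tensoriality of first order operators -/

section Slot

variable {F : Type*} [NormedAddCommGroup F] [NormedSpace ℝ F] [FiniteDimensional ℝ F]
  {V : M → Type*} [TopologicalSpace (TotalSpace F V)] [∀ x, AddCommGroup (V x)]
  [∀ x, Module ℝ (V x)] [∀ x, TopologicalSpace (V x)] [FiberBundle F V] [VectorBundle ℝ F V]
  [ContMDiffVectorBundle ∞ F V (𝓡 n)]

/-- A field of functionals with differentiable values on smooth sections has differentiable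
values on differentiable sections. -/
theorem mdifferentiableAt_functional {x : M} (m : (y : M) → V y →ₗ[ℝ] ℝ)
    (hm : ∀ σ : (y : M) → V y, (∀ᶠ y in 𝓝 x, ContMDiffAt (𝓡 n) ((𝓡 n).prod 𝓘(ℝ, F)) ∞
      (fun y ↦ TotalSpace.mk' F y (σ y)) y) →
        MDifferentiableAt (𝓡 n) 𝓘(ℝ) (fun y ↦ m y (σ y)) x)
    {σ : (y : M) → V y} (hσ : MDifferentiableAt (𝓡 n) ((𝓡 n).prod 𝓘(ℝ, F))
      (fun y ↦ TotalSpace.mk' F y (σ y)) x) :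
    MDifferentiableAt (𝓡 n) 𝓘(ℝ) (fun y ↦ m y (σ y)) x := by
  have : ContMDiffVectorBundle 1 F V (𝓡 n) := .of_le (n := ∞) (by simp)
  let t := trivializationAt F V x
  have hx : x ∈ t.baseSet := FiberBundle.mem_baseSet_trivializationAt F V x
  let b := Module.finBasis ℝ F
  -- The hypothesis covers smooth sections only. A differentiable section is a combination of smooth
  -- frame sections with differentiable coefficients.
  have h1 : (fun y ↦ m y (σ y)) =ᶠ[𝓝 x]
      fun y ↦ ∑ i, t.localFrameCoeff (𝓡 n) b i y (σ y) * m y (t.localFrame b i y) := by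
    filter_upwards [t.eventually_eq_localFrame_sum_coeff_smul (I := 𝓡 n) (s := σ) b hx] with y hy
    conv_lhs => rw [hy]
    simp
  refine MDifferentiableAt.congr_of_eventuallyEq ?_ h1
  refine mdifferentiableAt_sum _ fun i _ ↦ MDifferentiableAt.mul ?_ ?_
  · exact mdifferentiableAt_localFrameCoeff b hx hσ i
  · refine hm _ ?_
    filter_upwards [t.open_baseSet.mem_nhds hx] with y hy using
      contMDiffAt_localFrame_of_mem _ t b i hy

/-- The two Leibniz terms, `(v f) m(σ)` from the derivative and `m((v f) σ)` from `c`, cancel. Here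
`c` stands for `∇_v` on vectors or on covectors, and `r` collects the corrections from the other
arguments, so that one lemma serves every kind of argument. -/
theorem tensorialAt_slot {x : M} (v : TangentSpace (𝓡 n) x) (m : (y : M) → V y →ₗ[ℝ] ℝ)
    (hm : ∀ σ : (y : M) → V y, (∀ᶠ y in 𝓝 x, ContMDiffAt (𝓡 n) ((𝓡 n).prod 𝓘(ℝ, F)) ∞
      (fun y ↦ TotalSpace.mk' F y (σ y)) y) →
        MDifferentiableAt (𝓡 n) 𝓘(ℝ) (fun y ↦ m y (σ y)) x)
    (c : ((y : M) → V y) → V x)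
    (c_add : ∀ σ τ, MDifferentiableAt (𝓡 n) ((𝓡 n).prod 𝓘(ℝ, F))
      (fun y ↦ TotalSpace.mk' F y (σ y)) x → MDifferentiableAt (𝓡 n) ((𝓡 n).prod 𝓘(ℝ, F))
      (fun y ↦ TotalSpace.mk' F y (τ y)) x → c (σ + τ) = c σ + c τ)
    (c_smul : ∀ (f : M → ℝ) σ, MDifferentiableAt (𝓡 n) 𝓘(ℝ) f x →
      MDifferentiableAt (𝓡 n) ((𝓡 n).prod 𝓘(ℝ, F))
      (fun y ↦ TotalSpace.mk' F y (σ y)) x → c (f • σ) = f x • c σ + dirDeriv f x v • σ x)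
    (r : V x →ₗ[ℝ] ℝ) :
    TensorialAt (𝓡 n) F
      (fun σ ↦ dirDeriv (fun y ↦ m y (σ y)) x v - m x (c σ) - r (σ x)) x where
  smul {f σ} hf hσ := by
    have h := mdifferentiableAt_functional m hm hσ
    rw [c_smul f σ hf hσ]
    have : (fun y ↦ m y ((f • σ) y)) = fun y ↦ f y * m y (σ y) := by ext; simp
    rw [this, dirDeriv_mul hf h]
    simp; ring
  add {σ τ} hσ hτ := by
    rw [c_add _ _ hσ hτ]
    have : (fun y ↦ m y ((σ + τ) y)) = fun y ↦ m y (σ y) + m y (τ y) := by ext; simp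
    rw [this, dirDeriv_add (mdifferentiableAt_functional m hm hσ)
      (mdifferentiableAt_functional m hm hτ)]
    simp; ring

end Slot

/-! ### Raw connections which are connections -/

/-- The laws of a smooth connection for a raw operator. -/
structure IsConn (cov : RawConn n M) : Prop where
  map_add : ∀ Y x v w, cov Y x (v + w) = cov Y x v + cov Y x w
  map_smul : ∀ Y x (c : ℝ) v, cov Y x (c • v) = c • cov Y x v
  add : ∀ {Y Z : VField n M} {x : M}, DiffVAt Y x → DiffVAt Z x →
    ∀ v, cov (Y + Z) x v = cov Y x v + cov Z x v
  leibniz : ∀ {f : M → ℝ} {Y : VField n M} {x : M}, MDifferentiableAt (𝓡 n) 𝓘(ℝ) f x →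
    DiffVAt Y x → ∀ v, cov (f • Y) x v = f x • cov Y x v + dirDeriv f x v • Y x
  smooth : ∀ {Y W : VField n M} {x : M}, SmoothVNear Y x → SmoothVNear W x →
    SmoothVAt (fun y ↦ cov Y y (W y)) x

namespace IsConn

variable {cov : RawConn n M} (hc : IsConn cov)
include hc

theorem smoothNear {Y W : VField n M} {x : M} (hY : SmoothVNear Y x) (hW : SmoothVNear W x) :
    SmoothVNear (fun y ↦ cov Y y (W y)) x := by
  filter_upwards [hY.nhds, hW.nhds] with y h1 h2 using hc.smooth h1 h2

/-- `v (θ(Y)) - θ(∇_v Y)` is tensorial in `Y`. -/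
theorem tensorialAt_covDual {θ : CoField n M} {x : M} (hθ : DiffCoAt θ x)
    (v : TangentSpace (𝓡 n) x) :
    TensorialAt (𝓡 n) (EuclideanSpace ℝ (Fin n))
      (fun Y : VField n M ↦ dirDeriv (fun y ↦ θ y (Y y)) x v - θ x (cov Y x v)) x := by
  have := tensorialAt_slot (F := EuclideanSpace ℝ (Fin n))
    (V := fun x : M ↦ TangentSpace (𝓡 n) x) v (fun y ↦ (θ y).toLinearMap)
    (fun σ hσ ↦ hθ.apply (SmoothVAt.diff hσ.self_of_nhds)) (fun Y ↦ cov Y x v)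
    (fun _ _ h1 h2 ↦ hc.add h1 h2 v) (fun _ _ h1 h2 ↦ hc.leibniz h1 h2 v) 0
  simpa using this

/-- Tensoriality frees `covDual` from the coordinate fields of its definition: a linear functional
is determined by its values on the coordinate basis. -/
theorem covDual_apply {θ : CoField n M} {Y : VField n M} {x : M} (hθ : DiffCoAt θ x)
    (hY : DiffVAt Y x) (v : TangentSpace (𝓡 n) x) :
    covDual cov θ x v (Y x) = dirDeriv (fun y ↦ θ y (Y y)) x v - θ x (cov Y x v) := by
  have h := hc.tensorialAt_covDual hθ v
  rw [← TensorialAt.mkHom_apply h hY]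
  set L := TensorialAt.mkHom _ x h with hL
  have key : ∀ u : EuclideanSpace ℝ (Fin n),
      L u = ∑ i, u i * L (EuclideanSpace.single i (1 : ℝ) : EuclideanSpace ℝ (Fin n)) := by
    intro u
    let L' : EuclideanSpace ℝ (Fin n) →ₗ[ℝ] ℝ := L.toLinearMap
    have h1 : u = ∑ i, u i • (EuclideanSpace.single i (1 : ℝ) : EuclideanSpace ℝ (Fin n)) := by
      ext j; simp [Finset.sum_apply, Pi.single_apply]
    change L' u = ∑ i, u i * L' _
    conv_lhs => rw [h1]
    simp
  have h2 := key (Y x)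
  rw [h2, covDual]
  have : ∀ w : TangentSpace (𝓡 n) x, L w = dirDeriv (fun y ↦ θ y (ext w y)) x v
      - θ x (cov (ext w) x v) := fun w ↦ TensorialAt.mkHom_apply_eq_extend h w
  simp only [FunLike.coe_sum, Finset.sum_apply]
  refine Finset.sum_congr rfl fun i _ ↦ ?_
  rw [mul_comm]
  congr 1

theorem covDual_ext {θ : CoField n M} {x : M} (hθ : DiffCoAt θ x)
    (v w : TangentSpace (𝓡 n) x) :
    covDual cov θ x v w = dirDeriv (fun y ↦ θ y (ext w y)) x v - θ x (cov (ext w) x v) := by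
  simpa using hc.covDual_apply hθ (smoothVAt_ext w).diff v

theorem covDual_map_add (θ : CoField n M) (x : M) (v w : TangentSpace (𝓡 n) x) :
    covDual cov θ x (v + w) = covDual cov θ x v + covDual cov θ x w := by
  simp only [covDual, ← Finset.sum_add_distrib]
  refine Finset.sum_congr rfl fun i _ ↦ ?_
  rw [dirDeriv_add_vec, hc.map_add, _root_.map_add, add_sub_add_comm]
  exact add_smul _ _ _

theorem covDual_map_smul (θ : CoField n M) (x : M) (c : ℝ) (v : TangentSpace (𝓡 n) x) :
    covDual cov θ x (c • v) = c • covDual cov θ x v := by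
  simp only [covDual, Finset.smul_sum]
  refine Finset.sum_congr rfl fun i _ ↦ ?_
  rw [dirDeriv_smul_vec, hc.map_smul, _root_.map_smul, smul_eq_mul, ← mul_sub]
  exact mul_smul _ _ _

/-- With `covDual_leibniz` this makes the induced operator on covectors a connection, as
`tensorialAt_slot` requires for covector arguments. -/
theorem covDual_add {θ ψ : CoField n M} {x : M} (hθ : DiffCoAt θ x) (hψ : DiffCoAt ψ x)
    (v : TangentSpace (𝓡 n) x) :
    covDual cov (θ + ψ) x v = covDual cov θ x v + covDual cov ψ x v := by
  have h : DiffCoAt (θ + ψ) x :=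
    mdifferentiableAt_add_section (E := fun x : M ↦ (TangentSpace (𝓡 n) x →L[ℝ] ℝ)) hθ hψ
  ext w
  rw [add_apply, hc.covDual_ext h, hc.covDual_ext hθ, hc.covDual_ext hψ]
  have : (fun y ↦ (θ + ψ) y (ext w y)) = fun y ↦ θ y (ext w y) + ψ y (ext w y) := by ext; simp
  rw [this, dirDeriv_add (hθ.apply (smoothVAt_ext w).diff) (hψ.apply (smoothVAt_ext w).diff)]
  simp; ring

theorem covDual_leibniz {f : M → ℝ} {θ : CoField n M} {x : M}
    (hf : MDifferentiableAt (𝓡 n) 𝓘(ℝ) f x) (hθ : DiffCoAt θ x) (v : TangentSpace (𝓡 n) x) :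
    covDual cov (f • θ) x v = f x • covDual cov θ x v + dirDeriv f x v • θ x := by
  have h : DiffCoAt (f • θ) x :=
    MDifferentiableAt.smul_section (E := fun x : M ↦ (TangentSpace (𝓡 n) x →L[ℝ] ℝ)) hf hθ
  ext w
  rw [add_apply, hc.covDual_ext h, smul_apply, hc.covDual_ext hθ]
  have : (fun y ↦ (f • θ) y (ext w y)) = fun y ↦ f y * θ y (ext w y) := by ext; simp
  rw [this, dirDeriv_mul hf (hθ.apply (smoothVAt_ext w).diff)]
  simp; ring

end IsConn

/-! ### Orthonormal frames -/

namespace IsOrthonormalFrame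

variable {g : Metric n M} {x : M} {e : Fin n → TangentSpace (𝓡 n) x}
  (he : IsOrthonormalFrame g x e)
include he

theorem inner_sum_right (c : Fin n → ℝ) (i : Fin n) :
    g.inner x (e i) (∑ j, c j • e j) = c i := by
  simp [he i]

theorem linearIndependent : LinearIndependent ℝ e := by
  rw [Fintype.linearIndependent_iff]
  intro c hc i
  rw [← he.inner_sum_right c i, hc, map_zero]

/-- The basis underlying an orthonormal frame. -/
def basis : Module.Basis (Fin n) ℝ (TangentSpace (𝓡 n) x) :=
  haveI : FiniteDimensional ℝ (TangentSpace (𝓡 n) x) :=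
    inferInstanceAs (FiniteDimensional ℝ (EuclideanSpace ℝ (Fin n)))
  haveI : Nonempty (Fin n) ∨ IsEmpty (Fin n) := (isEmpty_or_nonempty _).symm
  Module.Basis.mk he.linearIndependent (by
    have h : Module.finrank ℝ (TangentSpace (𝓡 n) x) = n :=
      finrank_euclideanSpace_fin (𝕜 := ℝ) (n := n)
    rw [he.linearIndependent.span_eq_top_of_card_eq_finrank' (by simp [h])])

theorem expand (w : TangentSpace (𝓡 n) x) : ∑ i, g.inner x (e i) w • e i = w := by
  have h := he.basis.sum_repr w
  have hb : ∀ i, he.basis i = e i := fun i ↦ by simp [basis]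
  simp only [hb] at h
  conv_rhs => rw [← h]
  refine Finset.sum_congr rfl fun i _ ↦ ?_
  congr 1
  conv_lhs => rw [← h]
  exact he.inner_sum_right _ i

theorem expand_co (θ : TangentSpace (𝓡 n) x →L[ℝ] ℝ) : ∑ i, θ (e i) • g.inner x (e i) = θ := by
  ext w
  conv_rhs => rw [← he.expand w]
  simp [mul_comm]

theorem eq_of_inner {u w : TangentSpace (𝓡 n) x} (h : ∀ i, g.inner x (e i) u = g.inner x (e i) w) :
    u = w := by
  rw [← he.expand u, ← he.expand w]; simp only [h]

theorem parseval (u w : TangentSpace (𝓡 n) x) :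
    ∑ i, g.inner x (e i) u * g.inner x (e i) w = g.inner x u w := by
  conv_rhs => rw [← he.expand u]
  simp

end IsOrthonormalFrame

theorem frame_orthonormal (g : Metric n M) (x : M) : IsOrthonormalFrame g x (frame g x) :=
  (exists_orthonormalFrame g x).choose_spec

theorem SmoothAt.sum {ι : Type*} {t : Finset ι} {f : ι → M → ℝ} {x : M}
    (hf : ∀ i ∈ t, SmoothAt (n := n) (f i) x) :
    SmoothAt (n := n) (fun y ↦ ∑ i ∈ t, f i y) x := contMDiffAt_finsetSum hf

/-- Gram-Schmidt: orthonormal frames at a point extend to smooth orthonormal frames. -/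
theorem exists_smooth_frame (g : Metric n M) (x : M) {e : Fin n → TangentSpace (𝓡 n) x}
    (he : IsOrthonormalFrame g x e) :
    ∃ E : Fin n → VField n M, (∀ i, E i x = e i) ∧ (∀ i, SmoothVNear (E i) x) ∧
      ∀ᶠ y in 𝓝 x, IsOrthonormalFrame g y (fun i ↦ E i y) := by
  suffices H : ∀ m : ℕ, m ≤ n → ∃ E : Fin n → VField n M, (∀ i, E i x = e i) ∧
      (∀ i, SmoothVNear (E i) x) ∧ ∀ᶠ y in 𝓝 x, ∀ i j : Fin n, (i : ℕ) < m → (j : ℕ) < m →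
        g.inner y (E i y) (E j y) = if i = j then 1 else 0 by
    obtain ⟨E, h1, h2, h3⟩ := H n le_rfl
    exact ⟨E, h1, h2, h3.mono fun y hy i j ↦ hy i j i.2 j.2⟩
  intro m
  induction m with
  | zero => exact fun _ ↦ ⟨fun i ↦ ext (e i), fun i ↦ ext_self _, fun i ↦ smoothVNear_ext _, by simp⟩
  | succ m ih =>
    intro hm
    obtain ⟨E, h1, h2, h3⟩ := ih (by omega)
    let q : Fin n := ⟨m, hm⟩
    let S : Finset (Fin n) := {j | (j : ℕ) < m}
    let V : VField n M := fun y ↦ E q y - ∑ j ∈ S, g.inner y (E q y) (E j y) • E j y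
    -- At `x` the vector `E q x = e q` is already orthogonal to its predecessors, so orthogonalising
    -- and normalising do not change the prescribed frame there.
    have hVx : V x = e q := by
      have : ∀ j ∈ S, g.inner x (E q x) (E j x) • E j x = 0 := fun j hj ↦ by
        have hj' : (j : ℕ) < m := by simpa [S] using hj
        have : q ≠ j := fun h ↦ by simp [← h, q] at hj'
        rw [h1, h1, he, if_neg this, zero_smul]
      simp only [V]
      rw [Finset.sum_eq_zero this, sub_zero, h1]
    have hV : SmoothVNear V x := by
      filter_upwards [eventually_all.2 h2] with y hy
      exact (hy q).sub (SmoothVAt.sum fun j _ ↦ SmoothVAt.smul ((hy q).inner g (hy j)) (hy j))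
    -- The squared length is `1` at `x` and continuous; positivity makes the inverse square root
    -- smooth nearby.
    have hpos : ∀ᶠ y in 𝓝 x, 0 < g.inner y (V y) (V y) := by
      have h0 : g.inner x (V x) (V x) = 1 := by rw [hVx, he, if_pos rfl]
      have hcont : ContinuousAt (fun y ↦ g.inner y (V y) (V y)) x :=
        (hV.at.inner g hV.at).continuousAt
      exact hcont.eventually (lt_mem_nhds (by change 0 < g.inner x (V x) (V x); rw [h0]; norm_num))
    have hVE : ∀ᶠ y in 𝓝 x, ∀ j : Fin n, (j : ℕ) < m → g.inner y (V y) (E j y) = 0 := by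
      filter_upwards [h3] with y hy j hj
      have : ∀ i ∈ S, g.inner y (E q y) (E i y) * g.inner y (E i y) (E j y)
          = if i = j then g.inner y (E q y) (E j y) else 0 := fun i hi ↦ by
        rw [hy i j (by simpa [S] using hi) hj]
        split_ifs with h
        · rw [h, mul_one]
        · rw [mul_zero]
      simp only [V, map_sub, map_sum, map_smul, sub_apply, FunLike.coe_sum, Finset.sum_apply,
        FunLike.coe_smul, Pi.smul_apply, smul_eq_mul]
      rw [Finset.sum_congr rfl this, Finset.sum_ite_eq', if_pos (by simpa [S] using hj), sub_self]
    let W : VField n M := fun y ↦ (Real.sqrt (g.inner y (V y) (V y)))⁻¹ • V y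
    refine ⟨Function.update E q W, fun i ↦ ?_, fun i ↦ ?_, ?_⟩
    · by_cases hi : i = q
      · subst hi
        simp only [Function.update_self, W]
        rw [hVx, he, if_pos rfl]; simp
      · rw [Function.update_of_ne hi, h1]
    · by_cases hi : i = q
      · subst hi
        rw [Function.update_self]
        filter_upwards [hV, hpos] with y hy hp
        refine SmoothVAt.smul ?_ hy
        have h := hy.inner g hy
        have h' : ContDiffAt ℝ ∞ (fun t : ℝ ↦ (Real.sqrt t)⁻¹) (g.inner y (V y) (V y)) :=
          (Real.contDiffAt_sqrt hp.ne').inv (Real.sqrt_pos.2 hp).ne'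
        exact ContMDiffAt.comp (f := fun y ↦ g.inner y (V y) (V y)) y h'.contMDiffAt h
      · rw [Function.update_of_ne hi]; exact h2 i
    · filter_upwards [h3, hpos, hVE] with y hy hp hve i j hi hj
      have hlt : ∀ i : Fin n, (i : ℕ) < m + 1 → i ≠ q → (i : ℕ) < m := fun i hi hiq ↦ by
        have : (i : ℕ) ≠ m := fun h ↦ hiq (Fin.ext h)
        omega
      have hs := Real.mul_self_sqrt hp.le
      have hs' := (Real.sqrt_pos.2 hp).ne'
      by_cases hiq : i = q <;> by_cases hjq : j = q
      · rw [if_pos (hiq.trans hjq.symm), hiq, hjq, Function.update_self]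
        simp only [W, map_smul, smul_apply, smul_eq_mul]
        field_simp
        rw [pow_two, hs]
      · rw [hiq, if_neg (Ne.symm hjq), Function.update_self, Function.update_of_ne hjq]
        simp only [W, map_smul, smul_apply, smul_eq_mul]
        rw [hve j (hlt j hj hjq), mul_zero]
      · rw [hjq, if_neg hiq, Function.update_self, Function.update_of_ne hiq]
        simp only [W, map_smul, smul_eq_mul]
        rw [g.symm y (E i y), hve i (hlt i hi hiq), mul_zero]
      · rw [Function.update_of_ne hiq, Function.update_of_ne hjq]
        exact hy i j (hlt i hi hiq) (hlt j hj hjq)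

/-- The defining formula uses the chart chosen at the point of evaluation, which need not vary
regularly. Near `x` the covector is therefore expanded in one smooth orthonormal coframe. -/
theorem IsConn.covDual_smooth (g : Metric n M) {cov : RawConn n M} (hc : IsConn cov)
    {θ : CoField n M} {W : VField n M} {x : M} (hθ : SmoothCoNear θ x)
    (hW : SmoothVNear W x) : SmoothCoAt (fun y ↦ covDual cov θ y (W y)) x := by
  obtain ⟨E, -, h2, h3⟩ := exists_smooth_frame g x (frame_orthonormal g x)
  have key : ∀ᶠ y in 𝓝 x, covDual cov θ y (W y)
      = ∑ i, (dirDeriv (fun y' ↦ θ y' (E i y')) y (W y) - θ y (cov (E i) y (W y)))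
        • g.inner y (E i y) := by
    filter_upwards [eventually_all.2 h2, h3, hθ] with y hy2 hy3 hyθ
    rw [← hy3.expand_co (covDual cov θ y (W y))]
    refine Finset.sum_congr rfl fun i _ ↦ ?_
    rw [hc.covDual_apply hyθ.diff (hy2 i).diff]
  refine SmoothCoAt.congr (SmoothCoAt.sum_smul (fun i _ ↦ ?_) fun i _ ↦ (h2 i).at.flat g) key
  exact ((hθ.at.apply (h2 i).at).dirDeriv hW.at).sub (hθ.at.apply (hc.smooth (h2 i) hW))

/-- A criterion of smoothness for vector fields. -/
theorem smoothVAt_of_inner (g : Metric n M) {Z : VField n M} {x : M}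
    (h : ∀ Y : VField n M, SmoothVNear Y x → SmoothAt (n := n) (fun y ↦ g.inner y (Y y) (Z y)) x) :
    SmoothVAt Z x := by
  obtain ⟨E, -, h2, h3⟩ := exists_smooth_frame g x (frame_orthonormal g x)
  have key : ∀ᶠ y in 𝓝 x, Z y = ∑ i, g.inner y (E i y) (Z y) • E i y :=
    h3.mono fun y hy ↦ (hy.expand _).symm
  exact SmoothVAt.congr (SmoothVAt.sum fun i _ ↦ SmoothVAt.smul (h _ (h2 i)) (h2 i).at) key

/-! ### Tensor fields and their covariant derivatives -/

/-- Tensor fields, with smoothness tested on fields that are smooth around a point. -/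
structure IsTF {l k : ℕ} (s : RawField n M l k) : Prop where
  update_add : ∀ x z θ p u w, s x (Function.update z p (u + w)) θ
    = s x (Function.update z p u) θ + s x (Function.update z p w) θ
  update_smul : ∀ x z θ p (c : ℝ) u, s x (Function.update z p (c • u)) θ
    = c * s x (Function.update z p u) θ
  co_add : ∀ x z θ p u w, s x z (Function.update θ p (u + w))
    = s x z (Function.update θ p u) + s x z (Function.update θ p w)
  co_smul : ∀ x z θ p (c : ℝ) u, s x z (Function.update θ p (c • u))
    = c * s x z (Function.update θ p u)
  smooth : ∀ (x : M) (Y : Fin k → VField n M) (Θ : Fin l → CoField n M),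
    (∀ i, SmoothVNear (Y i) x) → (∀ j, SmoothCoNear (Θ j) x) →
      SmoothAt (n := n) (fun y ↦ s y (fun i ↦ Y i y) (fun j ↦ Θ j y)) x

/-- The passage to `IsTF` makes the notion stable under covariant differentiation: smoothness of
order `∞` at a single point only yields, for each `m`, a neighbourhood of class `C^m`, whereas
`IsConn.smooth` asks for fields smooth on one neighbourhood. -/
theorem IsTensorField.isTF {l k : ℕ} {s : RawField n M l k} (hs : IsTensorField s) : IsTF s where
  update_add x z θ p u w := by
    obtain ⟨S, hS⟩ := hs.multilinear x
    simp only [hS, S.map_update_add, add_apply]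
  update_smul x z θ p c u := by
    obtain ⟨S, hS⟩ := hs.multilinear x
    simp only [hS, S.map_update_smul, smul_apply, smul_eq_mul]
  co_add x z θ p u w := by
    obtain ⟨S, hS⟩ := hs.multilinear x
    simp only [hS, MultilinearMap.map_update_add]
  co_smul x z θ p c u := by
    obtain ⟨S, hS⟩ := hs.multilinear x
    simp only [hS, MultilinearMap.map_update_smul, smul_eq_mul]
  smooth x Y Θ hY hΘ := hs.smooth x Y Θ (fun i ↦ (hY i).at) fun j ↦ (hΘ j).at

namespace IsTF

variable {l k : ℕ} {s t : RawField n M l k}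

/-- A tensor at `x` as a multilinear map of the vectors. -/
def multi (hs : IsTF s) (x : M) (θ : Fin l → (TangentSpace (𝓡 n) x →L[ℝ] ℝ)) :
    MultilinearMap ℝ (fun _ : Fin k ↦ TangentSpace (𝓡 n) x) ℝ :=
  MultilinearMap.mk' (fun z ↦ s x z θ) (fun z p u w ↦ hs.update_add x z θ p u w)
    (fun z p c u ↦ hs.update_smul x z θ p c u)

/-- A tensor at `x` as a multilinear map of the covectors. -/
def multiCo (hs : IsTF s) (x : M) (z : Fin k → TangentSpace (𝓡 n) x) :
    MultilinearMap ℝ (fun _ : Fin l ↦ (TangentSpace (𝓡 n) x →L[ℝ] ℝ)) ℝ :=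
  MultilinearMap.mk' (fun θ ↦ s x z θ) (fun θ p u w ↦ hs.co_add x z θ p u w)
    (fun θ p c u ↦ hs.co_smul x z θ p c u)

theorem multi_apply (hs : IsTF s) (x : M) (z θ) : hs.multi x θ z = s x z θ := rfl

theorem multiCo_apply (hs : IsTF s) (x : M) (z θ) : hs.multiCo x z θ = s x z θ := rfl

theorem update_sum (hs : IsTF s) (x : M) (z θ p) {ι : Type*} (t : Finset ι)
    (u : ι → TangentSpace (𝓡 n) x) :
    s x (Function.update z p (∑ i ∈ t, u i)) θ = ∑ i ∈ t, s x (Function.update z p (u i)) θ :=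
  map_sum ((hs.multi x θ).toLinearMap z p) u t

theorem co_sum (hs : IsTF s) (x : M) (z θ p) {ι : Type*} (t : Finset ι)
    (u : ι → (TangentSpace (𝓡 n) x →L[ℝ] ℝ)) :
    s x z (Function.update θ p (∑ i ∈ t, u i)) = ∑ i ∈ t, s x z (Function.update θ p (u i)) :=
  map_sum ((hs.multiCo x z).toLinearMap θ p) u t

theorem smoothNear (hs : IsTF s) {x : M} {Y : Fin k → VField n M} {Θ : Fin l → CoField n M}
    (hY : ∀ i, SmoothVNear (Y i) x) (hΘ : ∀ j, SmoothCoNear (Θ j) x) :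
    SmoothNear (n := n) (fun y ↦ s y (fun i ↦ Y i y) (fun j ↦ Θ j y)) x := by
  filter_upwards [eventually_all.2 fun i ↦ (hY i).nhds, eventually_all.2 fun j ↦ (hΘ j).nhds]
    with y h1 h2 using hs.smooth y Y Θ h1 h2

theorem add (hs : IsTF s) (ht : IsTF t) : IsTF (s + t) where
  update_add x z θ p u w := by
    simp only [Pi.add_apply, hs.update_add, ht.update_add]; ring
  update_smul x z θ p c u := by
    simp only [Pi.add_apply, hs.update_smul, ht.update_smul]; ring
  co_add x z θ p u w := by
    simp only [Pi.add_apply, hs.co_add, ht.co_add]; ring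
  co_smul x z θ p c u := by
    simp only [Pi.add_apply, hs.co_smul, ht.co_smul]; ring
  smooth x Y Θ hY hΘ := ContMDiffAt.add (hs.smooth x Y Θ hY hΘ) (ht.smooth x Y Θ hY hΘ)

theorem const_smul (c : ℝ) (hs : IsTF s) : IsTF (c • s) where
  update_add x z θ p u w := by
    simp only [Pi.smul_apply, hs.update_add, smul_eq_mul]; ring
  update_smul x z θ p c u := by
    simp only [Pi.smul_apply, hs.update_smul, smul_eq_mul]; ring
  co_add x z θ p u w := by
    simp only [Pi.smul_apply, hs.co_add, smul_eq_mul]; ring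
  co_smul x z θ p c u := by
    simp only [Pi.smul_apply, hs.co_smul, smul_eq_mul]; ring
  smooth x Y Θ hY hΘ := ContMDiffAt.mul contMDiffAt_const (hs.smooth x Y Θ hY hΘ)

theorem zero : IsTF (0 : RawField n M l k) where
  update_add x z θ p u w := by simp
  update_smul x z θ p c u := by simp
  co_add x z θ p u w := by simp
  co_smul x z θ p c u := by simp
  smooth x Y Θ hY hΘ := contMDiffAt_const

theorem sum {ι : Type*} {f : ι → RawField n M l k} (t : Finset ι) (h : ∀ i ∈ t, IsTF (f i)) :
    IsTF (∑ i ∈ t, f i) := by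
  classical
  induction t using Finset.induction_on with
  | empty => simpa using zero
  | insert a t ha ih =>
    rw [Finset.sum_insert ha]
    exact (h a (by simp)).add (ih fun i hi ↦ h i (by simp [hi]))

theorem neg (hs : IsTF s) : IsTF (-s) := by simpa using hs.const_smul (-1)

theorem sub (hs : IsTF s) (ht : IsTF t) : IsTF (s - t) := by
  rw [sub_eq_add_neg]; exact hs.add ht.neg

end IsTF

/-- `v(s(Y, Θ)) - ∑ᵢ s(…, ∇_v Yᵢ, …, Θ) - ∑ⱼ s(Y, …, ∇_v Θⱼ, …)`. -/
def covDerivOn (cov : RawConn n M) {l k : ℕ} (s : RawField n M l k) (x : M)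
    (v : TangentSpace (𝓡 n) x) (Y : Fin k → VField n M) (Θ : Fin l → CoField n M) : ℝ :=
  dirDeriv (fun y ↦ s y (fun i ↦ Y i y) (fun j ↦ Θ j y)) x v
    - ∑ i, s x (Function.update (fun i ↦ Y i x) i (cov (Y i) x v)) (fun j ↦ Θ j x)
    - ∑ j, s x (fun i ↦ Y i x) (Function.update (fun j ↦ Θ j x) j (covDual cov (Θ j) x v))

theorem covDeriv_eq_covDerivOn (cov : RawConn n M) {l k : ℕ} (s : RawField n M l k) (x : M)
    (y θ) : covDeriv cov s x y θ
      = covDerivOn cov s x (y 0) (fun i ↦ ext (y i.succ)) (fun j ↦ coext (θ j)) := by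
  simp [covDeriv, covDerivOn]

theorem eval_update {ι : Type*} [DecidableEq ι] {T : M → Type*} (Y : ι → (x : M) → T x) (p : ι)
    (σ : (x : M) → T x) (y : M) :
    (fun i ↦ Function.update Y p σ i y) = Function.update (fun i ↦ Y i y) p (σ y) := by
  ext i
  by_cases h : i = p
  · subst h; simp
  · simp [h]

theorem smoothVNear_update {ι : Type*} [DecidableEq ι] {Y : ι → VField n M} {x : M}
    (hY : ∀ i, SmoothVNear (Y i) x) (p : ι) {σ : VField n M} (hσ : SmoothVNear σ x) (i : ι) :
    SmoothVNear (Function.update Y p σ i) x := by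
  by_cases h : i = p
  · subst h; simpa
  · simpa [h] using hY i

theorem smoothCoNear_update {ι : Type*} [DecidableEq ι] {Y : ι → CoField n M} {x : M}
    (hY : ∀ i, SmoothCoNear (Y i) x) (p : ι) {σ : CoField n M} (hσ : SmoothCoNear σ x) (i : ι) :
    SmoothCoNear (Function.update Y p σ i) x := by
  by_cases h : i = p
  · subst h; simpa
  · simpa [h] using hY i

section

variable {cov : RawConn n M} (hc : IsConn cov) {l k : ℕ} {s : RawField n M l k} (hs : IsTF s)
include hc hs

/-- The corrections for the arguments other than `p` depend linearly on `σ x` alone; they form the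
term `r` of `tensorialAt_slot`. -/
theorem tensorialAt_covDerivOn {x : M} (v : TangentSpace (𝓡 n) x) {Y : Fin k → VField n M}
    {Θ : Fin l → CoField n M} (hY : ∀ i, SmoothVNear (Y i) x) (hΘ : ∀ j, SmoothCoNear (Θ j) x)
    (p : Fin k) :
    TensorialAt (𝓡 n) (EuclideanSpace ℝ (Fin n))
      (fun σ : VField n M ↦ covDerivOn cov s x v (Function.update Y p σ) Θ) x := by
  let Yx := fun i ↦ Y i x
  let Θx := fun j ↦ Θ j x
  convert! tensorialAt_slot (F := EuclideanSpace ℝ (Fin n))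
    (V := fun x : M ↦ TangentSpace (𝓡 n) x) v
    (fun y ↦ (hs.multi y (fun j ↦ Θ j y)).toLinearMap (fun i ↦ Y i y) p)
    (fun σ hσ ↦ ?_) (fun Y ↦ cov Y x v)
    (fun _ _ h1 h2 ↦ hc.add h1 h2 v) (fun _ _ h1 h2 ↦ hc.leibniz h1 h2 v)
    (∑ i ∈ Finset.univ.erase p,
        (hs.multi x Θx).toLinearMap (Function.update Yx i (cov (Y i) x v)) p
      + ∑ j, (hs.multi x (Function.update Θx j (covDual cov (Θ j) x v))).toLinearMap Yx p)
    using 2 with σ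
  · simp only [covDerivOn, eval_update, MultilinearMap.toLinearMap_apply, hs.multi_apply,
      LinearMap.add_apply, LinearMap.sum_apply]
    rw [← Finset.add_sum_erase _ _ (Finset.mem_univ p)]
    simp only [Function.update_self, Function.update_idem]
    have : ∀ i ∈ Finset.univ.erase p,
        s x (Function.update (Function.update (fun i ↦ Y i x) p (σ x)) i
          (cov (Function.update Y p σ i) x v)) (fun j ↦ Θ j x)
        = s x (Function.update (Function.update Yx i (cov (Y i) x v)) p (σ x)) Θx := by
      intro i hi
      have hip := Finset.ne_of_mem_erase hi
      rw [Function.update_of_ne hip, Function.update_comm hip.symm]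
    rw [Finset.sum_congr rfl this]
    ring
  · have := hs.smooth x _ Θ (smoothVNear_update hY p (σ := σ) hσ) hΘ
    simp only [eval_update] at this
    exact this.diff

theorem tensorialAt_covDerivOn_co {x : M} (v : TangentSpace (𝓡 n) x) {Y : Fin k → VField n M}
    {Θ : Fin l → CoField n M} (hY : ∀ i, SmoothVNear (Y i) x) (hΘ : ∀ j, SmoothCoNear (Θ j) x)
    (p : Fin l) :
    TensorialAt (𝓡 n) (EuclideanSpace ℝ (Fin n) →L[ℝ] ℝ)
      (fun σ : CoField n M ↦ covDerivOn cov s x v Y (Function.update Θ p σ)) x := by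
  let Yx := fun i ↦ Y i x
  let Θx := fun j ↦ Θ j x
  convert! tensorialAt_slot (F := EuclideanSpace ℝ (Fin n) →L[ℝ] ℝ)
    (V := fun x : M ↦ (TangentSpace (𝓡 n) x →L[ℝ] ℝ)) v
    (fun y ↦ (hs.multiCo y (fun i ↦ Y i y)).toLinearMap (fun j ↦ Θ j y) p)
    (fun σ hσ ↦ ?_) (fun θ ↦ covDual cov θ x v)
    (fun _ _ h1 h2 ↦ hc.covDual_add h1 h2 v) (fun _ _ h1 h2 ↦ hc.covDual_leibniz h1 h2 v)
    (∑ i, (hs.multiCo x (Function.update Yx i (cov (Y i) x v))).toLinearMap Θx p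
      + ∑ j ∈ Finset.univ.erase p,
        (hs.multiCo x Yx).toLinearMap (Function.update Θx j (covDual cov (Θ j) x v)) p)
    using 2 with σ
  · simp only [covDerivOn, MultilinearMap.toLinearMap_apply, hs.multiCo_apply,
      LinearMap.add_apply, LinearMap.sum_apply,
      eval_update (T := fun x : M ↦ (TangentSpace (𝓡 n) x →L[ℝ] ℝ))]
    rw [← Finset.add_sum_erase (a := p) Finset.univ (fun j ↦ s x (fun i ↦ Y i x)
      (Function.update (Function.update (fun j ↦ Θ j x) p (σ x)) j
        (covDual cov (Function.update Θ p σ j) x v))) (Finset.mem_univ p)]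
    simp only [Function.update_self, Function.update_idem]
    have : ∀ j ∈ Finset.univ.erase p,
        s x (fun i ↦ Y i x) (Function.update (Function.update (fun j ↦ Θ j x) p (σ x)) j
          (covDual cov (Function.update Θ p σ j) x v))
        = s x Yx (Function.update (Function.update Θx j (covDual cov (Θ j) x v)) p (σ x)) := by
      intro i hi
      have hip := Finset.ne_of_mem_erase hi
      rw [Function.update_of_ne hip, Function.update_comm hip.symm]
    rw [Finset.sum_congr rfl this]
    ring
  · have := hs.smooth x Y _ hY (smoothCoNear_update hΘ p (σ := σ) hσ)
    simp only [eval_update (T := fun x : M ↦ (TangentSpace (𝓡 n) x →L[ℝ] ℝ))] at this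
    exact this.diff

/-- Tensoriality holds in one argument at a time, with the others smooth around `x`; the extensions
are therefore exchanged one by one, through `Finset.piecewise`. -/
theorem covDerivOn_congr {x : M} (v : TangentSpace (𝓡 n) x) {Y Y' : Fin k → VField n M}
    {Θ Θ' : Fin l → CoField n M} (hY : ∀ i, SmoothVNear (Y i) x) (hΘ : ∀ j, SmoothCoNear (Θ j) x)
    (hY' : ∀ i, SmoothVNear (Y' i) x) (hΘ' : ∀ j, SmoothCoNear (Θ' j) x)
    (h : ∀ i, Y' i x = Y i x) (h' : ∀ j, Θ' j x = Θ j x) :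
    covDerivOn cov s x v Y' Θ' = covDerivOn cov s x v Y Θ := by
  have h1 : ∀ t : Finset (Fin k), covDerivOn cov s x v (t.piecewise Y' Y) Θ'
      = covDerivOn cov s x v Y Θ' := by
    intro t
    induction t using Finset.induction_on with
    | empty => simp
    | insert a t ha ih =>
      have hp : ∀ i, SmoothVNear (t.piecewise Y' Y i) x := fun i ↦ by
        by_cases hi : i ∈ t
        · simpa [hi] using hY' i
        · simpa [hi] using hY i
      rw [← ih, Finset.piecewise_insert]
      have := (tensorialAt_covDerivOn hc hs v hp hΘ' a).pointwise (σ := Y' a)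
        (σ' := t.piecewise Y' Y a) (hY' a).at.diff (hp a).at.diff (by simp [ha, h])
      simpa using this
  have h2 : ∀ t : Finset (Fin l), covDerivOn cov s x v Y (t.piecewise Θ' Θ)
      = covDerivOn cov s x v Y Θ := by
    intro t
    induction t using Finset.induction_on with
    | empty => simp
    | insert a t ha ih =>
      have hp : ∀ i, SmoothCoNear (t.piecewise Θ' Θ i) x := fun i ↦ by
        by_cases hi : i ∈ t
        · simpa [hi] using hΘ' i
        · simpa [hi] using hΘ i
      rw [← ih, Finset.piecewise_insert]
      have := (tensorialAt_covDerivOn_co hc hs v hY hp a).pointwise (σ := Θ' a)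
        (σ' := t.piecewise Θ' Θ a) (hΘ' a).at.diff (hp a).at.diff (by simp [ha, h'])
      simpa using this
  have h3 := h1 Finset.univ
  have h4 := h2 Finset.univ
  simp only [Finset.piecewise_univ] at h3 h4
  rw [h3, h4]

/-- The covariant derivative can be computed with any extensions of the arguments. -/
theorem covDeriv_apply {x : M} (v : TangentSpace (𝓡 n) x) {Y : Fin k → VField n M}
    {Θ : Fin l → CoField n M} (hY : ∀ i, SmoothVNear (Y i) x) (hΘ : ∀ j, SmoothCoNear (Θ j) x) :
    covDeriv cov s x (Fin.cons v (fun i ↦ Y i x)) (fun j ↦ Θ j x)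
      = covDerivOn cov s x v Y Θ := by
  rw [covDeriv_eq_covDerivOn]
  exact covDerivOn_congr hc hs _ hY hΘ (fun i ↦ smoothVNear_ext _) (fun j ↦ smoothCoNear_coext _)
    (by simp) (by simp)

theorem covDerivOn_map_add (x : M) (v w : TangentSpace (𝓡 n) x) (Y : Fin k → VField n M)
    (Θ : Fin l → CoField n M) :
    covDerivOn cov s x (v + w) Y Θ = covDerivOn cov s x v Y Θ + covDerivOn cov s x w Y Θ := by
  simp only [covDerivOn, dirDeriv_add_vec, hc.map_add, hc.covDual_map_add, hs.update_add, hs.co_add,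
    Finset.sum_add_distrib]
  ring

theorem covDerivOn_map_smul (x : M) (c : ℝ) (v : TangentSpace (𝓡 n) x) (Y : Fin k → VField n M)
    (Θ : Fin l → CoField n M) :
    covDerivOn cov s x (c • v) Y Θ = c * covDerivOn cov s x v Y Θ := by
  simp only [covDerivOn, dirDeriv_smul_vec, hc.map_smul, hc.covDual_map_smul, hs.update_smul,
    hs.co_smul, ← Finset.mul_sum]
  ring

/-- This allows covariant derivatives to be iterated. Linearity is that of the direction in the
first place and tensoriality in the others; the metric only supplies the smooth frames of
`covDual_smooth`. -/
theorem IsTF.covDeriv (g : Metric n M) : IsTF (covDeriv cov s) where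
  update_add x z θ p u w := by
    simp only [covDeriv_eq_covDerivOn]
    refine Fin.cases ?_ (fun p ↦ ?_) p
    · simpa using covDerivOn_map_add hc hs x u w _ _
    · have key : ∀ u, (fun i : Fin k ↦ ext (Function.update z p.succ u i.succ))
          = Function.update (fun i : Fin k ↦ ext (z i.succ)) p (ext u) := by
        intro u; ext i : 1
        by_cases h : i = p
        · subst h; simp
        · simp [h]
      simp only [key, Function.update_of_ne (Fin.succ_ne_zero p).symm]
      have h := tensorialAt_covDerivOn hc hs (z 0) (fun i ↦ smoothVNear_ext (z i.succ))
        (fun j ↦ smoothCoNear_coext (θ j)) p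
      exact map_add (TensorialAt.mkHom _ x h) u w
  update_smul x z θ p c u := by
    simp only [covDeriv_eq_covDerivOn]
    refine Fin.cases ?_ (fun p ↦ ?_) p
    · simpa using covDerivOn_map_smul hc hs x c u _ _
    · have key : ∀ u, (fun i : Fin k ↦ ext (Function.update z p.succ u i.succ))
          = Function.update (fun i : Fin k ↦ ext (z i.succ)) p (ext u) := by
        intro u; ext i : 1
        by_cases h : i = p
        · subst h; simp
        · simp [h]
      simp only [key, Function.update_of_ne (Fin.succ_ne_zero p).symm]
      have h := tensorialAt_covDerivOn hc hs (z 0) (fun i ↦ smoothVNear_ext (z i.succ))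
        (fun j ↦ smoothCoNear_coext (θ j)) p
      exact map_smul (TensorialAt.mkHom _ x h) c u
  co_add x z θ p u w := by
    simp only [covDeriv_eq_covDerivOn]
    have key : ∀ u, (fun i : Fin l ↦ coext (Function.update θ p u i))
        = Function.update (fun i : Fin l ↦ coext (θ i)) p (coext u) := by
      intro u; ext i : 1
      by_cases h : i = p
      · subst h; simp
      · simp [h]
    simp only [key]
    have h := tensorialAt_covDerivOn_co hc hs (z 0) (fun i ↦ smoothVNear_ext (z i.succ))
      (fun j ↦ smoothCoNear_coext (θ j)) p
    exact map_add (TensorialAt.mkHom _ x h) u w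
  co_smul x z θ p c u := by
    simp only [covDeriv_eq_covDerivOn]
    have key : ∀ u, (fun i : Fin l ↦ coext (Function.update θ p u i))
        = Function.update (fun i : Fin l ↦ coext (θ i)) p (coext u) := by
      intro u; ext i : 1
      by_cases h : i = p
      · subst h; simp
      · simp [h]
    simp only [key]
    have h := tensorialAt_covDerivOn_co hc hs (z 0) (fun i ↦ smoothVNear_ext (z i.succ))
      (fun j ↦ smoothCoNear_coext (θ j)) p
    exact map_smul (TensorialAt.mkHom _ x h) c u
  smooth x Y Θ hY hΘ := by
    have hY' : ∀ i : Fin k, SmoothVNear (Y i.succ) x := fun i ↦ hY _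
    have h1 : (fun y ↦ StatGeom.covDeriv cov s y (fun i ↦ Y i y) (fun j ↦ Θ j y)) =ᶠ[𝓝 x]
        fun y ↦ covDerivOn cov s y (Y 0 y) (fun i ↦ Y i.succ) Θ := by
      filter_upwards [eventually_all.2 fun i ↦ (hY' i).nhds,
        eventually_all.2 fun j ↦ (hΘ j).nhds] with y h1 h2
      rw [← covDeriv_apply hc hs _ h1 h2]
      congr 1
      ext i : 1
      refine Fin.cases ?_ (fun i ↦ ?_) i <;> simp
    refine ContMDiffAt.congr_of_eventuallyEq ?_ h1
    unfold covDerivOn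
    refine ContMDiffAt.sub (ContMDiffAt.sub ?_ ?_) ?_
    · exact (hs.smooth x _ Θ hY' hΘ).dirDeriv (hY 0).at
    · refine SmoothAt.sum fun i _ ↦ ?_
      have := hs.smooth x _ Θ (smoothVNear_update hY' i (hc.smoothNear (hY' i) (hY 0))) hΘ
      simpa only [eval_update] using this
    · refine SmoothAt.sum fun j _ ↦ ?_
      have hW : SmoothCoNear (fun y ↦ covDual cov (Θ j) y (Y 0 y)) x := by
        filter_upwards [(hΘ j).nhds, (hY 0).nhds] with y h1 h2 using hc.covDual_smooth g h1 h2
      have := hs.smooth x _ _ hY' (smoothCoNear_update hΘ j hW)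
      simpa only [eval_update (T := fun x : M ↦ (TangentSpace (𝓡 n) x →L[ℝ] ℝ))] using this

end

/-! ### The connection of a statistical structure and its conjugate -/

/-- Multiply by a bump function supported where `Y` is smooth. The Hausdorff property provides bump
functions with closed support in a given neighbourhood. -/
theorem exists_global_eq [T2Space M] {Y : VField n M} {x : M} (hY : SmoothVNear Y x) :
    ∃ Y' : VField n M, (∀ y, SmoothVNear Y' y) ∧ ∀ᶠ y in 𝓝 x, Y' y = Y y := by
  obtain ⟨ψ, hψ⟩ := ((SmoothBumpFunction.nhds_basis_tsupport (I := 𝓡 n) x).mem_iff).1 hY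
  have hψ := hψ.2
  have hglob : ∀ y, SmoothVAt (fun y ↦ ψ y • Y y) y := by
    intro y
    by_cases hy : y ∈ tsupport ψ
    · exact SmoothVAt.smul ψ.contMDiffAt (hψ hy)
    -- Off the support `Y` itself may be irregular, so the vanishing product is compared with zero
    -- times a smooth field.
    · have h0 : ∀ᶠ z in 𝓝 y, ψ z • Y z = (0 : M → ℝ) z • ext (Y y) z := by
        filter_upwards [(isClosed_tsupport ψ).isOpen_compl.mem_nhds hy] with z hz
        rw [image_eq_zero_of_notMem_tsupport hz]; simp
      exact (SmoothVAt.smul contMDiffAt_const (smoothVAt_ext (Y y))).congr h0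
  exact ⟨_, fun y ↦ .of_forall hglob, ψ.eventuallyEq_one.mono fun y hy ↦ by rw [hy]; simp⟩

/-- The smoothness of `D` is a statement about globally smooth sections; a local field is first cut
off, and locality of the connection carries the result back. -/
theorem isConn_opOf [T2Space M] (D : Connection n M)
    (h : ContMDiffCovariantDerivativeOn (EuclideanSpace ℝ (Fin n)) ∞ D.toFun Set.univ) :
    IsConn (opOf D) where
  map_add Y x v w := map_add _ _ _
  map_smul Y x c v := map_smul _ _ _
  add {Y Z x} hY hZ v := by
    have := D.isCovariantDerivativeOnUniv.add hY hZ
    simp only [opOf, this, add_apply]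
  leibniz {f Y x} hf hY v := by
    have := D.isCovariantDerivativeOnUniv.leibniz hY hf
    simp only [opOf, this, add_apply, smul_apply]
    rfl
  smooth {Y W x} hY hW := by
    obtain ⟨Y', hglob, hY'⟩ := exists_global_eq hY
    have h1 := h.contMDiff (σ := Y') (fun y _ ↦ (hglob y).at.contMDiffWithinAt)
    have h2 := (h1 x trivial).contMDiffAt Filter.univ_mem
    have h3 : SmoothVAt (fun y ↦ D Y' y (W y)) x :=
      ContMDiffAt.clm_bundle_apply (E₂ := fun x : M ↦ TangentSpace (𝓡 n) x) h2 hW.at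
    refine h3.congr ?_
    filter_upwards [hY.nhds, eventually_eventually_nhds.2 hY'] with y hy hy1
    have := D.isCovariantDerivativeOnUniv.congr_of_eventuallyEq hy.at.diff
      (hglob y).at.diff Filter.univ_mem (hy1.mono fun z hz ↦ hz.symm)
    simp only [opOf]
    rw [this]

section Conj

variable (g : Metric n M) {cov : RawConn n M}

theorem metric_injective (x : M) : Function.Injective (g.inner x) := by
  intro u w h
  exact (frame_orthonormal g x).eq_of_inner fun i ↦ by rw [g.symm x _ u, g.symm x _ w, h]

/-- Lowering the index turns the conjugate connection into the dual connection. As this map is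
injective, the laws of `conj` are inherited from those of `covDual`. -/
theorem inner_conj (hc : IsConn cov) {Z : VField n M} {x : M} (hZ : DiffVAt Z x)
    (v : TangentSpace (𝓡 n) x) :
    g.inner x (conj g cov Z x v) = covDual cov (fun y ↦ g.inner y (Z y)) x v := by
  rw [← (frame_orthonormal g x).expand_co (covDual cov (fun y ↦ g.inner y (Z y)) x v)]
  simp only [conj, map_sum, map_smul]
  refine Finset.sum_congr rfl fun i _ ↦ ?_
  rw [hc.covDual_ext (DiffVAt.flat g hZ), g.symm x (cov _ x v)]
  congr 2
  simp only [g.symm _ (ext _ _)]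

/-- The defining property of the conjugate connection. -/
theorem inner_conj_apply (hc : IsConn cov) {Y Z : VField n M} {x : M} (hY : DiffVAt Y x)
    (hZ : DiffVAt Z x) (v : TangentSpace (𝓡 n) x) :
    g.inner x (conj g cov Z x v) (Y x)
      = dirDeriv (fun y ↦ g.inner y (Z y) (Y y)) x v - g.inner x (Z x) (cov Y x v) := by
  rw [inner_conj g hc hZ, hc.covDual_apply (DiffVAt.flat g hZ) hY]

theorem isConn_conj (hc : IsConn cov) : IsConn (conj g cov) where
  map_add Y x v w := by
    simp only [conj, ← Finset.sum_add_distrib, ← add_smul]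
    refine Finset.sum_congr rfl fun i _ ↦ ?_
    rw [dirDeriv_add_vec, hc.map_add, _root_.map_add, add_apply, add_sub_add_comm]
  map_smul Y x c v := by
    simp only [conj, Finset.smul_sum, smul_smul]
    refine Finset.sum_congr rfl fun i _ ↦ ?_
    rw [dirDeriv_smul_vec, hc.map_smul, _root_.map_smul, smul_apply, smul_eq_mul, mul_sub]
  add {Y Z x} hY hZ v := by
    refine metric_injective g x ?_
    have h : DiffVAt (Y + Z) x := mdifferentiableAt_add_section hY hZ
    rw [inner_conj g hc h, _root_.map_add, inner_conj g hc hY, inner_conj g hc hZ,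
      ← hc.covDual_add (DiffVAt.flat g hY) (DiffVAt.flat g hZ)]
    congr 1; ext y : 1; simp
  leibniz {f Y x} hf hY v := by
    refine metric_injective g x ?_
    have h : DiffVAt (f • Y) x := MDifferentiableAt.smul_section hf hY
    rw [inner_conj g hc h, _root_.map_add, map_smul, map_smul, inner_conj g hc hY,
      ← hc.covDual_leibniz hf (DiffVAt.flat g hY)]
    congr 1; ext y : 1; simp
  smooth {Y W x} hY hW := by
    refine smoothVAt_of_inner g fun Z hZ ↦ ?_
    have hf : SmoothCoNear (fun y ↦ g.inner y (Y y)) x := hY.mono fun y hy ↦ hy.flat g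
    refine ((hc.covDual_smooth g hf hW).apply hZ.at).congr_of_eventuallyEq ?_
    filter_upwards [hY] with y hy
    rw [g.symm, inner_conj g hc hy.diff]

theorem conj_conj (hc : IsConn cov) {Z : VField n M} {x : M} (hZ : DiffVAt Z x)
    (v : TangentSpace (𝓡 n) x) : conj g (conj g cov) Z x v = cov Z x v := by
  refine metric_injective g x ?_
  ext w
  have hw := (smoothVAt_ext w).diff
  have h1 := inner_conj_apply g (isConn_conj g hc) hw hZ v
  have h2 := inner_conj_apply g hc hZ hw v
  rw [ext_self] at h1 h2
  rw [h1, g.symm x (Z x), h2, g.symm x w]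
  simp only [g.symm _ (ext w _)]
  ring

/-- The mean value of two raw connections. -/
def avgConn (c₁ c₂ : RawConn n M) : RawConn n M := fun Y x v ↦ (1 / 2 : ℝ) • (c₁ Y x v + c₂ Y x v)

theorem isConn_avgConn {c₁ c₂ : RawConn n M} (h₁ : IsConn c₁) (h₂ : IsConn c₂) :
    IsConn (avgConn c₁ c₂) where
  map_add Y x v w := by simp only [avgConn, h₁.map_add, h₂.map_add]; module
  map_smul Y x c v := by simp only [avgConn, h₁.map_smul, h₂.map_smul]; module
  add hY hZ v := by simp only [avgConn, h₁.add hY hZ, h₂.add hY hZ]; module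
  leibniz hf hY v := by simp only [avgConn, h₁.leibniz hf hY, h₂.leibniz hf hY]; module
  smooth hY hW := SmoothVAt.smul contMDiffAt_const ((h₁.smooth hY hW).add (h₂.smooth hY hW))

/-- Symmetric connections. -/
def TorsionFree (cov : RawConn n M) : Prop :=
  ∀ {X Y : VField n M} {x : M}, SmoothVNear X x → SmoothVNear Y x →
    cov Y x (X x) - cov X x (Y x) = VectorField.mlieBracket (𝓡 n) X Y x

theorem isTF_metricTensor : IsTF (metricTensor g) where
  update_add x z θ p u w := by
    fin_cases p <;> simp [metricTensor]
  update_smul x z θ p c u := by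
    fin_cases p <;> simp [metricTensor]
  co_add x z θ p u w := p.elim0
  co_smul x z θ p c u := p.elim0
  smooth x Y Θ hY hΘ := (hY 0).at.inner g (hY 1).at

/-- The failure of the metric to be parallel is the difference of the two conjugate connections.
This translates the Codazzi equation into torsion, and `K` into a derivative of `g`. -/
theorem covDeriv_metricTensor (hc : IsConn cov) {Y Z : VField n M} {x : M}
    (hY : SmoothVNear Y x) (hZ : SmoothVNear Z x) (v : TangentSpace (𝓡 n) x) :
    covDeriv cov (metricTensor g) x ![v, Y x, Z x] ![]
      = g.inner x (conj g cov Y x v - cov Y x v) (Z x) := by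
  have h := covDeriv_apply hc (isTF_metricTensor g) v (Y := ![Y, Z]) (Θ := ![])
    (fun i ↦ by fin_cases i <;> assumption) (fun j ↦ j.elim0)
  have h1 : (Fin.cons v (fun i ↦ ![Y, Z] i x) : Fin 3 → TangentSpace (𝓡 n) x) = ![v, Y x, Z x] := by
    ext i : 1; fin_cases i <;> rfl
  rw [h1] at h
  rw [show (![] : Fin 0 → (TangentSpace (𝓡 n) x →L[ℝ] ℝ)) = fun j ↦ (![] : Fin 0 → CoField n M) j x
    from Subsingleton.elim _ _, h, map_sub, sub_apply,
    inner_conj_apply g hc hZ.at.diff hY.at.diff]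
  simp [covDerivOn, metricTensor, Fin.sum_univ_two]
  ring

end Conj

/-! ### Uniqueness of the Levi-Civita connection -/

section Koszul

variable (g : Metric n M) {cov : RawConn n M}

/-- Substituting compatibility with `g` and vanishing torsion into the Koszul expression leaves `2
g(∇_v Y, Z)`. Fields smooth around `x` suffice, since `covDeriv` and `diffTensor` apply the
connection to such extensions only; the laws of a connection need not be checked for `leviCivita`.
-/
theorem leviCivita_eq (ht : TorsionFree cov)
    (hg : ∀ {Y Z : VField n M} {x : M}, DiffVAt Y x → DiffVAt Z x → ∀ v,
      dirDeriv (fun y ↦ g.inner y (Y y) (Z y)) x v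
        = g.inner x (cov Y x v) (Z x) + g.inner x (Y x) (cov Z x v))
    {Y : VField n M} {x : M} (hY : SmoothVNear Y x) (v : TangentSpace (𝓡 n) x) :
    leviCivita g Y x v = cov Y x v := by
  rw [← (frame_orthonormal g x).expand (cov Y x v), leviCivita]
  refine Finset.sum_congr rfl fun i _ ↦ ?_
  congr 1
  set X : VField n M := ext v with hX
  set Z : VField n M := ext (frame g x i) with hZ
  have hXs : SmoothVNear X x := smoothVNear_ext v
  have hZs : SmoothVNear Z x := smoothVNear_ext _
  have hXx : X x = v := ext_self v
  have hZx : Z x = frame g x i := ext_self _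
  rw [koszul, hg hY.at.diff hZs.at.diff, hg hZs.at.diff hXs.at.diff, hg hXs.at.diff hY.at.diff,
    ← ht hXs hY, ← ht hY hZs, ← ht hZs hXs, ← hXx, ← hZx]
  simp only [map_sub, sub_apply]
  rw [g.symm x (Z x) (cov Y x (X x)), g.symm x (Z x) (cov X x (Y x)),
    g.symm x (Y x) (cov Z x (X x)), g.symm x (X x) (cov Y x (Z x))]
  ring

end Koszul

/-! ### Statistical structures -/

/-- The action of the difference tensor on covariant tensors,
`(X, Y₁, …, Yₖ) ↦ -∑ᵢ η(Y₁, …, K_X Yᵢ, …, Yₖ)`. -/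
def diffAct (K : (x : M) → TangentSpace (𝓡 n) x → TangentSpace (𝓡 n) x → TangentSpace (𝓡 n) x)
    {k : ℕ} (η : RawField n M 0 k) : RawField n M 0 (k + 1) :=
  fun x y θ ↦ -∑ i : Fin k,
    η x (Function.update (fun i : Fin k ↦ y i.succ) i (K x (y 0) (y i.succ))) θ

section DiffAct

variable (K : (x : M) → TangentSpace (𝓡 n) x → TangentSpace (𝓡 n) x → TangentSpace (𝓡 n) x)
  {k : ℕ} (s t : RawField n M 0 k)

theorem diffAct_add : diffAct K (s + t) = diffAct K s + diffAct K t := by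
  ext x y θ
  simp only [diffAct, Pi.add_apply, Finset.sum_add_distrib, neg_add]

theorem diffAct_sub : diffAct K (s - t) = diffAct K s - diffAct K t := by
  ext x y θ
  simp only [diffAct, Pi.sub_apply, Finset.sum_sub_distrib]
  ring

end DiffAct

/-- The definition of `covDual` sees a connection only through its values on the fields `ext w`. -/
theorem covDual_congr {c₁ c₂ : RawConn n M} (θ : CoField n M) {x : M} {v : TangentSpace (𝓡 n) x}
    (h : ∀ w : TangentSpace (𝓡 n) x, c₁ (ext w) x v = c₂ (ext w) x v) :
    covDual c₁ θ x v = covDual c₂ θ x v := by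
  let b : Fin n → TangentSpace (𝓡 n) x := fun i ↦ EuclideanSpace.single i (1 : ℝ)
  let β : Fin n → (TangentSpace (𝓡 n) x →L[ℝ] ℝ) :=
    fun i ↦ (EuclideanSpace.proj i : EuclideanSpace ℝ (Fin n) →L[ℝ] ℝ)
  exact congrArg (fun F : TangentSpace (𝓡 n) x → TangentSpace (𝓡 n) x ↦
    ∑ i, (dirDeriv (fun x' ↦ θ x' (ext (b i) x')) x v - θ x (F (b i))) • β i) (funext h)

namespace IsStatistical

variable [T2Space M] {g : Metric n M} {D : Connection n M} (hD : IsStatistical g D)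
include hD

theorem isConn : IsConn (opOf D) := isConn_opOf D hD.smooth

theorem isConn_conj : IsConn (conj g (opOf D)) := StatGeom.isConn_conj g hD.isConn

theorem isConn_avg : IsConn (avgConn (opOf D) (conj g (opOf D))) :=
  isConn_avgConn hD.isConn hD.isConn_conj

theorem torsionFree : TorsionFree (opOf D) := by
  intro X Y x hX hY
  exact D.torsion_eq_zero_iff.1 hD.torsion_free hX.at.diff hY.at.diff

/-- Paired with `w`, the difference of the torsions of `∇̄` and `∇` is `(∇_X g)(Y, w) - (∇_Y g)(X,
w)`, which vanishes by the Codazzi equation. -/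
theorem torsionFree_conj : TorsionFree (conj g (opOf D)) := by
  intro X Y x hX hY
  rw [← hD.torsionFree hX hY]
  refine metric_injective g x ?_
  ext w
  have h1 := covDeriv_metricTensor g hD.isConn hY (smoothVNear_ext w) (X x)
  have h2 := covDeriv_metricTensor g hD.isConn hX (smoothVNear_ext w) (Y x)
  have h3 := hD.codazzi x (X x) (Y x) (ext w x)
  rw [h1, h2] at h3
  simp only [ext_self, map_sub, sub_apply] at h3 ⊢
  linarith

theorem torsionFree_avg : TorsionFree (avgConn (opOf D) (conj g (opOf D))) := by
  intro X Y x hX hY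
  have h1 := hD.torsionFree hX hY
  have h2 := hD.torsionFree_conj hX hY
  simp only [avgConn]
  rw [← smul_sub, add_sub_add_comm, h1, h2]
  module

theorem avg_metric {Y Z : VField n M} {x : M} (hY : DiffVAt Y x) (hZ : DiffVAt Z x)
    (v : TangentSpace (𝓡 n) x) :
    dirDeriv (fun y ↦ g.inner y (Y y) (Z y)) x v
      = g.inner x (avgConn (opOf D) (conj g (opOf D)) Y x v) (Z x)
        + g.inner x (Y x) (avgConn (opOf D) (conj g (opOf D)) Z x v) := by
  have h1 := inner_conj_apply g hD.isConn hZ hY v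
  have h2 := inner_conj_apply g hD.isConn hY hZ v
  have h3 : (fun y ↦ g.inner y (Z y) (Y y)) = fun y ↦ g.inner y (Y y) (Z y) := by
    ext y; rw [g.symm]
  rw [h3] at h2
  simp only [avgConn, map_smul, map_add, smul_apply, add_apply, smul_eq_mul]
  rw [h1, g.symm x (Y x) (conj _ _ _ _ _), h2, g.symm x (Z x)]
  ring

theorem leviCivita_eq_avg {Y : VField n M} {x : M} (hY : SmoothVNear Y x)
    (v : TangentSpace (𝓡 n) x) :
    leviCivita g Y x v = avgConn (opOf D) (conj g (opOf D)) Y x v :=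
  leviCivita_eq g hD.torsionFree_avg hD.avg_metric hY v

theorem covDeriv_leviCivita {l k : ℕ} (s : RawField n M l k) :
    covDeriv (leviCivita g) s = covDeriv (avgConn (opOf D) (conj g (opOf D))) s := by
  have h : ∀ θ x v, covDual (leviCivita g) θ x v
      = covDual (avgConn (opOf D) (conj g (opOf D))) θ x v := fun θ x v ↦
    covDual_congr θ fun w ↦ hD.leviCivita_eq_avg (smoothVNear_ext w) v
  ext x y θ
  simp only [covDeriv, h, hD.leviCivita_eq_avg (smoothVNear_ext _)]

/-- Written as a multiple of `∇g`, the difference tensor is totally symmetric: the Codazzi equation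
exchanges the first two arguments, the symmetry of `g` the last two. -/
theorem inner_diffTensor (x : M) (u v w : TangentSpace (𝓡 n) x) :
    g.inner x (diffTensor g (opOf D) x u v) w
      = -(1 / 2 : ℝ) * covDeriv (opOf D) (metricTensor g) x ![u, v, w] ![] := by
  have h := covDeriv_metricTensor g hD.isConn (smoothVNear_ext v) (smoothVNear_ext w) u
  simp only [ext_self] at h
  rw [h, diffTensor, hD.leviCivita_eq_avg (smoothVNear_ext v)]
  simp only [avgConn, map_sub, map_smul, map_add, smul_apply, add_apply, sub_apply, smul_eq_mul]
  ring

theorem diffTensor_apply {Y : VField n M} {x : M} (hY : SmoothVNear Y x)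
    (u : TangentSpace (𝓡 n) x) :
    diffTensor g (opOf D) x u (Y x)
      = (1 / 2 : ℝ) • (opOf D Y x u - conj g (opOf D) Y x u) := by
  refine metric_injective g x ?_
  ext w
  have h := covDeriv_metricTensor g hD.isConn hY (smoothVNear_ext w) u
  simp only [ext_self] at h
  rw [hD.inner_diffTensor, h]
  simp only [map_smul, map_sub, smul_apply, sub_apply, smul_eq_mul]
  ring

theorem opOf_eq {Y : VField n M} {x : M} (hY : SmoothVNear Y x) (u : TangentSpace (𝓡 n) x) :
    opOf D Y x u = avgConn (opOf D) (conj g (opOf D)) Y x u + diffTensor g (opOf D) x u (Y x) := by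
  rw [hD.diffTensor_apply hY, avgConn]; module

theorem conj_eq {Y : VField n M} {x : M} (hY : SmoothVNear Y x) (u : TangentSpace (𝓡 n) x) :
    conj g (opOf D) Y x u
      = avgConn (opOf D) (conj g (opOf D)) Y x u - diffTensor g (opOf D) x u (Y x) := by
  rw [hD.diffTensor_apply hY, avgConn]; module

theorem diffTensor_symm (x : M) (u v : TangentSpace (𝓡 n) x) :
    diffTensor g (opOf D) x u v = diffTensor g (opOf D) x v u := by
  refine metric_injective g x ?_
  ext w
  rw [hD.inner_diffTensor, hD.inner_diffTensor, hD.codazzi]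

theorem diffTensor_inner_symm (x : M) (u v w : TangentSpace (𝓡 n) x) :
    g.inner x (diffTensor g (opOf D) x u v) w = g.inner x v (diffTensor g (opOf D) x u w) := by
  rw [g.symm x v, hD.inner_diffTensor, hD.inner_diffTensor]
  congr 1
  simp [covDeriv, metricTensor, Fin.sum_univ_two]
  simp only [g.symm _ (ext w _) (ext v _), g.symm x v, g.symm x _ w]
  ring

theorem diffTensor_add_left (x : M) (u u' v : TangentSpace (𝓡 n) x) :
    diffTensor g (opOf D) x (u + u') v
      = diffTensor g (opOf D) x u v + diffTensor g (opOf D) x u' v := by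
  have h := fun u ↦ hD.diffTensor_apply (smoothVNear_ext v) u
  simp only [ext_self] at h
  simp only [h, hD.isConn.map_add, hD.isConn_conj.map_add]
  module

theorem diffTensor_smul_left (x : M) (c : ℝ) (u v : TangentSpace (𝓡 n) x) :
    diffTensor g (opOf D) x (c • u) v = c • diffTensor g (opOf D) x u v := by
  have h := fun u ↦ hD.diffTensor_apply (smoothVNear_ext v) u
  simp only [ext_self] at h
  simp only [h, hD.isConn.map_smul, hD.isConn_conj.map_smul]
  module

/-- The difference tensor at a point as a bilinear map. -/
def diffBilin (x : M) :
    TangentSpace (𝓡 n) x →ₗ[ℝ] TangentSpace (𝓡 n) x →ₗ[ℝ] TangentSpace (𝓡 n) x :=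
  LinearMap.mk₂ ℝ (diffTensor g (opOf D) x) (hD.diffTensor_add_left x) (hD.diffTensor_smul_left x)
    (fun u v w ↦ by
      simp only [hD.diffTensor_symm x u, hD.diffTensor_add_left])
    (fun c u v ↦ by
      simp only [hD.diffTensor_symm x u, hD.diffTensor_smul_left])

theorem diffBilin_apply (x : M) (u v : TangentSpace (𝓡 n) x) :
    hD.diffBilin x u v = diffTensor g (opOf D) x u v := rfl

theorem diffTensor_conj (x : M) (u v : TangentSpace (𝓡 n) x) :
    diffTensor g (conj g (opOf D)) x u v = -diffTensor g (opOf D) x u v := by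
  have h := hD.conj_eq (smoothVNear_ext v) u
  rw [diffTensor, hD.leviCivita_eq_avg (smoothVNear_ext v), h, ext_self]
  abel

theorem vecE_conj : vecE g (conj g (opOf D)) = -vecE g (opOf D) := by
  ext x : 1
  simp [vecE, hD.diffTensor_conj]

theorem covDeriv_opOf {k : ℕ} {η : RawField n M 0 k} (hη : IsTF η) :
    covDeriv (opOf D) η = covDeriv (avgConn (opOf D) (conj g (opOf D))) η
      + diffAct (diffTensor g (opOf D)) η := by
  ext x y θ
  simp only [covDeriv, diffAct, Pi.add_apply, hD.opOf_eq (smoothVNear_ext _), ext_self,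
    hη.update_add, Finset.sum_add_distrib, Finset.univ_eq_empty, Finset.sum_empty]
  ring

theorem covDeriv_conj {k : ℕ} {η : RawField n M 0 k} (hη : IsTF η) :
    covDeriv (conj g (opOf D)) η = covDeriv (avgConn (opOf D) (conj g (opOf D))) η
      - diffAct (diffTensor g (opOf D)) η := by
  have hneg : ∀ x z θ p u, η x (Function.update z p (-u)) θ = -η x (Function.update z p u) θ := by
    intro x z θ p u
    simpa using hη.update_smul x z θ p (-1) u
  ext x y θ
  simp only [covDeriv, diffAct, Pi.sub_apply, hD.conj_eq (smoothVNear_ext _), ext_self,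
    sub_eq_add_neg, hη.update_add, hneg, Finset.sum_add_distrib, Finset.sum_neg_distrib,
    Finset.univ_eq_empty, Finset.sum_empty]
  ring

/-- A difference of two covariant derivatives of `η`, so multilinearity and smoothness come for
free. -/
theorem isTF_diffAct {k : ℕ} {η : RawField n M 0 k} (hη : IsTF η) :
    IsTF (diffAct (diffTensor g (opOf D)) η) := by
  have h : diffAct (diffTensor g (opOf D)) η
      = covDeriv (opOf D) η - covDeriv (avgConn (opOf D) (conj g (opOf D))) η := by
    rw [hD.covDeriv_opOf hη]; abel
  rw [h]
  exact (hη.covDeriv hD.isConn g).sub (hη.covDeriv hD.isConn_avg g)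

end IsStatistical

/-! ### Independence of the orthonormal frame -/

section FrameSum

variable {g : Metric n M} {x : M} {e e' : Fin n → TangentSpace (𝓡 n) x}

/-- Expanding one frame in the other leaves products of coefficients, which Parseval sums to the
identity matrix. -/
theorem sum_frame_eq {N : Type*} [AddCommGroup N] [Module ℝ N]
    (he : IsOrthonormalFrame g x e) (he' : IsOrthonormalFrame g x e')
    (B : TangentSpace (𝓡 n) x →ₗ[ℝ] TangentSpace (𝓡 n) x →ₗ[ℝ] N) :
    ∑ i, B (e i) (e i) = ∑ i, B (e' i) (e' i) := by
  have h : ∀ i, B (e' i) (e' i) = ∑ j, ∑ m,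
      (g.inner x (e' i) (e j) * g.inner x (e' i) (e m)) • B (e j) (e m) := by
    intro i
    conv_lhs => rw [← he.expand (e' i)]
    simp only [map_sum, map_smul, LinearMap.sum_apply, LinearMap.smul_apply, Finset.smul_sum,
      smul_smul, g.symm x (e' i)]
    rw [Finset.sum_comm]
    simp only [mul_comm]
  simp only [h]
  rw [Finset.sum_comm]
  refine Finset.sum_congr rfl fun j _ ↦ ?_
  rw [Finset.sum_comm]
  simp only [← Finset.sum_smul, he'.parseval]
  simp [he j]

/-- Covectors: sums over the dual frames. -/
theorem sum_coframe_eq {N : Type*} [AddCommGroup N] [Module ℝ N]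
    (he : IsOrthonormalFrame g x e) (he' : IsOrthonormalFrame g x e')
    (B : (TangentSpace (𝓡 n) x →L[ℝ] ℝ) →ₗ[ℝ] (TangentSpace (𝓡 n) x →L[ℝ] ℝ) →ₗ[ℝ] N) :
    ∑ i, B (g.inner x (e i)) (g.inner x (e i)) = ∑ i, B (g.inner x (e' i)) (g.inner x (e' i)) :=
  sum_frame_eq he he' (B.compl₁₂ (g.inner x).toLinearMap (g.inner x).toLinearMap)

/-- Families of vectors for which the sums `∑ᵢ B(eᵢ, eᵢ)` agree also give the same scalar products
of multilinear forms. -/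
theorem sum_multi_eq {W : Type*} [AddCommGroup W] [Module ℝ W] {n : ℕ} {e e' : Fin n → W}
    (H : ∀ B : W →ₗ[ℝ] W →ₗ[ℝ] ℝ, ∑ i, B (e i) (e i) = ∑ i, B (e' i) (e' i)) {k : ℕ}
    (S T : MultilinearMap ℝ (fun _ : Fin k ↦ W) ℝ) :
    ∑ a : Fin k → Fin n, S (fun i ↦ e (a i)) * T (fun i ↦ e (a i))
      = ∑ a : Fin k → Fin n, S (fun i ↦ e' (a i)) * T (fun i ↦ e' (a i)) := by
  induction k with
  | zero =>
    have h : ∀ a : Fin 0 → Fin n, (fun i ↦ e (a i)) = fun i ↦ e' (a i) :=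
      fun a ↦ Subsingleton.elim _ _
    simp only [h]
  | succ k ih =>
    have split : ∀ e : Fin n → W, ∑ a : Fin (k + 1) → Fin n, S (fun i ↦ e (a i)) * T (fun i ↦ e (a i))
        = ∑ i, ∑ a : Fin k → Fin n,
          S.curryLeft (e i) (fun j ↦ e (a j)) * T.curryLeft (e i) (fun j ↦ e (a j)) := by
      intro e
      rw [← (Fin.consEquiv fun _ : Fin (k + 1) ↦ Fin n).sum_comp, Fintype.sum_prod_type]
      refine Finset.sum_congr rfl fun i _ ↦ Finset.sum_congr rfl fun a _ ↦ ?_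
      have : (fun j : Fin (k + 1) ↦ e ((Fin.consEquiv fun _ : Fin (k + 1) ↦ Fin n) (i, a) j))
          = Fin.cons (e i) fun j ↦ e (a j) := by
        ext j; refine Fin.cases ?_ (fun j ↦ ?_) j <;> simp [Fin.consEquiv]
      rw [this]; rfl
    rw [split, split]
    -- With the first argument frozen, the induction hypothesis exchanges the frame in the tail;
    -- what is left is bilinear in the first arguments of `S` and `T`, so `H` applies.
    have h1 : ∀ i, ∑ a : Fin k → Fin n,
          S.curryLeft (e i) (fun j ↦ e (a j)) * T.curryLeft (e i) (fun j ↦ e (a j))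
        = ∑ a : Fin k → Fin n,
          S.curryLeft (e i) (fun j ↦ e' (a j)) * T.curryLeft (e i) (fun j ↦ e' (a j)) :=
      fun i ↦ ih _ _
    simp only [h1]
    have h2 := H (LinearMap.mk₂ ℝ (fun u w ↦ ∑ a : Fin k → Fin n,
      S.curryLeft u (fun j ↦ e' (a j)) * T.curryLeft w (fun j ↦ e' (a j)))
      (fun u u' w ↦ by simp [add_mul, Finset.sum_add_distrib])
      (fun c u w ↦ by simp [Finset.mul_sum, mul_assoc])
      (fun u u' w ↦ by simp [mul_add, Finset.sum_add_distrib])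
      (fun c u w ↦ by simp [Finset.mul_sum, mul_left_comm]))
    simpa using h2

theorem tensorInner_eq {l k : ℕ} {s t : RawField n M l k} (hs : IsTF s) (ht : IsTF t)
    (he : IsOrthonormalFrame g x e) :
    tensorInner g s t x = ∑ a : Fin k → Fin n, ∑ b : Fin l → Fin n,
      s x (fun i ↦ e (a i)) (fun j ↦ g.inner x (e (b j)))
        * t x (fun i ↦ e (a i)) (fun j ↦ g.inner x (e (b j))) := by
  have hf := frame_orthonormal g x
  rw [tensorInner]
  have h1 : ∀ a : Fin k → Fin n, ∑ b : Fin l → Fin n,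
      s x (fun i ↦ frame g x (a i)) (fun j ↦ g.inner x (frame g x (b j)))
        * t x (fun i ↦ frame g x (a i)) (fun j ↦ g.inner x (frame g x (b j)))
      = ∑ b : Fin l → Fin n,
      s x (fun i ↦ frame g x (a i)) (fun j ↦ g.inner x (e (b j)))
        * t x (fun i ↦ frame g x (a i)) (fun j ↦ g.inner x (e (b j))) := fun a ↦
    sum_multi_eq (fun B ↦ sum_coframe_eq hf he B) (hs.multiCo x _) (ht.multiCo x _)
  simp only [h1]
  rw [Finset.sum_comm]
  conv_rhs => rw [Finset.sum_comm]
  refine Finset.sum_congr rfl fun b _ ↦ ?_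
  exact sum_multi_eq (fun B ↦ sum_frame_eq hf he B) (hs.multi x _) (ht.multi x _)

end FrameSum

/-! ### Scalar products of tensors -/

/-- The scalar product of tensors at a point. -/
def tensorInnerAt (g : Metric n M) (x : M) {l k : ℕ}
    (S T : (Fin k → TangentSpace (𝓡 n) x) → (Fin l → (TangentSpace (𝓡 n) x →L[ℝ] ℝ)) → ℝ) : ℝ :=
  ∑ a : Fin k → Fin n, ∑ b : Fin l → Fin n,
    S (fun i ↦ frame g x (a i)) (fun j ↦ g.inner x (frame g x (b j)))
      * T (fun i ↦ frame g x (a i)) (fun j ↦ g.inner x (frame g x (b j)))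

section

variable (g : Metric n M) (x : M) {l k : ℕ}
  (S S' T : (Fin k → TangentSpace (𝓡 n) x) → (Fin l → (TangentSpace (𝓡 n) x →L[ℝ] ℝ)) → ℝ)

theorem tensorInner_eq_at (s t : RawField n M l k) :
    tensorInner g s t x = tensorInnerAt g x (s x) (t x) := rfl

theorem tensorInnerAt_comm : tensorInnerAt g x S T = tensorInnerAt g x T S := by
  simp only [tensorInnerAt, mul_comm]

theorem tensorInnerAt_add_left :
    tensorInnerAt g x (S + S') T = tensorInnerAt g x S T + tensorInnerAt g x S' T := by
  simp only [tensorInnerAt, Pi.add_apply, add_mul, Finset.sum_add_distrib]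

theorem tensorInnerAt_smul_left (c : ℝ) :
    tensorInnerAt g x (c • S) T = c * tensorInnerAt g x S T := by
  simp only [tensorInnerAt, Pi.smul_apply, smul_eq_mul, Finset.mul_sum, mul_assoc]

theorem tensorInnerAt_neg_left : tensorInnerAt g x (-S) T = -tensorInnerAt g x S T := by
  simp only [tensorInnerAt, Pi.neg_apply, neg_mul, Finset.sum_neg_distrib]

theorem tensorInnerAt_sub_left :
    tensorInnerAt g x (S - S') T = tensorInnerAt g x S T - tensorInnerAt g x S' T := by
  rw [sub_eq_add_neg, tensorInnerAt_add_left, tensorInnerAt_neg_left, sub_eq_add_neg]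

theorem tensorInnerAt_sum_left {ι : Type*} (t : Finset ι)
    (F : ι → (Fin k → TangentSpace (𝓡 n) x) → (Fin l → (TangentSpace (𝓡 n) x →L[ℝ] ℝ)) → ℝ) :
    tensorInnerAt g x (∑ i ∈ t, F i) T = ∑ i ∈ t, tensorInnerAt g x (F i) T := by
  classical
  induction t using Finset.induction_on with
  | empty => simp [tensorInnerAt]
  | insert a t ha ih => rw [Finset.sum_insert ha, Finset.sum_insert ha, tensorInnerAt_add_left, ih]

theorem sum_consEquiv {N : Type*} [AddCommMonoid N] (F : (Fin (k + 1) → Fin n) → N) :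
    ∑ a, F a = ∑ j : Fin n, ∑ a : Fin k → Fin n, F (Fin.cons j a) := by
  rw [← (Fin.consEquiv fun _ : Fin (k + 1) ↦ Fin n).sum_comp, Fintype.sum_prod_type]
  rfl

theorem frame_cons (j : Fin n) (a : Fin k → Fin n) :
    (fun i : Fin (k + 1) ↦ frame g x ((Fin.cons j a : Fin (k + 1) → Fin n) i))
      = Fin.cons (frame g x j) (fun i ↦ frame g x (a i)) := by
  ext i : 1
  refine Fin.cases ?_ (fun i ↦ ?_) i <;> simp

theorem tensorInnerAt_succ
    (S T : (Fin (k + 1) → TangentSpace (𝓡 n) x) → (Fin l → (TangentSpace (𝓡 n) x →L[ℝ] ℝ)) → ℝ) :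
    tensorInnerAt g x S T = ∑ j, tensorInnerAt g x (fun y ↦ S (Fin.cons (frame g x j) y))
      (fun y ↦ T (Fin.cons (frame g x j) y)) := by
  simp only [tensorInnerAt]
  rw [sum_consEquiv]
  simp only [frame_cons]

end

theorem mdifferentiableAt_fun_mul {f h : M → ℝ} {x : M}
    (hf : MDifferentiableAt (𝓡 n) 𝓘(ℝ) f x) (hh : MDifferentiableAt (𝓡 n) 𝓘(ℝ) h x) :
    MDifferentiableAt (𝓡 n) 𝓘(ℝ) (fun y ↦ f y * h y) x := hf.mul hh

/-- The contributions of skew-symmetric coefficients to the derivative of a scalar product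
cancel. -/
theorem sum_skew_eq_zero {k : ℕ} (F G : (Fin k → Fin n) → ℝ) (γ γ' : Fin n → Fin n → ℝ)
    (h : ∀ c d, γ' c d = -γ d c) :
    ∑ a : Fin k → Fin n, ((∑ i, ∑ d, γ (a i) d * F (Function.update a i d)) * G a
      + F a * ∑ i, ∑ d, γ' (a i) d * G (Function.update a i d)) = 0 := by
  simp only [Finset.sum_mul, Finset.mul_sum, ← Finset.sum_add_distrib]
  rw [Finset.sum_comm]
  refine Finset.sum_eq_zero fun i _ ↦ ?_
  simp only [Finset.sum_add_distrib]
  -- Exchanging the index `a i` with the summation index `d` moves the modified multi-index from `F`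
  -- to `G` and transposes `γ`.
  have hinv : Function.Involutive
      (fun q : (Fin k → Fin n) × Fin n ↦ (Function.update q.1 i q.2, q.1 i)) := by
    rintro ⟨a, d⟩; simp
  have h1 : ∑ a : Fin k → Fin n, ∑ d, γ (a i) d * F (Function.update a i d) * G a
      = ∑ a : Fin k → Fin n, ∑ d, γ d (a i) * F a * G (Function.update a i d) := by
    rw [← Fintype.sum_prod_type', ← Fintype.sum_prod_type', ← Equiv.sum_comp (hinv.toPerm _)]
    refine Finset.sum_congr rfl fun q _ ↦ ?_
    simp [Function.Involutive.coe_toPerm]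
  rw [h1, ← Finset.sum_add_distrib]
  refine Finset.sum_eq_zero fun a _ ↦ ?_
  rw [← Finset.sum_add_distrib]
  refine Finset.sum_eq_zero fun d _ ↦ ?_
  rw [h]; ring

/-- The frames in the definition are chosen pointwise; independence of the frame allows a smooth one
near `x`. -/
theorem smoothAt_tensorInner (g : Metric n M) {l k : ℕ} {s t : RawField n M l k} (hs : IsTF s)
    (ht : IsTF t) (x : M) : SmoothAt (n := n) (tensorInner g s t) x := by
  obtain ⟨E, -, h2, h3⟩ := exists_smooth_frame g x (frame_orthonormal g x)
  have hf : ∀ i, SmoothCoNear (fun y ↦ g.inner y (E i y)) x :=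
    fun i ↦ (h2 i).mono fun y hy ↦ hy.flat g
  refine ContMDiffAt.congr_of_eventuallyEq ?_ (h3.mono fun y hy ↦ tensorInner_eq hs ht hy)
  refine SmoothAt.sum fun a _ ↦ SmoothAt.sum fun b _ ↦ ContMDiffAt.mul ?_ ?_
  · exact hs.smooth x (fun i ↦ E (a i)) _ (fun i ↦ h2 _) (fun j ↦ hf (b j))
  · exact ht.smooth x (fun i ↦ E (a i)) _ (fun i ↦ h2 _) (fun j ↦ hf (b j))

/-- The derivative of the scalar product along conjugate connections. -/
theorem dirDeriv_tensorInner (g : Metric n M) {cov : RawConn n M} (hc : IsConn cov) {l k : ℕ}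
    {s t : RawField n M l k} (hs : IsTF s) (ht : IsTF t) (x : M) (v : TangentSpace (𝓡 n) x) :
    dirDeriv (tensorInner g s t) x v
      = tensorInnerAt g x (fun y ↦ covDeriv cov s x (Fin.cons v y)) (t x)
        + tensorInnerAt g x (s x) (fun y ↦ covDeriv (conj g cov) t x (Fin.cons v y)) := by
  have hc' := isConn_conj g hc
  have he := frame_orthonormal g x
  obtain ⟨E, h1, h2, h3⟩ := exists_smooth_frame g x he
  have hf : ∀ i, SmoothCoNear (fun y ↦ g.inner y (E i y)) x :=
    fun i ↦ (h2 i).mono fun y hy ↦ hy.flat g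
  have hsm := fun (a : Fin k → Fin n) (b : Fin l → Fin n) ↦ (hs.smooth x (fun i : Fin k ↦ E (a i))
    (fun (j : Fin l) y ↦ g.inner y (E (b j) y)) (fun i ↦ h2 _) (fun j ↦ hf (b j))).diff
  have htm := fun (a : Fin k → Fin n) (b : Fin l → Fin n) ↦ (ht.smooth x (fun i : Fin k ↦ E (a i))
    (fun (j : Fin l) y ↦ g.inner y (E (b j) y)) (fun i ↦ h2 _) (fun j ↦ hf (b j))).diff
  set γ : Fin n → Fin n → ℝ := fun c d ↦ g.inner x (E d x) (cov (E c) x v) with hγ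
  set γ' : Fin n → Fin n → ℝ := fun c d ↦ g.inner x (E d x) (conj g cov (E c) x v) with hγ'
  -- The products `g(E c, E d)` are constant near `x`, so the conjugation identity loses its
  -- derivative term.
  have hskew : ∀ c d, γ' c d = -γ d c := by
    intro c d
    have h := inner_conj_apply g hc (h2 d).at.diff (h2 c).at.diff v
    have h0 : dirDeriv (fun y ↦ g.inner y (E c y) (E d y)) x v = 0 := by
      rw [dirDeriv_congr (h3.mono fun y hy ↦ hy c d), dirDeriv_const]
    rw [h0, zero_sub] at h
    simp only [hγ, hγ']
    rw [g.symm, h]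
  have hskew' : ∀ c d, γ c d = -γ' d c := fun c d ↦ by rw [hskew]; ring
  have hex : ∀ c, cov (E c) x v = ∑ d, γ c d • frame g x d := fun c ↦ by
    simp only [hγ, h1]; exact (he.expand _).symm
  have hex' : ∀ c, conj g cov (E c) x v = ∑ d, γ' c d • frame g x d := fun c ↦ by
    simp only [hγ', h1]; exact (he.expand _).symm
  -- On the dual coframe `∇` acts with the coefficients of `∇̄`, and conversely in `hco'`; this lets
  -- covector places cancel as vector places do.
  have hco : ∀ c, covDual cov (fun y ↦ g.inner y (E c y)) x v
      = ∑ d, γ' c d • g.inner x (frame g x d) := fun c ↦ by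
    rw [← inner_conj g hc (h2 c).at.diff, hex']; simp
  have hco' : ∀ c, covDual (conj g cov) (fun y ↦ g.inner y (E c y)) x v
      = ∑ d, γ c d • g.inner x (frame g x d) := fun c ↦ by
    rw [← inner_conj g hc' (h2 c).at.diff, conj_conj g hc (h2 c).at.diff, hex]; simp
  have hup : ∀ (a : Fin k → Fin n) i d, Function.update (fun i ↦ frame g x (a i)) i (frame g x d)
      = fun p ↦ frame g x (Function.update a i d p) := fun a i d ↦
    (Function.comp_update (frame g x) a i d).symm
  have hup' : ∀ (b : Fin l → Fin n) j d,
      Function.update (fun j ↦ g.inner x (frame g x (b j))) j (g.inner x (frame g x d))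
      = fun p ↦ g.inner x (frame g x (Function.update b j d p)) := fun b j d ↦
    (Function.comp_update (fun i ↦ g.inner x (frame g x i)) b j d).symm
  -- General in the connection because it is used for `∇` on `s` and for `∇̄` on `t`, with `γ` and
  -- `γ'` exchanged.
  have deriv : ∀ {cov : RawConn n M} (_ : IsConn cov) {s : RawField n M l k} (_ : IsTF s)
      (γ γ' : Fin n → Fin n → ℝ) (_ : ∀ c, cov (E c) x v = ∑ d, γ c d • frame g x d)
      (_ : ∀ c, covDual cov (fun y ↦ g.inner y (E c y)) x v
        = ∑ d, γ' c d • g.inner x (frame g x d)) (a : Fin k → Fin n) (b : Fin l → Fin n),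
      dirDeriv (fun y ↦ s y (fun i ↦ E (a i) y) (fun j ↦ g.inner y (E (b j) y))) x v
      = covDeriv cov s x (Fin.cons v fun i ↦ frame g x (a i))
          (fun j ↦ g.inner x (frame g x (b j)))
        + (∑ i, ∑ d, γ (a i) d * s x (fun p ↦ frame g x (Function.update a i d p))
          (fun j ↦ g.inner x (frame g x (b j))))
        + ∑ j, ∑ d, γ' (b j) d * s x (fun i ↦ frame g x (a i))
          (fun p ↦ g.inner x (frame g x (Function.update b j d p))) := by
    intro cov hc s hs γ γ' h h' a b
    have hm := covDeriv_apply hc hs v (fun i ↦ h2 (a i)) (fun j ↦ hf (b j))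
    simp only [covDerivOn, h1, h, h', hs.update_sum, hs.co_sum, hs.update_smul, hs.co_smul, hup,
      hup'] at hm
    rw [hm]; ring
  have h0 : tensorInner g s t =ᶠ[𝓝 x] fun y ↦ ∑ a : Fin k → Fin n, ∑ b : Fin l → Fin n,
      s y (fun i ↦ E (a i) y) (fun j ↦ g.inner y (E (b j) y))
        * t y (fun i ↦ E (a i) y) (fun j ↦ g.inner y (E (b j) y)) :=
    h3.mono fun y hy ↦ tensorInner_eq hs ht hy
  obtain ⟨F, hF⟩ : ∃ F : (Fin k → Fin n) → (Fin l → Fin n) → ℝ, ∀ a b,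
      s x (fun i ↦ frame g x (a i)) (fun j ↦ g.inner x (frame g x (b j))) = F a b :=
    ⟨_, fun _ _ ↦ rfl⟩
  obtain ⟨G, hG⟩ : ∃ G : (Fin k → Fin n) → (Fin l → Fin n) → ℝ, ∀ a b,
      t x (fun i ↦ frame g x (a i)) (fun j ↦ g.inner x (frame g x (b j))) = G a b :=
    ⟨_, fun _ _ ↦ rfl⟩
  obtain ⟨F', hF'⟩ : ∃ F' : (Fin k → Fin n) → (Fin l → Fin n) → ℝ, ∀ a b,
      covDeriv cov s x (Fin.cons v fun i ↦ frame g x (a i))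
        (fun j ↦ g.inner x (frame g x (b j))) = F' a b := ⟨_, fun _ _ ↦ rfl⟩
  obtain ⟨G', hG'⟩ : ∃ G' : (Fin k → Fin n) → (Fin l → Fin n) → ℝ, ∀ a b,
      covDeriv (conj g cov) t x (Fin.cons v fun i ↦ frame g x (a i))
        (fun j ↦ g.inner x (frame g x (b j))) = G' a b := ⟨_, fun _ _ ↦ rfl⟩
  have key : ∀ (a : Fin k → Fin n) (b : Fin l → Fin n), dirDeriv (fun y ↦
      s y (fun i ↦ E (a i) y) (fun j ↦ g.inner y (E (b j) y))
        * t y (fun i ↦ E (a i) y) (fun j ↦ g.inner y (E (b j) y))) x v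
      = (F' a b + (∑ i, ∑ d, γ (a i) d * F (Function.update a i d) b)
          + ∑ j, ∑ d, γ' (b j) d * F a (Function.update b j d)) * G a b
        + F a b * (G' a b + (∑ i, ∑ d, γ' (a i) d * G (Function.update a i d) b)
          + ∑ j, ∑ d, γ (b j) d * G a (Function.update b j d)) := by
    intro a b
    rw [dirDeriv_mul (hsm a b) (htm a b), deriv hc hs γ γ' hex hco a b,
      deriv hc' ht γ' γ hex' hco' a b]
    simp only [h1, hF, hG, hF', hG']
  have hsum : dirDeriv (tensorInner g s t) x v = ∑ a : Fin k → Fin n, ∑ b : Fin l → Fin n,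
      ((F' a b + (∑ i, ∑ d, γ (a i) d * F (Function.update a i d) b)
          + ∑ j, ∑ d, γ' (b j) d * F a (Function.update b j d)) * G a b
        + F a b * (G' a b + (∑ i, ∑ d, γ' (a i) d * G (Function.update a i d) b)
          + ∑ j, ∑ d, γ (b j) d * G a (Function.update b j d))) := by
    rw [dirDeriv_congr h0, dirDeriv_sum _ fun a _ ↦ mdifferentiableAt_sum _ fun b _ ↦
      mdifferentiableAt_fun_mul (hsm a b) (htm a b)]
    refine Finset.sum_congr rfl fun a _ ↦ ?_
    rw [dirDeriv_sum _ fun b _ ↦ mdifferentiableAt_fun_mul (hsm a b) (htm a b)]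
    exact Finset.sum_congr rfl fun b _ ↦ key a b
  rw [hsum]
  simp only [tensorInnerAt, hF, hG, hF', hG', ← Finset.sum_add_distrib]
  clear_value γ γ'
  -- `e3` removes the frame terms of the vector places for each fixed `b`, `e4` those of the
  -- covector places for each fixed `a`.
  have e3 := Finset.sum_eq_zero fun b (_ : b ∈ Finset.univ) ↦
    sum_skew_eq_zero (fun a ↦ F a b) (fun a ↦ G a b) γ γ' hskew
  have e4 := Finset.sum_eq_zero fun a (_ : a ∈ Finset.univ) ↦
    sum_skew_eq_zero (F a) (G a) γ' γ hskew'
  rw [Finset.sum_comm] at e3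
  rw [← sub_eq_zero]
  refine Eq.trans ?_ ((congrArg₂ (· + ·) e3 e4).trans (add_zero 0))
  simp only [← Finset.sum_add_distrib, ← Finset.sum_sub_distrib]
  refine Finset.sum_congr rfl fun a _ ↦ Finset.sum_congr rfl fun b _ ↦ ?_
  ring

/-! ### Contraction with vector fields -/

/-- Vectors extend to smooth vector fields on the whole manifold. -/
theorem exists_global_ext [T2Space M] {x : M} (v : TangentSpace (𝓡 n) x) :
    ∃ Y : VField n M, (∀ y, SmoothVNear Y y) ∧ Y x = v := by
  obtain ⟨Y, h1, h2⟩ := exists_global_eq (smoothVNear_ext v)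
  exact ⟨Y, h1, by rw [h2.self_of_nhds, ext_self]⟩

theorem eval_cons {k : ℕ} (X : VField n M) (Y : Fin k → VField n M) (y : M) :
    (fun i ↦ (Fin.cons X Y : Fin (k + 1) → VField n M) i y) = Fin.cons (X y) (fun i ↦ Y i y) := by
  ext i : 1
  refine Fin.cases ?_ (fun i ↦ ?_) i <;> simp

theorem smoothVNear_cons {k : ℕ} {X : VField n M} {Y : Fin k → VField n M} {x : M}
    (hX : SmoothVNear X x) (hY : ∀ i, SmoothVNear (Y i) x) (i : Fin (k + 1)) :
    SmoothVNear ((Fin.cons X Y : Fin (k + 1) → VField n M) i) x := by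
  refine Fin.cases ?_ (fun i ↦ ?_) i
  · simpa
  · simpa using hY i

theorem IsTF.insertFirst {l k : ℕ} {T : RawField n M l (k + 1)} (hT : IsTF T) {X : VField n M}
    (hX : ∀ y, SmoothVNear X y) : IsTF (insertFirst X T) where
  update_add x z θ p u w := by
    simp only [StatGeom.insertFirst, Fin.cons_update, hT.update_add]
  update_smul x z θ p c u := by
    simp only [StatGeom.insertFirst, Fin.cons_update, hT.update_smul]
  co_add x z θ p u w := hT.co_add _ _ _ _ _ _
  co_smul x z θ p c u := hT.co_smul _ _ _ _ _ _
  smooth x Y Θ hY hΘ := by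
    have := hT.smooth x _ Θ (smoothVNear_cons (hX x) hY) hΘ
    simpa only [eval_cons, StatGeom.insertFirst] using this

/-- The Leibniz rule for the contraction with `X`. Since `IsTF` is a condition at every point, `X`
has to be smooth on all of `M`. -/
theorem covDeriv_insertFirst {cov : RawConn n M} (hc : IsConn cov) {l k : ℕ}
    {T : RawField n M l (k + 1)} (hT : IsTF T) {X : VField n M} (hX : ∀ y, SmoothVNear X y)
    {x : M} (v : TangentSpace (𝓡 n) x) (z θ) :
    covDeriv cov (insertFirst X T) x (Fin.cons v z) θ
      = covDeriv cov T x (Fin.cons v (Fin.cons (X x) z)) θ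
        + T x (Fin.cons (cov X x v) z) θ := by
  have hz : ∀ i, SmoothVNear (ext (z i)) x := fun i ↦ smoothVNear_ext _
  have hθ : ∀ i, SmoothCoNear (coext (θ i)) x := fun i ↦ smoothCoNear_coext _
  have h1 := covDeriv_apply hc (hT.insertFirst hX) v hz hθ
  have h2 := covDeriv_apply hc hT v (smoothVNear_cons (hX x) hz) hθ
  simp only [eval_cons, ext_self, coext_self] at h1 h2
  rw [h1, h2]
  simp only [covDerivOn, eval_cons, Fin.sum_univ_succ, Fin.cons_zero, Fin.cons_succ,
    Fin.update_cons_zero, insertFirst, ← Fin.cons_update, ext_self, coext_self]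
  ring

theorem covDeriv_conj_conj (g : Metric n M) {cov : RawConn n M} (hc : IsConn cov) {l k : ℕ}
    (s : RawField n M l k) : covDeriv (conj g (conj g cov)) s = covDeriv cov s := by
  have h0 : ∀ {x} (w v : TangentSpace (𝓡 n) x), conj g (conj g cov) (ext w) x v = cov (ext w) x v :=
    fun w v ↦ conj_conj g hc (smoothVAt_ext w).diff v
  have h : ∀ θ x v, covDual (conj g (conj g cov)) θ x v = covDual cov θ x v := fun θ x v ↦
    covDual_congr θ fun w ↦ h0 w v
  ext x y θ
  simp only [covDeriv, h, h0]

/-! ### Laplacians of functions -/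

theorem extD_fun (f : M → ℝ) (x : M) (y : Fin 1 → TangentSpace (𝓡 n) x) (θ) :
    extD (k := 0) (fun x' _ _ ↦ f x') x y θ = dirDeriv f x (y 0) := by
  simp [extD]

theorem isTF_extD_fun {f : M → ℝ} (hf : ∀ x, SmoothAt (n := n) f x) :
    IsTF (n := n) (extD (k := 0) (fun x' _ _ ↦ f x')) where
  update_add x z θ p u w := by
    obtain rfl : p = 0 := Fin.fin_one_eq_zero p
    simp only [extD_fun, Function.update_self, dirDeriv_add_vec]
  update_smul x z θ p c u := by
    obtain rfl : p = 0 := Fin.fin_one_eq_zero p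
    simp only [extD_fun, Function.update_self, dirDeriv_smul_vec]
  co_add x z θ p u w := p.elim0
  co_smul x z θ p c u := p.elim0
  smooth x Y Θ hY hΘ := by
    simp only [extD_fun]
    exact (hf x).dirDeriv (hY 0).at

namespace IsStatistical

variable [T2Space M] {g : Metric n M} {D : Connection n M} (hD : IsStatistical g D)
include hD

/-- The covariant derivative of `df` is tensorial, so the fields `E i` need to agree with the frame
at `x` only and may fail to be orthonormal nearby. -/
theorem hodgeLaplacianFun_eq {f : M → ℝ} (hf : ∀ x, SmoothAt (n := n) f x) {x : M}
    {E : Fin n → VField n M} (hE : ∀ i, SmoothVNear (E i) x) (hEx : ∀ i, E i x = frame g x i) :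
    hodgeLaplacianFun g f x = -∑ i, (dirDeriv (fun y ↦ dirDeriv f y (E i y)) x (frame g x i)
      - dirDeriv f x (avgConn (opOf D) (conj g (opOf D)) (E i) x (frame g x i))) := by
  have key : ∀ i, covDeriv (avgConn (opOf D) (conj g (opOf D))) (extD (k := 0) fun x' _ _ ↦ f x') x
      (Fin.cons (frame g x i) (Fin.cons (frame g x i) ![])) ![]
      = dirDeriv (fun y ↦ dirDeriv f y (E i y)) x (frame g x i)
      - dirDeriv f x (avgConn (opOf D) (conj g (opOf D)) (E i) x (frame g x i)) := by
    intro i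
    have h := covDeriv_apply hD.isConn_avg (isTF_extD_fun hf) (frame g x i) (x := x)
      (Y := fun _ ↦ E i) (Θ := fun j ↦ j.elim0) (fun _ ↦ hE i) (fun j ↦ j.elim0)
    have h1 : (fun _ : Fin 1 ↦ E i x) = Fin.cons (frame g x i) ![] := by
      ext j : 1
      obtain rfl := Subsingleton.elim j 0
      simp [hEx]
    have h2 : (![] : Fin 0 → (TangentSpace (𝓡 n) x →L[ℝ] ℝ))
      = fun j : Fin 0 ↦ (j.elim0 : CoField n M) x := Subsingleton.elim _ _
    rw [h1] at h
    rw [h2, h]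
    simp [covDerivOn, extD_fun]
  simp only [hodgeLaplacianFun, hodgeLaplacian, formLaplacian, codiff, hD.covDeriv_leviCivita,
    Pi.neg_apply, traceFirst, key]

theorem smoothVAt_grad {f : M → ℝ} (hf : ∀ x, SmoothAt (n := n) f x) (x : M) :
    SmoothVAt (grad g f) x := by
  refine smoothVAt_of_inner g fun Y hY ↦ ?_
  refine ((hf x).dirDeriv hY.at).congr_of_eventuallyEq (.of_forall fun y ↦ ?_)
  have := (frame_orthonormal g y).expand (Y y)
  simp only [grad, map_sum, map_smul, smul_eq_mul]
  conv_rhs => rw [← this]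
  simp only [dirDeriv_sum_vec, dirDeriv_smul_vec, g.symm y (Y y), mul_comm]

theorem inner_grad (f : M → ℝ) (y : M) (v : TangentSpace (𝓡 n) y) :
    g.inner y (grad g f y) v = dirDeriv f y v := by
  have := (frame_orthonormal g y).expand v
  conv_rhs => rw [← this]
  simp only [grad, map_sum, map_smul, dirDeriv_sum_vec, dirDeriv_smul_vec, FunLike.coe_sum,
    Finset.sum_apply, smul_apply, smul_eq_mul, mul_comm]

theorem trace_eq {x : M} (L : TangentSpace (𝓡 n) x →ₗ[ℝ] TangentSpace (𝓡 n) x) :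
    LinearMap.trace ℝ (TangentSpace (𝓡 n) x) L
      = ∑ i, g.inner x (L (frame g x i)) (frame g x i) := by
  have he := frame_orthonormal g x
  have hb : ∀ i, he.basis i = frame g x i := fun i ↦ by simp [IsOrthonormalFrame.basis]
  rw [LinearMap.trace_eq_matrix_trace ℝ he.basis, Matrix.trace]
  refine Finset.sum_congr rfl fun i _ ↦ ?_
  rw [Matrix.diag_apply, LinearMap.toMatrix_apply, hb]
  have h := he.expand (L (frame g x i))
  conv_lhs => rw [← h]
  simp only [← hb, map_sum, map_smul, Module.Basis.repr_self]
  simp [Finsupp.single_apply, g.symm x (L _)]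

/-- Conjugation gives `g(∇_e grad f, e) = e(e f) - df(∇̄_e e)`, and `∇̄_e e = ∇̂_e e - K(e, e)`; the
trace of the last term is `E f`. -/
theorem statLaplacianFun_eq {f : M → ℝ} (hf : ∀ x, SmoothAt (n := n) f x) (x : M) :
    statLaplacianFun g D f x
      = hodgeLaplacianFun g f x - dirDeriv f x (vecE g (opOf D) x) := by
  have hE : ∀ i, SmoothVNear (ext (frame g x i)) x := fun i ↦ smoothVNear_ext _
  rw [hD.hodgeLaplacianFun_eq hf hE fun i ↦ ext_self _, statLaplacianFun, divergence,
    hD.trace_eq, vecE, dirDeriv_sum_vec, ← neg_add', ← Finset.sum_add_distrib]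
  congr 1
  refine Finset.sum_congr rfl fun i _ ↦ ?_
  have hG := (hD.smoothVAt_grad hf x).diff
  have h := inner_conj_apply g hD.isConn_conj (hE i).at.diff hG (frame g x i)
  rw [conj_conj g hD.isConn hG, ext_self] at h
  simp only [hD.inner_grad] at h
  rw [hD.conj_eq (hE i), ext_self] at h
  refine h.trans ?_
  rw [sub_eq_add_neg (avgConn _ _ _ _ _), dirDeriv_add_vec, ← neg_one_smul ℝ, dirDeriv_smul_vec]
  ring

/-! ### The Laplacian of the square of the length of a tensor field -/

theorem dirDeriv_inner_self {l k : ℕ} {s : RawField n M l k} (hs : IsTF s) (X : VField n M)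
    (x : M) : dirDeriv (tensorInner g s s) x (X x)
      = tensorInner g (covAlong (opOf D) X s) s x
        + tensorInner g (covAlong (conj g (opOf D)) X s) s x := by
  rw [dirDeriv_tensorInner g hD.isConn hs hs, tensorInnerAt_comm g x (s x)]
  rfl

/-- Each summand of the first derivative is differentiated by the connection opposite to the one it
contains: `∇̄` acts on `∇_X s`, which leaves `∇` for the other factor `s`, and conversely. This
produces mixed second derivatives and unmixed scalar products. -/
theorem dirDeriv_dirDeriv_inner_self {l k : ℕ} {s : RawField n M l k} (hs : IsTF s)
    {X : VField n M} (hX : ∀ y, SmoothVNear X y) (x : M) (v : TangentSpace (𝓡 n) x) :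
    dirDeriv (fun y ↦ dirDeriv (tensorInner g s s) y (X y)) x v
      = tensorInnerAt g x (fun y ↦ covDeriv (conj g (opOf D)) (covDeriv (opOf D) s) x
            (Fin.cons v (Fin.cons (X x) y))) (s x)
        + tensorInnerAt g x (fun y ↦ covDeriv (opOf D) s x
            (Fin.cons (conj g (opOf D) X x v) y)) (s x)
        + tensorInnerAt g x (fun y ↦ covDeriv (opOf D) s x (Fin.cons (X x) y))
            (fun y ↦ covDeriv (opOf D) s x (Fin.cons v y))
        + (tensorInnerAt g x (fun y ↦ covDeriv (opOf D) (covDeriv (conj g (opOf D)) s) x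
            (Fin.cons v (Fin.cons (X x) y))) (s x)
        + tensorInnerAt g x (fun y ↦ covDeriv (conj g (opOf D)) s x
            (Fin.cons (opOf D X x v) y)) (s x)
        + tensorInnerAt g x (fun y ↦ covDeriv (conj g (opOf D)) s x (Fin.cons (X x) y))
            (fun y ↦ covDeriv (conj g (opOf D)) s x (Fin.cons v y))) := by
  have h1 := hs.covDeriv hD.isConn g
  have h2 := hs.covDeriv hD.isConn_conj g
  simp only [hD.dirDeriv_inner_self hs]
  simp only [covAlong]
  rw [dirDeriv_add (smoothAt_tensorInner g (h1.insertFirst hX) hs x).diff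
    (smoothAt_tensorInner g (h2.insertFirst hX) hs x).diff]
  have e1 := dirDeriv_tensorInner g hD.isConn_conj (h1.insertFirst hX) hs x v
  have e2 := dirDeriv_tensorInner g hD.isConn (h2.insertFirst hX) hs x v
  have a1 : (fun y ↦ covDeriv (conj g (opOf D)) (insertFirst X (covDeriv (opOf D) s)) x
      (Fin.cons v y)) = (fun y ↦ covDeriv (conj g (opOf D)) (covDeriv (opOf D) s) x
        (Fin.cons v (Fin.cons (X x) y)))
        + fun y ↦ covDeriv (opOf D) s x (Fin.cons (conj g (opOf D) X x v) y) := by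
    ext y θ; exact covDeriv_insertFirst hD.isConn_conj h1 hX v y θ
  have a2 : (fun y ↦ covDeriv (opOf D) (insertFirst X (covDeriv (conj g (opOf D)) s)) x
      (Fin.cons v y)) = (fun y ↦ covDeriv (opOf D) (covDeriv (conj g (opOf D)) s) x
        (Fin.cons v (Fin.cons (X x) y)))
        + fun y ↦ covDeriv (conj g (opOf D)) s x (Fin.cons (opOf D X x v) y) := by
    ext y θ; exact covDeriv_insertFirst hD.isConn h2 hX v y θ
  rw [a1, tensorInnerAt_add_left, covDeriv_conj_conj g hD.isConn] at e1
  rw [a2, tensorInnerAt_add_left] at e2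
  exact congrArg₂ (· + ·) e1 e2

theorem hodgeLaplacianFun_inner_self {l k : ℕ} {s : RawField n M l k} (hs : IsTF s) (x : M) :
    hodgeLaplacianFun g (tensorInner g s s) x
      = tensorInner g (roughLaplacian g (opOf D) s) s x
        + tensorInner g (roughLaplacian g (conj g (opOf D)) s) s x
        - tensorInner g (covDeriv (opOf D) s) (covDeriv (opOf D) s) x
        - tensorInner g (covDeriv (conj g (opOf D)) s) (covDeriv (conj g (opOf D)) s) x := by
  -- Global extensions, because the contractions with `E i` must again be tensor fields.
  choose E hE hEx using fun i ↦ exists_global_ext (frame g x i)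
  have h1 := hs.covDeriv hD.isConn g
  have h2 := hs.covDeriv hD.isConn_conj g
  have hcons_add : ∀ {T : RawField n M l (k + 1)} (hT : IsTF T) (u w : TangentSpace (𝓡 n) x),
      (fun y ↦ T x (Fin.cons (u + w) y)) = (fun y ↦ T x (Fin.cons u y))
        + fun y ↦ T x (Fin.cons w y) := by
    intro T hT u w
    ext y θ
    simpa using hT.update_add x (Fin.cons 0 y) θ 0 u w
  have hcons_smul : ∀ {T : RawField n M l (k + 1)} (hT : IsTF T) (c : ℝ) (w : TangentSpace (𝓡 n) x),
      (fun y ↦ T x (Fin.cons (c • w) y)) = c • fun y ↦ T x (Fin.cons w y) := by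
    intro T hT c w
    ext y θ
    simpa using hT.update_smul x (Fin.cons 0 y) θ 0 c w
  have hcons_sum : ∀ {T : RawField n M l (k + 1)} (hT : IsTF T) (u : Fin n → TangentSpace (𝓡 n) x),
      (fun y ↦ T x (Fin.cons (∑ i, u i) y)) = ∑ i, fun y ↦ T x (Fin.cons (u i) y) := by
    intro T hT u
    ext y θ
    simpa [Finset.sum_apply] using hT.update_sum x (Fin.cons 0 y) θ 0 Finset.univ u
  -- The terms with `∇̂_e e` cancel against the correction in the Hessian; only `K(e, e)` survives,
  -- with opposite signs for `∇` and `∇̄`.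
  have key : ∀ i, dirDeriv (fun y ↦ dirDeriv (tensorInner g s s) y (E i y)) x (frame g x i)
      - dirDeriv (tensorInner g s s) x (avgConn (opOf D) (conj g (opOf D)) (E i) x (frame g x i))
      = tensorInnerAt g x (fun y ↦ covDeriv (conj g (opOf D)) (covDeriv (opOf D) s) x
            (Fin.cons (frame g x i) (Fin.cons (frame g x i) y))) (s x)
        - tensorInnerAt g x (fun y ↦ covDeriv (opOf D) s x
            (Fin.cons (diffTensor g (opOf D) x (frame g x i) (frame g x i)) y)) (s x)
        + tensorInnerAt g x (fun y ↦ covDeriv (opOf D) s x (Fin.cons (frame g x i) y))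
            (fun y ↦ covDeriv (opOf D) s x (Fin.cons (frame g x i) y))
        + (tensorInnerAt g x (fun y ↦ covDeriv (opOf D) (covDeriv (conj g (opOf D)) s) x
            (Fin.cons (frame g x i) (Fin.cons (frame g x i) y))) (s x)
        + tensorInnerAt g x (fun y ↦ covDeriv (conj g (opOf D)) s x
            (Fin.cons (diffTensor g (opOf D) x (frame g x i) (frame g x i)) y)) (s x)
        + tensorInnerAt g x (fun y ↦ covDeriv (conj g (opOf D)) s x (Fin.cons (frame g x i) y))
            (fun y ↦ covDeriv (conj g (opOf D)) s x (Fin.cons (frame g x i) y))) := by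
    intro i
    rw [hD.dirDeriv_dirDeriv_inner_self hs (hE i), hD.opOf_eq (hE i x), hD.conj_eq (hE i x),
      dirDeriv_tensorInner g hD.isConn hs hs, tensorInnerAt_comm g x (s x), hEx,
      sub_eq_add_neg (avgConn _ _ _ _ _), ← neg_one_smul ℝ]
    simp only [hcons_add h1, hcons_add h2, hcons_smul h1, tensorInnerAt_add_left,
      tensorInnerAt_smul_left]
    ring
  rw [hD.hodgeLaplacianFun_eq (smoothAt_tensorInner g hs hs) (fun i ↦ hE i x) hEx]
  simp only [key, Finset.sum_add_distrib, Finset.sum_sub_distrib, ← tensorInnerAt_sum_left,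
    ← hcons_sum h1, ← hcons_sum h2, ← tensorInnerAt_succ]
  have r1 : roughLaplacian g (opOf D) s x
      = -(∑ i, fun y ↦ covDeriv (conj g (opOf D)) (covDeriv (opOf D) s) x
            (Fin.cons (frame g x i) (Fin.cons (frame g x i) y)))
        + fun y ↦ covDeriv (opOf D) s x (Fin.cons (vecE g (opOf D) x) y) := by
    ext y θ
    simp [roughLaplacian, formalAdjoint, traceFirst, insertFirst, Finset.sum_apply]
  -- The conjugate structure has difference tensor `-K`, hence the vector field `-E`.
  have r2 : roughLaplacian g (conj g (opOf D)) s x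
      = -(∑ i, fun y ↦ covDeriv (opOf D) (covDeriv (conj g (opOf D)) s) x
            (Fin.cons (frame g x i) (Fin.cons (frame g x i) y)))
        + (-1 : ℝ) • fun y ↦ covDeriv (conj g (opOf D)) s x (Fin.cons (vecE g (opOf D) x) y) := by
    rw [← hcons_smul h2]
    ext y θ
    simp [roughLaplacian, formalAdjoint, traceFirst, insertFirst, Finset.sum_apply, hD.vecE_conj,
      covDeriv_conj_conj g hD.isConn]
  simp only [tensorInner_eq_at, r1, r2, tensorInnerAt_add_left, tensorInnerAt_neg_left,
    tensorInnerAt_smul_left, vecE]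
  ring

theorem statLaplacianFun_inner_self {l k : ℕ} {s : RawField n M l k} (hs : IsTF s) (x : M) :
    statLaplacianFun g D (tensorInner g s s) x
      = hodgeLaplacianFun g (tensorInner g s s) x
        - tensorInner g (covAlong (opOf D) (vecE g (opOf D)) s) s x
        - tensorInner g (covAlong (conj g (opOf D)) (vecE g (opOf D)) s) s x := by
  rw [hD.statLaplacianFun_eq (smoothAt_tensorInner g hs hs), hD.dirDeriv_inner_self hs]
  ring

end IsStatistical

/-! ### Fields with constant components in a chart -/

section Chart

variable {x : M}

/-- In the chart at `x` the field `ext v` is the constant `v`. The vanishing brackets and the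
symmetry of second derivatives both rest on this. -/
theorem mfderiv_extChartAt_ext (v : TangentSpace (𝓡 n) x) {y : M}
    (hy : y ∈ (extChartAt (𝓡 n) x).source) :
    mfderiv (𝓡 n) 𝓘(ℝ, EuclideanSpace ℝ (Fin n)) (extChartAt (𝓡 n) x) y (ext v y) = v := by
  have : IsManifold (𝓡 n) 1 M := .of_le (n := ∞) (by simp)
  have hy' : y ∈ (chartAt (EuclideanSpace ℝ (Fin n)) x).source := by simpa using hy
  let t := trivializationAt (EuclideanSpace ℝ (Fin n)) (TangentSpace (𝓡 n) : M → Type _) x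
  have hb : ∀ {z}, z ∈ (chartAt (EuclideanSpace ℝ (Fin n)) x).source → z ∈ t.baseSet := fun h ↦ by
    simpa [t] using h
  have h1 : (t ⟨x, v⟩).2 = v := by
    have h := congrArg (fun L : TangentSpace (𝓡 n) x →L[ℝ] EuclideanSpace ℝ (Fin n) ↦ L v)
      (TangentBundle.continuousLinearMapAt_trivializationAt (I := 𝓡 n) (x₀ := x) (x := x)
        (mem_chart_source _ x))
    rw [mfderiv_extChartAt_self] at h
    rw [← t.continuousLinearMapAt_apply_of_mem ℝ (hb (mem_chart_source _ x))]
    exact h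
  have h2 := congrArg (fun L : TangentSpace (𝓡 n) y →L[ℝ] EuclideanSpace ℝ (Fin n) ↦ L (ext v y))
      (TangentBundle.continuousLinearMapAt_trivializationAt (I := 𝓡 n) (x₀ := x) (x := y) hy')
  refine h2.symm.trans ?_
  have h3 : ext v y = t.symm y ((t ⟨x, v⟩).2) := rfl
  change t.continuousLinearMapAt ℝ y (ext v y) = v
  rw [h3, h1]
  have h4 := t.continuousLinearMapAt_symmL (R := ℝ) (hb hy') v
  exact (congrArg (t.continuousLinearMapAt ℝ y) (t.symmL_apply (R := ℝ) (hb hy') v)).symm.trans h4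

theorem mlieBracket_ext (u v : TangentSpace (𝓡 n) x) :
    VectorField.mlieBracket (𝓡 n) (ext u) (ext v) x = 0 := by
  have : IsManifold (𝓡 n) 1 M := .of_le (n := ∞) (by simp)
  have key : ∀ v : TangentSpace (𝓡 n) x,
      VectorField.mpullbackWithin 𝓘(ℝ, EuclideanSpace ℝ (Fin n)) (𝓡 n) (extChartAt (𝓡 n) x).symm
        (ext v) (Set.range (𝓡 n)) =ᶠ[𝓝 (extChartAt (𝓡 n) x x)] fun _ ↦ v := by
    intro v
    filter_upwards [extChartAt_target_mem_nhds (I := 𝓡 n) x] with z hz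
    have h1 := mfderiv_extChartAt_comp_mfderivWithin_extChartAt_symm (I := 𝓡 n) hz
    have h2 := mfderivWithin_extChartAt_symm_comp_mfderiv_extChartAt (I := 𝓡 n) hz
    have h3 := mfderiv_extChartAt_ext v ((extChartAt (𝓡 n) x).map_target hz)
    rw [VectorField.mpullbackWithin_apply, ContinuousLinearMap.inverse_eq h2 h1]
    exact h3
  have h : VectorField.mlieBracketWithin (𝓡 n) (ext u) (ext v) Set.univ x = 0 := by
    rw [VectorField.mlieBracketWithin_apply]
    have hr : Set.range (𝓡 n) = Set.univ := by simp
    simp only [Set.preimage_univ, Set.univ_inter]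
    have e : ∀ (V W : EuclideanSpace ℝ (Fin n) → EuclideanSpace ℝ (Fin n))
        (z a b : EuclideanSpace ℝ (Fin n)), V =ᶠ[𝓝 z] (fun _ ↦ a) → W =ᶠ[𝓝 z] (fun _ ↦ b) →
        VectorField.lieBracketWithin ℝ V W (Set.range (𝓡 n)) z = 0 := by
      intro V W z a b hV hW
      rw [hr, VectorField.lieBracketWithin_univ, hV.lieBracket_vectorField_eq hW]
      simp [VectorField.lieBracket]
    exact (congrArg _ (e _ _ _ u v (key u) (key v))).trans (map_zero _)
  exact h

theorem dirDeriv_ext {f : M → ℝ} {y : M} (hy : y ∈ (extChartAt (𝓡 n) x).source)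
    (hf : MDifferentiableAt (𝓡 n) 𝓘(ℝ) f y) (v : TangentSpace (𝓡 n) x) :
    dirDeriv f y (ext v y)
      = fderiv ℝ (f ∘ (extChartAt (𝓡 n) x).symm) (extChartAt (𝓡 n) x y) v := by
  have : IsManifold (𝓡 n) 1 M := .of_le (n := ∞) (by simp)
  have h0 : f =ᶠ[𝓝 y] (f ∘ (extChartAt (𝓡 n) x).symm) ∘ extChartAt (𝓡 n) x := by
    filter_upwards [extChartAt_source_mem_nhds' (I := 𝓡 n) hy] with z hz
    simp only [Function.comp_apply, (extChartAt (𝓡 n) x).left_inv hz]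
  have hs : MDifferentiableAt 𝓘(ℝ, EuclideanSpace ℝ (Fin n)) (𝓡 n) (extChartAt (𝓡 n) x).symm
      (extChartAt (𝓡 n) x y) := by
    have h := mdifferentiableWithinAt_extChartAt_symm (I := 𝓡 n)
      ((extChartAt (𝓡 n) x).map_source hy)
    have hr : Set.range (𝓡 n) = Set.univ := by simp
    rwa [hr, mdifferentiableWithinAt_univ] at h
  have hF : MDifferentiableAt 𝓘(ℝ, EuclideanSpace ℝ (Fin n)) 𝓘(ℝ)
      (f ∘ (extChartAt (𝓡 n) x).symm) (extChartAt (𝓡 n) x y) := by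
    refine MDifferentiableAt.comp (I' := 𝓡 n) _ ?_ hs
    rwa [(extChartAt (𝓡 n) x).left_inv hy]
  have hφ : MDifferentiableAt (𝓡 n) 𝓘(ℝ, EuclideanSpace ℝ (Fin n)) (extChartAt (𝓡 n) x) y :=
    mdifferentiableAt_extChartAt (by simpa using hy)
  have h1 := mfderiv_comp_apply (I := 𝓡 n) y hF hφ (ext v y)
  rw [mfderiv_extChartAt_ext v hy, mfderiv_eq_fderiv] at h1
  rw [dirDeriv_congr h0]
  exact h1

/-- Second derivatives with respect to fields with constant components are symmetric. -/
theorem dirDeriv_dirDeriv_ext {f : M → ℝ} (hf : SmoothNear (n := n) f x)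
    (u v : TangentSpace (𝓡 n) x) :
    dirDeriv (fun y ↦ dirDeriv f y (ext v y)) x u
      = dirDeriv (fun y ↦ dirDeriv f y (ext u y)) x v := by
  set φ := extChartAt (𝓡 n) x with hφ
  set F := f ∘ φ.symm with hFd
  have hx : x ∈ φ.source := mem_extChartAt_source x
  have hF : ContDiffAt ℝ ∞ F (φ x) := by
    have h := (contMDiffAt_iff (I := 𝓡 n) (I' := 𝓘(ℝ)).1 hf.self_of_nhds).2
    have hr : Set.range (𝓡 n) = Set.univ := by simp
    rw [hr, contDiffWithinAt_univ] at h
    exact h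
  have key : ∀ u v : TangentSpace (𝓡 n) x, dirDeriv (fun y ↦ dirDeriv f y (ext v y)) x u
      = fderiv ℝ (fderiv ℝ F) (φ x) u v := by
    intro u v
    have h0 : (fun y ↦ dirDeriv f y (ext v y)) =ᶠ[𝓝 x] fun y ↦ fderiv ℝ F (φ y) v := by
      filter_upwards [extChartAt_source_mem_nhds (I := 𝓡 n) x, hf] with y hy hfy
      exact dirDeriv_ext hy hfy.diff v
    have hd : MDifferentiableAt (𝓡 n) 𝓘(ℝ) (fun y ↦ dirDeriv f y (ext v y)) x :=
      (hf.self_of_nhds.dirDeriv (smoothVAt_ext v)).diff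
    have h1 := dirDeriv_ext hx hd u
    rw [ext_self] at h1
    rw [h1]
    have h2 : (fun y ↦ dirDeriv f y (ext v y)) ∘ φ.symm =ᶠ[𝓝 (φ x)] fun z ↦ fderiv ℝ F z v := by
      have hc : ContinuousAt φ.symm (φ x) := continuousAt_extChartAt_symm x
      have h0' : ∀ᶠ y in 𝓝 (φ.symm (φ x)), dirDeriv f y (ext v y) = fderiv ℝ F (φ y) v := by
        rw [φ.left_inv hx]; exact h0
      filter_upwards [hc.eventually h0', extChartAt_target_mem_nhds (I := 𝓡 n) x] with z hz hzt
      simp only [Function.comp_apply, hz]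
      rw [φ.right_inv hzt]
    rw [h2.fderiv_eq]
    have h3 : DifferentiableAt ℝ (fderiv ℝ F) (φ x) :=
      (hF.fderiv_right (m := 1) (by norm_cast)).differentiableAt (by simp)
    have h4 : ∀ a b : EuclideanSpace ℝ (Fin n),
        fderiv ℝ (fun z ↦ fderiv ℝ F z b) (φ x) a = fderiv ℝ (fderiv ℝ F) (φ x) a b := by
      intro a b
      rw [fderiv_clm_apply h3 (differentiableAt_const _)]
      simp
    exact h4 u v
  rw [key, key]
  exact (hF.isSymmSndFDerivAt (by rw [minSmoothness_of_isRCLikeNormedField]; exact WithTop.coe_le_coe.2 le_top)).eq u v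

end Chart

/-- The Christoffel symbols of a torsion-free connection are symmetric: coordinate fields have
vanishing bracket. -/
theorem TorsionFree.ext_symm {cov : RawConn n M} (ht : TorsionFree cov) {x : M}
    (u v : TangentSpace (𝓡 n) x) : cov (ext u) x v = cov (ext v) x u := by
  have h := ht (smoothVNear_ext v) (smoothVNear_ext u)
  rw [ext_self, ext_self, mlieBracket_ext, sub_eq_zero] at h
  exact h

/-! ### Alternating tensor fields -/

/-- Fields of alternating functions. -/
def Alt {k : ℕ} (η : RawField n M 0 k) : Prop :=
  ∀ x y θ i j, i ≠ j → y i = y j → η x y θ = 0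

section AltLemmas

variable {k : ℕ} {η : RawField n M 0 k}

/-- An alternating tensor at `x` as an alternating map. -/
def IsTF.altMap (hη : IsTF η) (ha : Alt η) (x : M)
    (θ : Fin 0 → (TangentSpace (𝓡 n) x →L[ℝ] ℝ)) :
    AlternatingMap ℝ (TangentSpace (𝓡 n) x) ℝ (Fin k) :=
  { hη.multi x θ with map_eq_zero_of_eq' := fun y i j h hij ↦ ha x y θ i j hij h }

theorem IsTF.altMap_apply (hη : IsTF η) (ha : Alt η) (x : M) (θ y) :
    hη.altMap ha x θ y = η x y θ := rfl

theorem Alt.swap (hη : IsTF η) (ha : Alt η) (x : M) (y θ) {i j : Fin k} (hij : i ≠ j) :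
    η x (y ∘ Equiv.swap i j) θ = -η x y θ :=
  (hη.altMap ha x θ).map_swap y hij

theorem Alt.update_update (hη : IsTF η) (ha : Alt η) (x : M) (y θ) {i m : Fin k} (him : i ≠ m)
    (a b : TangentSpace (𝓡 n) x) :
    η x (Function.update (Function.update y m a) i b) θ
      = -η x (Function.update (Function.update y i a) m b) θ := by
  rw [← ha.swap hη x _ θ him]
  congr 1
  ext p : 1
  by_cases h1 : p = i
  · subst h1; simp
  · by_cases h2 : p = m
    · subst h2; simp [him, h1]
    · simp [h1, h2, Equiv.swap_apply_of_ne_of_ne]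

theorem sum_sum_eq_zero_of_antisymm {ι : Type*} [Fintype ι] (F : ι → ι → ℝ)
    (h : ∀ i j, F i j = -F j i) : ∑ i, ∑ j, F i j = 0 := by
  have h1 : ∑ i, ∑ j, F i j = -∑ i, ∑ j, F i j := by
    conv_lhs => rw [Finset.sum_comm]
    simp only [← Finset.sum_neg_distrib, ← h]
  linarith

/-- Moving `a` from the front to place `m` passes `m` arguments, whence the sign. -/
theorem alternatingMap_update {V : Type*} [AddCommGroup V] [Module ℝ V]
    (f : AlternatingMap ℝ V ℝ (Fin k)) (a : V) (y : Fin k → V) (m : Fin k) :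
    (-1 : ℝ) ^ (m : ℕ) * f (fun j ↦ (Fin.cons a y : Fin (k + 1) → V) (m.succ.succAbove j))
      = f (Function.update y m a) := by
  cases k with
  | zero => exact m.elim0
  | succ k =>
    have h1 : (fun j ↦ (Fin.cons a y : Fin (k + 2) → V) (m.succ.succAbove j))
        = Matrix.vecCons a (m.removeNth y) := by
      ext j : 1
      refine Fin.cases ?_ (fun j ↦ ?_) j
      · simp
      · simp [Fin.removeNth]
    have h2 : Function.update y m a = m.insertNth a (m.removeNth y) := by simp
    rw [h1, h2, f.map_insertNth]
    simp

end AltLemmas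

/-! ### Linearity of the covariant derivative and permutation of slots -/

section Linear

variable {cov : RawConn n M} {l k : ℕ} {s t : RawField n M l k}

theorem IsTF.diff_ext (hs : IsTF s) {x : M} (z : Fin k → TangentSpace (𝓡 n) x)
    (θ : Fin l → (TangentSpace (𝓡 n) x →L[ℝ] ℝ)) :
    MDifferentiableAt (𝓡 n) 𝓘(ℝ)
      (fun y ↦ s y (fun i ↦ ext (z i) y) (fun j ↦ coext (θ j) y)) x :=
  (hs.smooth x _ _ (fun i ↦ smoothVNear_ext (z i)) (fun j ↦ smoothCoNear_coext (θ j))).diff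

theorem covDeriv_add (hs : IsTF s) (ht : IsTF t) :
    covDeriv cov (s + t) = covDeriv cov s + covDeriv cov t := by
  ext x y θ
  simp only [covDeriv, Pi.add_apply, Finset.sum_add_distrib,
    dirDeriv_add (hs.diff_ext _ _) (ht.diff_ext _ _)]
  ring

theorem covDeriv_neg : covDeriv cov (-s) = -covDeriv cov s := by
  ext x y θ
  simp only [covDeriv, Pi.neg_apply, Finset.sum_neg_distrib, dirDeriv_neg]
  ring

theorem covDeriv_sub (hs : IsTF s) (ht : IsTF t) :
    covDeriv cov (s - t) = covDeriv cov s - covDeriv cov t := by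
  rw [sub_eq_add_neg, covDeriv_add hs ht.neg, covDeriv_neg, sub_eq_add_neg]

theorem covDeriv_zero : covDeriv cov (0 : RawField n M l k) = 0 := by
  ext x y θ
  simp [covDeriv, dirDeriv_const]

theorem covDeriv_sum {ι : Type*} {f : ι → RawField n M l k} (t : Finset ι)
    (h : ∀ i, IsTF (f i)) : covDeriv cov (∑ i ∈ t, f i) = ∑ i ∈ t, covDeriv cov (f i) := by
  classical
  induction t using Finset.induction_on with
  | empty => simp [covDeriv_zero]
  | insert a t ha ih =>
    rw [Finset.sum_insert ha, Finset.sum_insert ha, covDeriv_add (h a) (IsTF.sum _ fun i _ ↦ h i), ih]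

/-- A tensor field with permuted arguments. -/
def permSlots (σ : Equiv.Perm (Fin k)) (s : RawField n M l k) : RawField n M l k :=
  fun x y θ ↦ s x (y ∘ σ) θ

theorem IsTF.permSlots (hs : IsTF s) (σ : Equiv.Perm (Fin k)) : IsTF (permSlots σ s) where
  update_add x z θ p u w := by
    simp only [StatGeom.permSlots, Function.update_comp_equiv, hs.update_add]
  update_smul x z θ p c u := by
    simp only [StatGeom.permSlots, Function.update_comp_equiv, hs.update_smul]
  co_add x z θ p u w := hs.co_add _ _ _ _ _ _
  co_smul x z θ p c u := hs.co_smul _ _ _ _ _ _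
  smooth x Y Θ hY hΘ := hs.smooth x (fun i ↦ Y (σ i)) Θ (fun i ↦ hY _) hΘ

theorem covDeriv_permSlots (σ : Equiv.Perm (Fin k)) (x : M) (v : TangentSpace (𝓡 n) x) (y θ) :
    covDeriv cov (permSlots σ s) x (Fin.cons v y) θ
      = covDeriv cov s x (Fin.cons v (y ∘ σ)) θ := by
  simp only [covDeriv, permSlots, Fin.cons_zero, Fin.cons_succ, Function.update_comp_equiv]
  congr 2
  exact Fintype.sum_equiv σ.symm _ _ fun i ↦ by simp [Function.comp_def]

end Linear

section AltCov

variable {cov : RawConn n M} (hc : IsConn cov) (g : Metric n M) {k : ℕ} {η : RawField n M 0 k}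

/-- Fields of functions which are alternating in all arguments but the first. -/
def TailAlt {k : ℕ} (T : RawField n M 0 (k + 1)) : Prop :=
  ∀ x v y θ i j, i ≠ j → y i = y j → T x (Fin.cons v y) θ = 0

/-- A transposition of places commutes with the covariant derivative and changes the sign of `η`; on
equal arguments the value is its own negative. -/
theorem Alt.covDeriv (hη : IsTF η) (ha : Alt η) : TailAlt (covDeriv cov η) := by
  intro x v y θ i j hij hy
  have h1 : permSlots (Equiv.swap i j) η = -η := by
    ext x y θ; exact ha.swap hη x y θ hij
  have h2 := covDeriv_permSlots (cov := cov) (s := η) (Equiv.swap i j) x v y θ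
  rw [h1, covDeriv_neg] at h2
  have h3 : y ∘ Equiv.swap i j = y := by
    ext p : 1
    by_cases hp : p = i
    · subst hp; simp [hy]
    · by_cases hq : p = j
      · subst hq; simp [hy]
      · simp [Equiv.swap_apply_of_ne_of_ne hp hq]
  rw [h3] at h2
  simp only [Pi.neg_apply] at h2
  linarith

theorem TailAlt.insertFirst {T : RawField n M 0 (k + 1)} (hT : TailAlt T) (X : VField n M) :
    Alt (insertFirst X T) := fun x y θ i j hij hy ↦ hT x (X x) y θ i j hij hy

include hc in
theorem TailAlt.covDeriv [T2Space M] {T : RawField n M 0 (k + 1)} (hT : IsTF T) (ha : TailAlt T)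
    (x : M) (v w : TangentSpace (𝓡 n) x) {y θ} {i j : Fin k} (hij : i ≠ j) (hy : y i = y j) :
    covDeriv cov T x (Fin.cons v (Fin.cons w y)) θ = 0 := by
  -- Contracting `T` with a field through `w` gives an alternating tensor field, to which
  -- `Alt.covDeriv` applies; the correction term of the contraction vanishes by `ha`.
  obtain ⟨W, hW, rfl⟩ := exists_global_ext w
  have h1 := covDeriv_insertFirst hc hT hW v y θ
  rw [(ha.insertFirst W).covDeriv (hT.insertFirst hW) x v y θ i j hij hy,
    ha x _ y θ i j hij hy, add_zero] at h1
  exact h1.symm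

/-- The exterior derivative through a symmetric connection. -/
theorem extD_cons (ht : TorsionFree cov) (hη : IsTF η) (ha : Alt η) (x : M)
    (Y₀ : TangentSpace (𝓡 n) x) (y θ) :
    extD η x (Fin.cons Y₀ y) θ = covDeriv cov η x (Fin.cons Y₀ y) θ
      - ∑ m, covDeriv cov η x (Fin.cons (y m) (Function.update y m Y₀)) θ := by
  have hraw : extD η x (Fin.cons Y₀ y) θ
      = dirDeriv (fun x' ↦ η x' (fun j ↦ ext (y j) x') (fun j ↦ coext (θ j) x')) x Y₀
        - ∑ m, dirDeriv (fun x' ↦ η x' (fun j ↦ ext (Function.update y m Y₀ j) x')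
            (fun j ↦ coext (θ j) x')) x (y m) := by
    rw [extD, Fin.sum_univ_succ, sub_eq_add_neg, ← Finset.sum_neg_distrib]
    congr 1
    · simp
    · refine Finset.sum_congr rfl fun m _ ↦ ?_
      have hd := hη.diff_ext (x := x)
        (fun j ↦ (Fin.cons Y₀ y : Fin (k + 1) → TangentSpace (𝓡 n) x) (m.succ.succAbove j)) θ
      rw [Fin.val_succ, pow_succ, mul_assoc, mul_left_comm, neg_one_mul,
        ← dirDeriv_const_mul _ hd, Fin.cons_succ]
      congr 2
      ext x'
      have h := alternatingMap_update (hη.altMap ha x' fun j ↦ coext (θ j) x') (ext Y₀ x')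
        (fun j ↦ ext (y j) x') m
      simp only [hη.altMap_apply] at h
      have e1 : (fun j ↦ ext (Function.update y m Y₀ j) x')
          = Function.update (fun j ↦ ext (y j) x') m (ext Y₀ x') :=
        Function.comp_update (fun v ↦ ext v x') y m Y₀
      have e2 : (fun j ↦ ext ((Fin.cons Y₀ y : Fin (k + 1) → TangentSpace (𝓡 n) x)
          (m.succ.succAbove j)) x')
          = fun j ↦ (Fin.cons (ext Y₀ x') (fun j ↦ ext (y j) x') :
            Fin (k + 1) → TangentSpace (𝓡 n) x') (m.succ.succAbove j) := by
        ext j : 1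
        refine Fin.cases ?_ (fun p ↦ ?_) (m.succ.succAbove j) <;> simp
      rw [e1, e2, h]
  rw [hraw]
  simp only [covDeriv, Fin.cons_zero, Fin.cons_succ, Finset.univ_eq_empty, Finset.sum_empty,
    sub_zero, Finset.sum_sub_distrib]
  -- For `i = m` the symmetry of the Christoffel symbols gives the right-hand side. The terms with
  -- `i ≠ m` are antisymmetric in `m` and `i`, because `η` is alternating, and sum to zero.
  have key : ∑ m, ∑ i, η x (Function.update (Function.update y m Y₀) i
        (cov (ext (Function.update y m Y₀ i)) x (y m))) θ
      = ∑ m, η x (Function.update y m (cov (ext (y m)) x Y₀)) θ := by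
    rw [← sub_eq_zero, ← Finset.sum_sub_distrib]
    have h0 := sum_sum_eq_zero_of_antisymm (fun m i ↦ if i = m then 0 else
      η x (Function.update (Function.update y m Y₀) i (cov (ext (y i)) x (y m))) θ) fun m i ↦ by
        by_cases h : i = m
        · subst h; simp
        · simp only [h, Ne.symm h, if_false, ha.update_update hη x y θ h, ht.ext_symm (y i)]
    rw [← h0]
    refine Finset.sum_congr rfl fun m _ ↦ ?_
    rw [← Finset.add_sum_erase _ _ (Finset.mem_univ m),
      ← Finset.add_sum_erase (a := m) _ (fun i ↦ ite _ _ _) (Finset.mem_univ m)]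
    simp only [Function.update_self, Function.update_idem, if_true, ht.ext_symm Y₀]
    rw [add_sub_cancel_left, zero_add]
    refine Finset.sum_congr rfl fun i hi ↦ ?_
    have := Finset.ne_of_mem_erase hi
    rw [Function.update_of_ne this, if_neg this]
  rw [key]
  ring

end AltCov

/-! ### Traces over the first two places -/

section Trace

variable {g : Metric n M} {x : M} {e : Fin n → TangentSpace (𝓡 n) x}

/-- The bilinear map of the first two arguments of a tensor. -/
def IsTF.firstTwo {l k : ℕ} {T : RawField n M l (k + 2)} (hT : IsTF T) (x : M)
    (y : Fin k → TangentSpace (𝓡 n) x) (θ : Fin l → (TangentSpace (𝓡 n) x →L[ℝ] ℝ)) :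
    TangentSpace (𝓡 n) x →ₗ[ℝ] TangentSpace (𝓡 n) x →ₗ[ℝ] ℝ :=
  LinearMap.mk₂ ℝ (fun u w ↦ T x (Fin.cons u (Fin.cons w y)) θ)
    (fun u u' w ↦ by simpa using hT.update_add x (Fin.cons 0 (Fin.cons w y)) θ 0 u u')
    (fun c u w ↦ by simpa using hT.update_smul x (Fin.cons 0 (Fin.cons w y)) θ 0 c u)
    (fun u w w' ↦ by
      simpa only [← Fin.cons_update, Fin.update_cons_zero] using
        hT.update_add x (Fin.cons u (Fin.cons 0 y)) θ (Fin.succ 0) w w')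
    (fun c u w ↦ by
      simpa only [← Fin.cons_update, Fin.update_cons_zero, smul_eq_mul] using
        hT.update_smul x (Fin.cons u (Fin.cons 0 y)) θ (Fin.succ 0) c w)

theorem traceFirst_eq {l k : ℕ} {T : RawField n M l (k + 2)} (hT : IsTF T)
    (he : IsOrthonormalFrame g x e) (y θ) :
    traceFirst g T x y θ = ∑ i, T x (Fin.cons (e i) (Fin.cons (e i) y)) θ :=
  sum_frame_eq (frame_orthonormal g x) he (hT.firstTwo x y θ)

/-- Endomorphisms can be moved in a trace to their adjoints. -/
theorem sum_adjoint_eq (he : IsOrthonormalFrame g x e)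
    (B : TangentSpace (𝓡 n) x →ₗ[ℝ] TangentSpace (𝓡 n) x →ₗ[ℝ] ℝ)
    {L L' : TangentSpace (𝓡 n) x → TangentSpace (𝓡 n) x}
    (h : ∀ u w, g.inner x (L u) w = g.inner x u (L' w)) :
    ∑ i, B (L (e i)) (e i) = ∑ i, B (e i) (L' (e i)) := by
  have h1 : ∀ i, B (L (e i)) (e i) = ∑ j, g.inner x (e j) (L (e i)) * B (e j) (e i) := by
    intro i
    conv_lhs => rw [← he.expand (L (e i))]
    simp
  have h2 : ∀ i, B (e i) (L' (e i)) = ∑ j, g.inner x (e j) (L' (e i)) * B (e i) (e j) := by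
    intro i
    conv_lhs => rw [← he.expand (L' (e i))]
    simp
  simp only [h1, h2]
  rw [Finset.sum_comm]
  refine Finset.sum_congr rfl fun i _ ↦ Finset.sum_congr rfl fun j _ ↦ ?_
  rw [g.symm x (e i), h]

theorem IsTF.traceFirst (g : Metric n M) {l k : ℕ} {T : RawField n M l (k + 2)} (hT : IsTF T) :
    IsTF (traceFirst g T) where
  update_add x z θ p u w := by
    simp only [StatGeom.traceFirst, Fin.cons_update, hT.update_add, Finset.sum_add_distrib]
  update_smul x z θ p c u := by
    simp only [StatGeom.traceFirst, Fin.cons_update, hT.update_smul, Finset.mul_sum]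
  co_add x z θ p u w := by
    simp only [StatGeom.traceFirst, hT.co_add, Finset.sum_add_distrib]
  co_smul x z θ p c u := by
    simp only [StatGeom.traceFirst, hT.co_smul, Finset.mul_sum]
  smooth x Y Θ hY hΘ := by
    obtain ⟨E, -, h2, h3⟩ := exists_smooth_frame g x (frame_orthonormal g x)
    refine ContMDiffAt.congr_of_eventuallyEq (f := fun y ↦ ∑ i, T y
      (Fin.cons (E i y) (Fin.cons (E i y) fun i ↦ Y i y)) (fun j ↦ Θ j y)) ?_
      (h3.mono fun y hy ↦ traceFirst_eq hT hy _ _)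
    refine SmoothAt.sum fun i _ ↦ ?_
    have := hT.smooth x _ Θ (smoothVNear_cons (h2 i) (smoothVNear_cons (h2 i) hY)) hΘ
    simpa only [eval_cons] using this

end Trace

/-- Connections for which the metric is parallel. -/
def IsMetricConn (g : Metric n M) (cov : RawConn n M) : Prop :=
  ∀ {Y Z : VField n M} {x : M}, DiffVAt Y x → DiffVAt Z x → ∀ v,
    dirDeriv (fun y ↦ g.inner y (Y y) (Z y)) x v
      = g.inner x (cov Y x v) (Z x) + g.inner x (Y x) (cov Z x v)

section TraceCov

variable {g : Metric n M} {cov : RawConn n M} (hc : IsConn cov) {k : ℕ}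
include hc

/-- In a smooth orthonormal frame a metric connection has skew coefficients, so the terms containing
derivatives of the frame cancel in the trace. -/
theorem covDeriv_traceFirst (hg : IsMetricConn g cov) {T : RawField n M 0 (k + 2)} (hT : IsTF T)
    (x : M) (v : TangentSpace (𝓡 n) x) (y θ) :
    covDeriv cov (traceFirst g T) x (Fin.cons v y) θ
      = ∑ j, covDeriv cov T x
          (Fin.cons v (Fin.cons (frame g x j) (Fin.cons (frame g x j) y))) θ := by
  have he := frame_orthonormal g x
  obtain ⟨E, h1, h2, h3⟩ := exists_smooth_frame g x he
  have hz : ∀ i, SmoothVNear (ext (y i)) x := fun i ↦ smoothVNear_ext _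
  have hθ : ∀ i, SmoothCoNear (coext (θ i)) x := fun i ↦ smoothCoNear_coext _
  have hY := fun j ↦ smoothVNear_cons (h2 j) (smoothVNear_cons (h2 j) hz)
  have h4 := fun j ↦ covDeriv_apply hc hT v (hY j) hθ
  have hd : ∀ j, MDifferentiableAt (𝓡 n) 𝓘(ℝ) (fun y' ↦ T y' (Fin.cons (E j y')
      (Fin.cons (E j y') fun i ↦ ext (y i) y')) (fun i ↦ coext (θ i) y')) x := by
    intro j
    have := (hT.smooth x _ _ (hY j) hθ).diff
    simpa only [eval_cons] using this
  simp only [eval_cons, covDerivOn, ext_self, coext_self, h1, Fin.sum_univ_succ, Fin.cons_zero,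
    Fin.cons_succ, Fin.update_cons_zero, ← Fin.cons_update] at h4
  have h5 : (fun y' ↦ traceFirst g T y' (fun i ↦ ext (y i) y') (fun i ↦ coext (θ i) y')) =ᶠ[𝓝 x]
      fun y' ↦ ∑ j, T y' (Fin.cons (E j y') (Fin.cons (E j y') fun i ↦ ext (y i) y'))
        (fun i ↦ coext (θ i) y') := h3.mono fun y' hy' ↦ traceFirst_eq hT hy' _ _
  have hskew : ∑ j, ∑ d, g.inner x (frame g x d) (cov (E j) x v) *
      (hT.firstTwo x y θ (frame g x d) (frame g x j)
        + hT.firstTwo x y θ (frame g x j) (frame g x d)) = 0 := by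
    refine sum_sum_eq_zero_of_antisymm _ fun j d ↦ ?_
    have h := hg (h2 j).at.diff (h2 d).at.diff v
    rw [dirDeriv_congr (h3.mono fun y hy ↦ hy j d), dirDeriv_const, h1, h1,
      g.symm x (cov _ _ _)] at h
    have h' : g.inner x (frame g x d) (cov (E j) x v)
      = -g.inner x (frame g x j) (cov (E d) x v) := by linarith
    rw [h']; ring
  have h6 : ∀ j, T x (Fin.cons (cov (E j) x v) (Fin.cons (frame g x j) y)) θ
      + T x (Fin.cons (frame g x j) (Fin.cons (cov (E j) x v) y)) θ
      = ∑ d, g.inner x (frame g x d) (cov (E j) x v) *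
      (hT.firstTwo x y θ (frame g x d) (frame g x j)
        + hT.firstTwo x y θ (frame g x j) (frame g x d)) := by
    intro j
    change hT.firstTwo x y θ _ _ + hT.firstTwo x y θ _ _ = _
    conv_lhs => rw [← he.expand (cov (E j) x v)]
    simp [mul_add, Finset.sum_add_distrib]
  simp only [← h6] at hskew
  rw [Finset.sum_congr rfl fun j _ ↦ h4 j]
  simp only [covDeriv, Fin.cons_zero, Fin.cons_succ]
  rw [dirDeriv_congr h5, dirDeriv_sum _ fun j _ ↦ hd j]
  simp only [traceFirst, Finset.univ_eq_empty, Finset.sum_empty, sub_zero,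
    Finset.sum_sub_distrib, Finset.sum_add_distrib] at hskew ⊢
  rw [Finset.sum_comm (s := (Finset.univ : Finset (Fin k)))]
  linarith

end TraceCov

/-! ### Exterior derivative, codifferential and Hodge Laplacian through a connection -/

section Hodge

variable {k : ℕ}

theorem cons_comp_swap {V : Type*} (a : V) (y : Fin k → V) (m : Fin k) :
    (Fin.cons a y : Fin (k + 1) → V) ∘ Equiv.swap 0 m.succ
      = Fin.cons (y m) (Function.update y m a) := by
  ext q : 1
  refine Fin.cases ?_ (fun q ↦ ?_) q
  · simp
  · by_cases h : q = m
    · subst h; simp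
    · rw [Function.comp_apply, Equiv.swap_apply_of_ne_of_ne (Fin.succ_ne_zero q)
        (fun h' ↦ h (Fin.succ_injective _ h'))]
      simp [h]

/-- Swapping places `0` and `p.succ` returns `a (y p)` to its own place at the price of a sign, so
the antisymmetrised expression becomes one sum over all places. It serves `d` of a trace or of a
contraction. -/
theorem sum_swap_first {V : Type*} (f : V → (Fin (k + 1) → V) → ℝ)
    (hf : ∀ v y (i j : Fin (k + 1)), i ≠ j → f v (y ∘ Equiv.swap i j) = -f v y) (a : V → V) (Y₀ : V)
    (y : Fin k → V) :
    f Y₀ (Fin.cons (a Y₀) y) - ∑ p, f (y p) (Fin.cons (a (y p)) (Function.update y p Y₀))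
      = ∑ m, f ((Fin.cons Y₀ y : Fin (k + 1) → V) m)
          (Function.update (Fin.cons Y₀ y : Fin (k + 1) → V) m
            (a ((Fin.cons Y₀ y : Fin (k + 1) → V) m))) := by
  rw [Fin.sum_univ_succ, sub_eq_add_neg, ← Finset.sum_neg_distrib]
  refine congrArg₂ (· + ·) (by simp) (Finset.sum_congr rfl fun p _ ↦ ?_)
  rw [Fin.cons_succ, ← hf _ _ 0 p.succ (Fin.succ_ne_zero p).symm]
  rw [cons_comp_swap, ← Fin.cons_update, Function.update_self, Function.update_idem]

theorem TailAlt.swap {T : RawField n M 0 (k + 1)} (ha : TailAlt T) (hT : IsTF T) (x : M)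
    (v : TangentSpace (𝓡 n) x) (y θ) {i j : Fin k} (hij : i ≠ j) :
    T x (Fin.cons v (y ∘ Equiv.swap i j)) θ = -T x (Fin.cons v y) θ :=
  AlternatingMap.map_swap { (hT.multi x θ).curryLeft v with
    map_eq_zero_of_eq' := fun y i j h hij ↦ ha x v y θ i j hij h } y hij

variable {cov : RawConn n M} (hc : IsConn cov)

include hc in
theorem TailAlt.covDeriv_swap [T2Space M] (g : Metric n M) {T : RawField n M 0 (k + 1)}
    (ha : TailAlt T) (hT : IsTF T) (x : M)
    (v w : TangentSpace (𝓡 n) x) (y θ) {i j : Fin k} (hij : i ≠ j) :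
    StatGeom.covDeriv cov T x (Fin.cons v (Fin.cons w (y ∘ Equiv.swap i j))) θ
      = -StatGeom.covDeriv cov T x (Fin.cons v (Fin.cons w y)) θ :=
  AlternatingMap.map_swap { (((hT.covDeriv hc g).multi x θ).curryLeft v).curryLeft w with
    map_eq_zero_of_eq' := fun _ _ _ h hij ↦ ha.covDeriv hc hT x v w hij h } y hij

variable {η : RawField n M 0 k} (ht : TorsionFree cov) (hη : IsTF η) (ha : Alt η)
include ht hη ha

/-- Expressing `dη` by permutations of the places of `∇η` gives an identity of tensor fields, which
can be differentiated again. -/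
theorem extD_eq_sub_sum : extD η = covDeriv cov η
    - ∑ m : Fin k, permSlots (Equiv.swap 0 m.succ) (covDeriv cov η) := by
  ext x y θ
  rw [← Fin.cons_self_tail y, extD_cons ht hη ha]
  simp only [Pi.sub_apply, Finset.sum_apply, permSlots, cons_comp_swap]

include hc

theorem isTF_extD (g : Metric n M) : IsTF (extD η) := by
  rw [extD_eq_sub_sum ht hη ha]
  have h := hη.covDeriv hc g
  exact h.sub (IsTF.sum _ fun m _ ↦ h.permSlots _)

/-- The antisymmetrisation of `∇η` is `AlternatingMap.alternatizeUncurryFin` of the linear map `v ↦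
∇_v η`. -/
theorem alt_extD (g : Metric n M) : Alt (extD η) := by
  have hT := hη.covDeriv hc g
  have hA := Alt.covDeriv (cov := cov) hη ha
  intro x y θ i j hij hy
  let L : TangentSpace (𝓡 n) x →ₗ[ℝ] AlternatingMap ℝ (TangentSpace (𝓡 n) x) ℝ (Fin k) :=
    { toFun := fun v ↦ { (hT.multi x θ).curryLeft v with
        map_eq_zero_of_eq' := fun y i j h hij ↦ hA x v y θ i j hij h }
      map_add' := fun u w ↦ by
        ext y; exact congrArg (fun f ↦ f y) ((hT.multi x θ).curryLeft.map_add u w)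
      map_smul' := fun c u ↦ by
        ext y; exact congrArg (fun f ↦ f y) ((hT.multi x θ).curryLeft.map_smul c u) }
  have hL : ∀ v y, L v y = covDeriv cov η x (Fin.cons v y) θ := fun _ _ ↦ rfl
  have key : extD η x y θ = AlternatingMap.alternatizeUncurryFin L y := by
    rw [← Fin.cons_self_tail y, extD_cons ht hη ha, AlternatingMap.alternatizeUncurryFin_apply,
      Fin.sum_univ_succ, sub_eq_add_neg, ← Finset.sum_neg_distrib]
    congr 1
    · simp [hL]
    · refine Finset.sum_congr rfl fun m _ ↦ ?_
      have h := alternatingMap_update (L (Fin.tail y m)) (y 0) (Fin.tail y) m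
      rw [← hL, ← h, Fin.val_succ, pow_succ, zsmul_eq_mul, Fin.cons_succ]
      push_cast
      have e : (m.succ.removeNth (Fin.cons (y 0) (Fin.tail y) : Fin (k + 1) → _))
        = fun j ↦ (Fin.cons (y 0) (Fin.tail y) : Fin (k + 1) → _) (m.succ.succAbove j) := rfl
      rw [e]
      ring
  rw [key]
  exact AlternatingMap.map_eq_zero_of_eq _ y hy hij

theorem covDeriv_extD (g : Metric n M) (x : M) (X Y₀ : TangentSpace (𝓡 n) x) (y θ) :
    covDeriv cov (extD η) x (Fin.cons X (Fin.cons Y₀ y)) θ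
      = covDeriv cov (covDeriv cov η) x (Fin.cons X (Fin.cons Y₀ y)) θ
        - ∑ m, covDeriv cov (covDeriv cov η) x
            (Fin.cons X (Fin.cons (y m) (Function.update y m Y₀))) θ := by
  have h := hη.covDeriv hc g
  rw [extD_eq_sub_sum ht hη ha, covDeriv_sub h (IsTF.sum _ fun m _ ↦ h.permSlots _),
    covDeriv_sum _ fun m ↦ h.permSlots _]
  simp only [Pi.sub_apply, Finset.sum_apply, covDeriv_permSlots, cons_comp_swap]

theorem codiff_extD (g : Metric n M) (x : M) (y θ) :
    codiff g cov (extD η) x y θ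
      = -∑ j, covDeriv cov (covDeriv cov η) x
          (Fin.cons (frame g x j) (Fin.cons (frame g x j) y)) θ
        + ∑ m, ∑ j, covDeriv cov (covDeriv cov η) x
            (Fin.cons (frame g x j) (Fin.cons (y m) (Function.update y m (frame g x j)))) θ := by
  simp only [codiff, Pi.neg_apply, traceFirst, covDeriv_extD hc ht hη ha g,
    Finset.sum_sub_distrib]
  rw [Finset.sum_comm (s := (Finset.univ : Finset (Fin n)))]
  ring

end Hodge

section Hodge

variable {k : ℕ} {g : Metric n M} {cov : RawConn n M} (hc : IsConn cov)

theorem alt_traceFirst {T : RawField n M 0 (k + 2)} (ha : TailAlt T) : Alt (traceFirst g T) := by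
  intro x y θ i j hij hy
  refine Finset.sum_eq_zero fun p _ ↦ ha x _ _ θ i.succ j.succ ?_ ?_
  · exact fun h ↦ hij (Fin.succ_injective _ h)
  · simpa using hy

theorem alt_neg {η : RawField n M 0 k} (h : Alt η) : Alt (-η) := fun x y θ i j hij hy ↦ by
  simp [h x y θ i j hij hy]

include hc in
theorem IsTF.codiff {η : RawField n M 0 (k + 1)} (hη : IsTF η) : IsTF (codiff g cov η) :=
  ((hη.covDeriv hc g).traceFirst g).neg

theorem Alt.codiff {η : RawField n M 0 (k + 1)} (hη : IsTF η) (ha : Alt η) :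
    Alt (codiff g cov η) := alt_neg (alt_traceFirst (ha.covDeriv hη))

variable [T2Space M] (ht : TorsionFree cov) (hg : IsMetricConn g cov)
include hc ht hg

/-- A metric connection commutes with the trace, so `dδη` is built from second derivatives of `η`;
`sum_swap_first` then moves each frame vector to the place of the argument that became the
direction. -/
theorem extD_codiff {η : RawField n M 0 (k + 1)} (hη : IsTF η) (ha : Alt η) (x : M) (y θ) :
    extD (codiff g cov η) x y θ
      = -∑ m, ∑ j, covDeriv cov (covDeriv cov η) x
            (Fin.cons (y m) (Fin.cons (frame g x j) (Function.update y m (frame g x j)))) θ := by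
  have hT := hη.covDeriv hc g
  have hA := Alt.covDeriv (cov := cov) hη ha
  rw [← Fin.cons_self_tail y, extD_cons ht (hη.codiff hc) (ha.codiff hη), codiff]
  simp only [covDeriv_neg, Pi.neg_apply, covDeriv_traceFirst hc hg hT]
  rw [Finset.sum_comm]
  have h := fun j ↦ sum_swap_first (fun v y ↦ covDeriv cov (covDeriv cov η) x
      (Fin.cons v (Fin.cons (frame g x j) y)) θ)
    (fun v y i i' hi ↦ hA.covDeriv_swap hc g hT x v _ y θ hi) (fun _ ↦ frame g x j) (y 0)
    (Fin.tail y)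
  simp only [← h, Finset.sum_sub_distrib, Finset.sum_neg_distrib]
  rw [Finset.sum_comm (s := (Finset.univ : Finset (Fin n)))]
  ring

/-- The Weitzenböck formula before curvature enters: beside the trace of second derivatives, `δd`
and `dδ` contribute the two orders of differentiation, with opposite signs. -/
theorem formLaplacian_eq {η : RawField n M 0 k} (hη : IsTF η) (ha : Alt η) (x : M) (y θ) :
    formLaplacian g cov η x y θ
      = -∑ j, covDeriv cov (covDeriv cov η) x
          (Fin.cons (frame g x j) (Fin.cons (frame g x j) y)) θ
        + ∑ m, ∑ j, (covDeriv cov (covDeriv cov η) x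
            (Fin.cons (frame g x j) (Fin.cons (y m) (Function.update y m (frame g x j)))) θ
          - covDeriv cov (covDeriv cov η) x
            (Fin.cons (y m) (Fin.cons (frame g x j) (Function.update y m (frame g x j)))) θ) := by
  cases k with
  | zero =>
    -- In degree `0` there are no places `m`, so the absent term `dδ` matches an empty sum.
    rw [formLaplacian, codiff_extD hc ht hη ha]
    simp
  | succ k =>
    rw [formLaplacian, Pi.add_apply, Pi.add_apply, Pi.add_apply, codiff_extD hc ht hη ha,
      extD_codiff hc ht hg hη ha]
    simp only [Finset.sum_sub_distrib]
    ring

end Hodge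

/-! ### The Ricci identity -/

section Ricci

variable {cov : RawConn n M} (hc : IsConn cov) {k : ℕ} {η : RawField n M 0 k} (hη : IsTF η)
include hc hη

theorem dirDeriv_eval (x : M) (v : TangentSpace (𝓡 n) x) {Y : Fin k → VField n M}
    (hY : ∀ i, SmoothVNear (Y i) x) (θ : Fin 0 → (TangentSpace (𝓡 n) x →L[ℝ] ℝ)) :
    dirDeriv (fun y ↦ η y (fun i ↦ Y i y) (fun j ↦ coext (θ j) y)) x v
      = covDeriv cov η x (Fin.cons v (fun i ↦ Y i x)) θ
        + ∑ i, η x (Function.update (fun i ↦ Y i x) i (cov (Y i) x v)) θ := by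
  have h := covDeriv_apply hc hη v hY (Θ := fun j ↦ coext (θ j)) fun j ↦ smoothCoNear_coext _
  simp only [coext_self] at h
  rw [h]
  simp [covDerivOn]

/-- For a torsion-free connection every term except the sum with iterated `cov` is symmetric in `u`
and `v`: the double sum after exchanging `i` and `p`, the last term by symmetry of the Christoffel
symbols. -/
theorem covDeriv_covDeriv_eq (g : Metric n M) (x : M) (u v : TangentSpace (𝓡 n) x) (z θ) :
    covDeriv cov (covDeriv cov η) x (Fin.cons u (Fin.cons v z)) θ
      = dirDeriv (fun y ↦ dirDeriv (fun y ↦ η y (fun i ↦ ext (z i) y) (fun j ↦ coext (θ j) y))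
          y (ext v y)) x u
        - ∑ i, (covDeriv cov η x (Fin.cons u (Function.update z i (cov (ext (z i)) x v))) θ
            + covDeriv cov η x (Fin.cons v (Function.update z i (cov (ext (z i)) x u))) θ)
        - ∑ i, η x (Function.update z i (cov (fun y ↦ cov (ext (z i)) y (ext v y)) x u)) θ
        - (∑ i, ∑ p, if p = i then 0 else
            η x (Function.update (Function.update z i (cov (ext (z i)) x v)) p
              (cov (ext (z p)) x u)) θ)
        - covDeriv cov η x (Fin.cons (cov (ext v) x u) z) θ := by
  have hz : ∀ i, SmoothVNear (ext (z i)) x := fun i ↦ smoothVNear_ext _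
  have hθ : ∀ i, SmoothCoNear (coext (θ i)) x := fun i ↦ smoothCoNear_coext _
  have hV := smoothVNear_ext v
  have hσ : ∀ i, SmoothVNear (fun y ↦ cov (ext (z i)) y (ext v y)) x :=
    fun i ↦ hc.smoothNear (hz i) hV
  have h1 := dirDeriv_eval hc (hη.covDeriv hc g) x u (smoothVNear_cons hV hz) θ
  simp only [eval_cons, ext_self, Fin.sum_univ_succ, Fin.cons_zero, Fin.cons_succ,
    Fin.update_cons_zero, ← Fin.cons_update] at h1
  have h2 : (fun y ↦ covDeriv cov η y (Fin.cons (ext v y) fun i ↦ ext (z i) y)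
      (fun j ↦ coext (θ j) y)) =ᶠ[𝓝 x] fun y ↦
        dirDeriv (fun y ↦ η y (fun i ↦ ext (z i) y) (fun j ↦ coext (θ j) y)) y (ext v y)
        - ∑ i, η y (fun p ↦ Function.update (fun p ↦ ext (z p)) i
            (fun y ↦ cov (ext (z i)) y (ext v y)) p y) (fun j ↦ coext (θ j) y) := by
    filter_upwards [eventually_all.2 fun i ↦ (hz i).nhds, eventually_all.2 fun i ↦ (hθ i).nhds]
      with y h1 h2
    rw [covDeriv_apply hc hη (ext v y) h1 h2, covDerivOn]
    simp only [eval_update, Finset.univ_eq_empty, Finset.sum_empty, sub_zero]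
  have hs := fun i ↦ smoothVNear_update hz i (hσ i)
  have hd : ∀ i, MDifferentiableAt (𝓡 n) 𝓘(ℝ) (fun y ↦ η y (fun p ↦ Function.update
      (fun p ↦ ext (z p)) i (fun y ↦ cov (ext (z i)) y (ext v y)) p y)
        (fun j ↦ coext (θ j) y)) x := fun i ↦ (hη.smooth x _ _ (hs i) hθ).diff
  rw [dirDeriv_congr h2, dirDeriv_sub ((hη.smoothNear hz hθ).self_of_nhds.dirDeriv hV.at).diff
    (mdifferentiableAt_sum _ fun i _ ↦ hd i), dirDeriv_sum _ fun i _ ↦ hd i] at h1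
  have h3 : ∀ i, dirDeriv (fun y ↦ η y (fun p ↦ Function.update
      (fun p ↦ ext (z p)) i (fun y ↦ cov (ext (z i)) y (ext v y)) p y)
        (fun j ↦ coext (θ j) y)) x u
      = covDeriv cov η x (Fin.cons u (Function.update z i (cov (ext (z i)) x v))) θ
        + (η x (Function.update z i (cov (fun y ↦ cov (ext (z i)) y (ext v y)) x u)) θ
        + ∑ p, if p = i then 0 else
            η x (Function.update (Function.update z i (cov (ext (z i)) x v)) p
              (cov (ext (z p)) x u)) θ) := by
    intro i
    rw [dirDeriv_eval hc hη x u (hs i)]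
    simp only [eval_update, ext_self]
    congr 1
    rw [← Finset.add_sum_erase _ _ (Finset.mem_univ i),
      ← Finset.add_sum_erase (a := i) _ (fun p ↦ ite _ _ _) (Finset.mem_univ i)]
    simp only [Function.update_self, Function.update_idem, if_true, zero_add]
    congr 1
    refine Finset.sum_congr rfl fun p hp ↦ ?_
    have := Finset.ne_of_mem_erase hp
    rw [Function.update_of_ne this, if_neg this]
  simp only [h3, Finset.sum_add_distrib] at h1 ⊢
  linarith

theorem covDeriv_covDeriv_comm (g : Metric n M) (ht : TorsionFree cov) (x : M)
    (u v : TangentSpace (𝓡 n) x) (z θ) :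
    covDeriv cov (covDeriv cov η) x (Fin.cons u (Fin.cons v z)) θ
      - covDeriv cov (covDeriv cov η) x (Fin.cons v (Fin.cons u z)) θ
      = -∑ m, η x (Function.update z m (curvature cov x u v (z m))) θ := by
  have hz : ∀ i, SmoothVNear (ext (z i)) x := fun i ↦ smoothVNear_ext _
  have hθ : ∀ i, SmoothCoNear (coext (θ i)) x := fun i ↦ smoothCoNear_coext _
  have h0 : ∀ w : TangentSpace (𝓡 n) x, cov (ext w) x 0 = 0 := fun w ↦ by simpa using hc.map_smul (ext w) x 0 0
  have hR : ∀ w, curvature cov x u v w = cov (fun y ↦ cov (ext w) y (ext v y)) x u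
      + (-1 : ℝ) • cov (fun y ↦ cov (ext w) y (ext u y)) x v := fun w ↦ by
    rw [curvature, mlieBracket_ext, h0]; module
  -- Exchanging the two places exchanges the roles of `u` and `v`, so the terms with derivatives at
  -- two different places do not contribute to the commutator.
  have hoff := sum_sum_eq_zero_of_antisymm (fun i p : Fin k ↦ if p = i then 0 else
    (η x (Function.update (Function.update z i (cov (ext (z i)) x v)) p
              (cov (ext (z p)) x u)) θ
      - η x (Function.update (Function.update z i (cov (ext (z i)) x u)) p
              (cov (ext (z p)) x v)) θ)) fun i p ↦ by
    by_cases h : p = i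
    · simp [h]
    · simp only [h, Ne.symm h, if_false, Function.update_comm h]
      ring
  have hoff' : (∑ i, ∑ p, if p = i then 0 else
      η x (Function.update (Function.update z i (cov (ext (z i)) x v)) p (cov (ext (z p)) x u)) θ)
      = ∑ i, ∑ p, if p = i then 0 else
      η x (Function.update (Function.update z i (cov (ext (z i)) x u)) p
        (cov (ext (z p)) x v)) θ := by
    rw [← sub_eq_zero, ← hoff]
    simp only [← Finset.sum_sub_distrib]
    refine Finset.sum_congr rfl fun i _ ↦ Finset.sum_congr rfl fun p _ ↦ ?_
    split_ifs <;> simp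
  rw [covDeriv_covDeriv_eq hc hη g, covDeriv_covDeriv_eq hc hη g, hoff', ht.ext_symm u v,
    dirDeriv_dirDeriv_ext (hη.smoothNear hz hθ) u v]
  simp only [hR, hη.update_add, hη.update_smul, Finset.sum_add_distrib, ← Finset.mul_sum]
  ring

end Ricci

/-! ### The algebra of the difference tensor -/

section PairBilin

variable {k : ℕ} {η : RawField n M 0 k} (hη : IsTF η)

/-- The bilinear map of two arguments of a tensor. -/
def IsTF.pairBilin (x : M) (y : Fin k → TangentSpace (𝓡 n) x)
    (θ : Fin 0 → (TangentSpace (𝓡 n) x →L[ℝ] ℝ)) {m p : Fin k} (h : p ≠ m) :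
    TangentSpace (𝓡 n) x →ₗ[ℝ] TangentSpace (𝓡 n) x →ₗ[ℝ] ℝ :=
  LinearMap.mk₂ ℝ (fun a b ↦ η x (Function.update (Function.update y m a) p b) θ)
    (fun a a' b ↦ by simp only [Function.update_comm h.symm, hη.update_add])
    (fun c a b ↦ by simp only [Function.update_comm h.symm, hη.update_smul, smul_eq_mul])
    (fun a b b' ↦ by simp only [hη.update_add])
    (fun c a b ↦ by simp only [hη.update_smul, smul_eq_mul])

theorem IsTF.pairBilin_apply (x : M) (y θ) {m p : Fin k} (h : p ≠ m) (a b) :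
    hη.pairBilin x y θ h a b = η x (Function.update (Function.update y m a) p b) θ := rfl

theorem Alt.pairBilin_swap (ha : Alt η) (x : M) (y θ) {m p : Fin k} (h : p ≠ m) (a b) :
    hη.pairBilin x y θ h a b = -hη.pairBilin x y θ h b a := by
  rw [hη.pairBilin_apply, hη.pairBilin_apply, ha.update_update hη x y θ h,
    Function.update_comm h]

theorem diffAct_cons (K : (x : M) → TangentSpace (𝓡 n) x → TangentSpace (𝓡 n) x →
    TangentSpace (𝓡 n) x) (x : M) (X : TangentSpace (𝓡 n) x) (y θ) :
    diffAct K η x (Fin.cons X y) θ = -∑ i, η x (Function.update y i (K x X (y i))) θ := by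
  simp [diffAct]

include hη in
-- The outer action also hits the direction `Y` of the inner one, which is the source of `K_{K_X
-- Y}`; the minus signs of the two derivations cancel.
theorem diffAct_diffAct (K : (x : M) → TangentSpace (𝓡 n) x → TangentSpace (𝓡 n) x →
    TangentSpace (𝓡 n) x) (x : M) (X Y : TangentSpace (𝓡 n) x) (z θ) :
    diffAct K (diffAct K η) x (Fin.cons X (Fin.cons Y z)) θ
      = ∑ m, η x (Function.update z m (K x (K x X Y) (z m) + K x Y (K x X (z m)))) θ
        + ∑ p, ∑ m, if m = p then 0 else
          η x (Function.update (Function.update z p (K x X (z p))) m (K x Y (z m))) θ := by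
  rw [diffAct_cons, Fin.sum_univ_succ]
  simp only [Fin.cons_zero, Fin.cons_succ, Fin.update_cons_zero, ← Fin.cons_update, diffAct_cons,
    Finset.sum_neg_distrib, hη.update_add, Finset.sum_add_distrib]
  have h : ∀ p, ∑ m, η x (Function.update (Function.update z p (K x X (z p))) m
      (K x Y (Function.update z p (K x X (z p)) m))) θ
      = η x (Function.update z p (K x Y (K x X (z p)))) θ + ∑ m, if m = p then 0 else
          η x (Function.update (Function.update z p (K x X (z p))) m (K x Y (z m))) θ := by
    intro p
    rw [← Finset.add_sum_erase _ _ (Finset.mem_univ p),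
      ← Finset.add_sum_erase (a := p) _ (fun m ↦ ite _ _ _) (Finset.mem_univ p)]
    simp only [Function.update_self, Function.update_idem, if_true, zero_add]
    congr 1
    refine Finset.sum_congr rfl fun m hm ↦ ?_
    have := Finset.ne_of_mem_erase hm
    rw [Function.update_of_ne this, if_neg this]
  simp only [h, Finset.sum_add_distrib]
  ring

include hη in
-- Symmetry of `K` removes `K_{K_X Y}` and the terms at two different places cancel in pairs, so
-- only commutators of `K_X` and `K_Y` at single places remain.
theorem diffAct_diffAct_comm (K : (x : M) → TangentSpace (𝓡 n) x → TangentSpace (𝓡 n) x →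
    TangentSpace (𝓡 n) x) (x : M) (X Y : TangentSpace (𝓡 n) x) (z θ) (hK : K x X Y = K x Y X) :
    diffAct K (diffAct K η) x (Fin.cons X (Fin.cons Y z)) θ
        - diffAct K (diffAct K η) x (Fin.cons Y (Fin.cons X z)) θ
      = ∑ m, (η x (Function.update z m (K x Y (K x X (z m)))) θ
        - η x (Function.update z m (K x X (K x Y (z m)))) θ) := by
  have hoff := sum_sum_eq_zero_of_antisymm (fun p m : Fin k ↦ if m = p then 0 else
    (η x (Function.update (Function.update z p (K x X (z p))) m (K x Y (z m))) θ
      - η x (Function.update (Function.update z p (K x Y (z p))) m (K x X (z m))) θ)) fun i p ↦ by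
    by_cases h : p = i
    · simp [h]
    · simp only [h, Ne.symm h, if_false, Function.update_comm h]
      ring
  have hoff' : (∑ p, ∑ m, if m = p then 0 else
      η x (Function.update (Function.update z p (K x X (z p))) m (K x Y (z m))) θ)
      = ∑ p, ∑ m, if m = p then 0 else
      η x (Function.update (Function.update z p (K x Y (z p))) m (K x X (z m))) θ := by
    rw [← sub_eq_zero, ← hoff]
    simp only [← Finset.sum_sub_distrib]
    refine Finset.sum_congr rfl fun i _ ↦ Finset.sum_congr rfl fun p _ ↦ ?_
    split_ifs <;> simp
  rw [diffAct_diffAct hη, diffAct_diffAct hη, hoff', hK]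
  simp only [hη.update_add, Finset.sum_add_distrib, Finset.sum_sub_distrib]
  ring

end PairBilin

namespace IsStatistical

variable [T2Space M] {g : Metric n M} {D : Connection n M} (hD : IsStatistical g D)
include hD

theorem sum_diffTensor (x : M) (u : TangentSpace (𝓡 n) x) :
    ∑ j, diffTensor g (opOf D) x (diffTensor g (opOf D) x (frame g x j) (frame g x j)) u
      = diffTensor g (opOf D) x (vecE g (opOf D) x) u := by
  simp only [← hD.diffBilin_apply, vecE, map_sum, LinearMap.sum_apply]

theorem sum_diffTensor_right (x : M) (u : TangentSpace (𝓡 n) x) :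
    ∑ j, diffTensor g (opOf D) x u (diffTensor g (opOf D) x (frame g x j) (frame g x j))
      = diffTensor g (opOf D) x (vecE g (opOf D) x) u := by
  rw [← hD.sum_diffTensor]
  exact Finset.sum_congr rfl fun j _ ↦ hD.diffTensor_symm _ _ _

/-- The algebraic core of (b). The diagonal trace has terms in `K_E`, in `K_e K_e` at one place, and
in `K_e` at two places. The commutators produce the last two kinds with the opposite sign, while the
multiples of `K_E` balance through the term `2 K_E η`. -/
theorem sum_diffAct_diffAct {k : ℕ} {η : RawField n M 0 k} (hη : IsTF η) (ha : Alt η) (x : M)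
    (y θ) :
    ∑ j, diffAct (diffTensor g (opOf D)) (diffAct (diffTensor g (opOf D)) η) x
          (Fin.cons (frame g x j) (Fin.cons (frame g x j) y)) θ
      + 2 * diffAct (diffTensor g (opOf D)) η x (Fin.cons (vecE g (opOf D) x) y) θ
      = -∑ m, ∑ j, (diffAct (diffTensor g (opOf D)) (diffAct (diffTensor g (opOf D)) η) x
            (Fin.cons (frame g x j) (Fin.cons (y m) (Function.update y m (frame g x j)))) θ
          - diffAct (diffTensor g (opOf D)) (diffAct (diffTensor g (opOf D)) η) x
            (Fin.cons (y m) (Fin.cons (frame g x j) (Function.update y m (frame g x j)))) θ) := by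
  set K := diffTensor g (opOf D) with hK
  set e := frame g x with he
  have heo : IsOrthonormalFrame g x e := frame_orthonormal g x
  have hsymm : ∀ u v, K x u v = K x v u := hD.diffTensor_symm x
  have hself : ∀ u v w, g.inner x (K x u v) w = g.inner x v (K x u w) :=
    hD.diffTensor_inner_symm x
  have hcomm := fun m j ↦ diffAct_diffAct_comm hη K x (e j) (y m) (Function.update y m (e j)) θ
    (hsymm _ _)
  -- The place `p = m` carries the frame vector itself and yields `K_E` and `K_e K_e`; each other
  -- place gives a trace of an alternating bilinear form in the places `m` and `p`.
  have hinner : ∀ m, ∑ j, ∑ p, (η x (Function.update (Function.update y m (e j)) p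
        (K x (y m) (K x (e j) (Function.update y m (e j) p)))) θ
      - η x (Function.update (Function.update y m (e j)) p
        (K x (e j) (K x (y m) (Function.update y m (e j) p)))) θ)
      = η x (Function.update y m (K x (vecE g (opOf D) x) (y m))) θ
        - ∑ j, η x (Function.update y m (K x (e j) (K x (e j) (y m)))) θ
        - ∑ p, ∑ j, if p = m then 0 else
          η x (Function.update (Function.update y m (K x (e j) (y m))) p (K x (e j) (y p))) θ := by
    intro m
    rw [Finset.sum_comm, ← Finset.add_sum_erase _ _ (Finset.mem_univ m),
      ← Finset.add_sum_erase (a := m) _ (fun p ↦ ∑ j, ite _ _ _) (Finset.mem_univ m)]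
    simp only [Function.update_self, Function.update_idem, if_true, Finset.sum_const_zero,
      zero_add]
    rw [sub_eq_add_neg _ (∑ p ∈ Finset.univ.erase m, _), ← Finset.sum_neg_distrib]
    congr 1
    · rw [Finset.sum_sub_distrib, ← hη.update_sum, hK, he, hD.sum_diffTensor_right, ← hK, ← he]
      congr 1
      exact Finset.sum_congr rfl fun j _ ↦ by rw [hsymm (y m)]
    · refine Finset.sum_congr rfl fun p hp ↦ ?_
      have hpm := Finset.ne_of_mem_erase hp
      simp only [Function.update_of_ne hpm, if_neg hpm, ← hη.pairBilin_apply x y θ hpm]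
      set B := hη.pairBilin x y θ hpm with hB
      have hBs : ∀ a b, B a b = -B b a := fun a b ↦ ha.pairBilin_swap hη x y θ hpm a b
      -- By symmetry of `K` this is the trace of a self-adjoint endomorphism against an alternating
      -- form.
      have h1 : ∑ j, B (e j) (K x (e j) (K x (y m) (y p))) = 0 := by
        have h2 := sum_adjoint_eq heo B (L := K x (K x (y m) (y p)))
          (L' := K x (K x (y m) (y p))) (hself _)
        have h3 : ∑ j, B (K x (K x (y m) (y p)) (e j)) (e j)
            = -∑ j, B (e j) (K x (K x (y m) (y p)) (e j)) := by
          rw [← Finset.sum_neg_distrib]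
          exact Finset.sum_congr rfl fun j _ ↦ hBs _ _
        have h4 : ∑ j, B (e j) (K x (e j) (K x (y m) (y p)))
            = ∑ j, B (e j) (K x (K x (y m) (y p)) (e j)) :=
          Finset.sum_congr rfl fun j _ ↦ by rw [hsymm (e j)]
        rw [h4]; linarith
      have h5 : ∑ j, B (K x (e j) (y m)) (K x (e j) (y p))
          = ∑ j, B (e j) (K x (y p) (K x (y m) (e j))) := by
        have h := sum_adjoint_eq heo (B.compl₂ (hD.diffBilin x (y p)))
          (L := K x (y m)) (L' := K x (y m)) (hself _)
        simpa only [LinearMap.compl₂_apply, hD.diffBilin_apply, ← hK, hsymm _ (e _)] using h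
      -- Passing to the adjoint reverses the product of the two endomorphisms; alternation of `B`
      -- supplies the sign.
      have h6 : ∑ j, B (e j) (K x (y m) (K x (e j) (y p)))
          = -∑ j, B (e j) (K x (y p) (K x (y m) (e j))) := by
        have h := sum_adjoint_eq heo B (L := fun u ↦ K x (y m) (K x (y p) u))
          (L' := fun u ↦ K x (y p) (K x (y m) u)) (fun u w ↦ by rw [hself, hself])
        rw [← h, ← Finset.sum_neg_distrib]
        exact Finset.sum_congr rfl fun j _ ↦ by rw [hBs, hsymm (e j)]
      rw [Finset.sum_sub_distrib, h1, h6, h5, sub_zero]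
  simp only [hcomm, hinner]
  have hdiag : ∀ j, diffAct K (diffAct K η) x (Fin.cons (e j) (Fin.cons (e j) y)) θ
      = ∑ m, η x (Function.update y m (K x (K x (e j) (e j)) (y m))) θ
        + ∑ m, η x (Function.update y m (K x (e j) (K x (e j) (y m)))) θ
        + ∑ p, ∑ m, if m = p then 0 else
          η x (Function.update (Function.update y p (K x (e j) (y p))) m (K x (e j) (y m))) θ := by
    intro j
    rw [diffAct_diffAct hη]
    simp only [hη.update_add, Finset.sum_add_distrib]
  have hE : ∑ j, ∑ m, η x (Function.update y m (K x (K x (e j) (e j)) (y m))) θ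
      = ∑ m, η x (Function.update y m (K x (vecE g (opOf D) x) (y m))) θ := by
    rw [Finset.sum_comm]
    refine Finset.sum_congr rfl fun m _ ↦ ?_
    rw [← hη.update_sum, hK, he, hD.sum_diffTensor]
  simp only [hdiag, Finset.sum_add_distrib, hE, diffAct_cons, Finset.sum_sub_distrib]
  have c1 : ∑ j, ∑ m, η x (Function.update y m (K x (e j) (K x (e j) (y m)))) θ
      = ∑ m, ∑ j, η x (Function.update y m (K x (e j) (K x (e j) (y m)))) θ := Finset.sum_comm
  have c2 : (∑ j, ∑ p, ∑ m, if m = p then 0 else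
        η x (Function.update (Function.update y p (K x (e j) (y p))) m (K x (e j) (y m))) θ)
      = ∑ p, ∑ m, ∑ j, if m = p then 0 else
        η x (Function.update (Function.update y p (K x (e j) (y p))) m (K x (e j) (y m))) θ := by
    rw [Finset.sum_comm]
    exact Finset.sum_congr rfl fun p _ ↦ Finset.sum_comm
  rw [c1, c2]
  ring

end IsStatistical

/-! ### The Bochner formulas -/

theorem extD_sub {k : ℕ} {η ζ : RawField n M 0 k} (hη : IsTF η) (hζ : IsTF ζ) :
    extD (η - ζ) = extD η - extD ζ := by
  ext x y θ
  simp only [extD, Pi.sub_apply, dirDeriv_sub (hη.diff_ext _ _) (hζ.diff_ext _ _), mul_sub,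
    Finset.sum_sub_distrib]

/-- The formula of Cartan with the Lie derivative written as `∇_X - S_X`. -/
theorem insertFirst_extD_add {cov : RawConn n M} (hc : IsConn cov) (ht : TorsionFree cov)
    {k : ℕ} {η : RawField n M 0 (k + 1)} (hη : IsTF η) (ha : Alt η) {X : VField n M}
    (hX : ∀ y, SmoothVNear X y) (g : Metric n M) (x : M) (y θ) :
    insertFirst X (extD η) x y θ + extD (insertFirst X η) x y θ
      = covAlong cov X η x y θ - derivAction (fun x v ↦ cov X x v) η x y θ := by
  have hA := Alt.covDeriv (cov := cov) hη ha
  have hT := hη.covDeriv hc g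
  have hiA : Alt (insertFirst X η) := fun x y θ i j hij hy ↦
    ha x _ θ i.succ j.succ (fun h ↦ hij (Fin.succ_injective _ h)) (by simpa using hy)
  have h1 := sum_swap_first (fun v y ↦ covDeriv cov η x (Fin.cons v y) θ)
    (fun v y i j hij ↦ hA.swap hT x v y θ hij) (fun _ ↦ X x) (y 0) (Fin.tail y)
  have h2 := sum_swap_first (fun _ y ↦ η x y θ) (fun _ y i j hij ↦ ha.swap hη x y θ hij)
    (fun v ↦ cov X x v) (y 0) (Fin.tail y)
  simp only [Fin.cons_self_tail] at h1 h2
  have h3 : extD (insertFirst X η) x y θ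
      = ∑ m, covDeriv cov η x (Fin.cons (y m) (Function.update y m (X x))) θ
        + ∑ m, η x (Function.update y m (cov X x (y m))) θ := by
    rw [← h1, ← h2]
    conv_lhs => rw [← Fin.cons_self_tail y]
    rw [extD_cons ht (hη.insertFirst hX) hiA]
    simp only [covDeriv_insertFirst hc hη hX, Finset.sum_add_distrib]
    ring
  rw [h3]
  simp only [insertFirst, covAlong, derivAction, extD_cons ht hη ha]
  ring

namespace IsStatistical

variable [T2Space M] {g : Metric n M} {D : Connection n M} (hD : IsStatistical g D)
include hD

/-- The trace may be taken in a smooth orthonormal frame, where `K` is half the difference of two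
smooth covariant derivatives. Smoothness of `E` everywhere is needed to contract forms with it. -/
theorem smoothVNear_vecE (x : M) : SmoothVNear (vecE g (opOf D)) x := by
  refine .of_forall fun x ↦ ?_
  obtain ⟨E, -, h2, h3⟩ := exists_smooth_frame g x (frame_orthonormal g x)
  have key : ∀ᶠ y in 𝓝 x, vecE g (opOf D) y = ∑ i, (1 / 2 : ℝ) •
      (opOf D (E i) y (E i y) - conj g (opOf D) (E i) y (E i y)) := by
    filter_upwards [h3, eventually_all.2 fun i ↦ (h2 i).nhds] with y hy hE
    refine (sum_frame_eq (frame_orthonormal g y) hy (hD.diffBilin y)).trans ?_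
    exact Finset.sum_congr rfl fun i _ ↦ hD.diffTensor_apply (hE i) _
  refine SmoothVAt.congr (SmoothVAt.sum fun i _ ↦ SmoothVAt.smul contMDiffAt_const ?_) key
  exact (hD.isConn.smooth (h2 i) (h2 i)).sub (hD.isConn_conj.smooth (h2 i) (h2 i))

/-- Expanding `(∇̂ + K)² + (∇̂ - K)²`, the cross terms cancel. The mixed products in
`covDeriv_covDeriv_mixed` differ only in the sign of `KK`, and comparing the two brings in the
curvature. -/
theorem covDeriv_covDeriv_add {k : ℕ} {η : RawField n M 0 k} (hη : IsTF η) :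
    covDeriv (opOf D) (covDeriv (opOf D) η)
        + covDeriv (conj g (opOf D)) (covDeriv (conj g (opOf D)) η)
      = (2 : ℝ) • (covDeriv (avgConn (opOf D) (conj g (opOf D)))
          (covDeriv (avgConn (opOf D) (conj g (opOf D))) η)
        + diffAct (diffTensor g (opOf D)) (diffAct (diffTensor g (opOf D)) η)) := by
  have h1 := hη.covDeriv hD.isConn g
  have h2 := hη.covDeriv hD.isConn_conj g
  have hN := hη.covDeriv hD.isConn_avg g
  have hK := hD.isTF_diffAct hη
  rw [hD.covDeriv_opOf h1, hD.covDeriv_conj h2, hD.covDeriv_opOf hη, hD.covDeriv_conj hη,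
    covDeriv_add hN hK, covDeriv_sub hN hK, diffAct_add, diffAct_sub]
  module

theorem covDeriv_covDeriv_mixed {k : ℕ} {η : RawField n M 0 k} (hη : IsTF η) :
    covDeriv (conj g (opOf D)) (covDeriv (opOf D) η)
        + covDeriv (opOf D) (covDeriv (conj g (opOf D)) η)
      = (2 : ℝ) • (covDeriv (avgConn (opOf D) (conj g (opOf D)))
          (covDeriv (avgConn (opOf D) (conj g (opOf D))) η)
        - diffAct (diffTensor g (opOf D)) (diffAct (diffTensor g (opOf D)) η)) := by
  have h1 := hη.covDeriv hD.isConn g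
  have h2 := hη.covDeriv hD.isConn_conj g
  have hN := hη.covDeriv hD.isConn_avg g
  have hK := hD.isTF_diffAct hη
  rw [hD.covDeriv_conj h1, hD.covDeriv_opOf h2, hD.covDeriv_opOf hη, hD.covDeriv_conj hη,
    covDeriv_add hN hK, covDeriv_sub hN hK, diffAct_add, diffAct_sub]
  module

theorem hodgeLaplacian_eq_avg {k : ℕ} (η : RawField n M 0 k) :
    hodgeLaplacian g η = formLaplacian g (avgConn (opOf D) (conj g (opOf D))) η := by
  cases k <;> simp only [hodgeLaplacian, formLaplacian, codiff, hD.covDeriv_leviCivita]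

/-- The Ricci identity is applied to `∇` and `∇̄` separately, both being torsion-free; the sum of
their second derivatives is then split into `∇̂∇̂` and `KK`. -/
theorem weitzenbock_eq {k : ℕ} {η : RawField n M 0 k} (hη : IsTF η) (x : M) (y θ) :
    weitzenbock g (curvatureSum g D) η x y θ
      = 2 * ∑ m, ∑ j, ((covDeriv (avgConn (opOf D) (conj g (opOf D)))
            (covDeriv (avgConn (opOf D) (conj g (opOf D))) η) x
            (Fin.cons (frame g x j) (Fin.cons (y m) (Function.update y m (frame g x j)))) θ
          - covDeriv (avgConn (opOf D) (conj g (opOf D)))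
            (covDeriv (avgConn (opOf D) (conj g (opOf D))) η) x
            (Fin.cons (y m) (Fin.cons (frame g x j) (Function.update y m (frame g x j)))) θ)
        + (diffAct (diffTensor g (opOf D)) (diffAct (diffTensor g (opOf D)) η) x
            (Fin.cons (frame g x j) (Fin.cons (y m) (Function.update y m (frame g x j)))) θ
          - diffAct (diffTensor g (opOf D)) (diffAct (diffTensor g (opOf D)) η) x
            (Fin.cons (y m) (Fin.cons (frame g x j) (Function.update y m (frame g x j)))) θ)) := by
  rw [weitzenbock, Finset.mul_sum]
  refine Finset.sum_congr rfl fun m _ ↦ ?_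
  rw [Finset.mul_sum]
  refine Finset.sum_congr rfl fun j _ ↦ ?_
  set z := Function.update y m (frame g x j) with hz
  have h1 := covDeriv_covDeriv_comm hD.isConn hη g hD.torsionFree x (frame g x j) (y m) z θ
  have h2 := covDeriv_covDeriv_comm hD.isConn_conj hη g hD.torsionFree_conj x (frame g x j)
    (y m) z θ
  have h3 := fun Y ↦ congrArg (fun T : RawField n M 0 (k + 2) ↦ T x Y θ)
    (hD.covDeriv_covDeriv_add hη)
  simp only [Pi.add_apply, Pi.smul_apply, smul_eq_mul] at h3
  have h4 := h3 (Fin.cons (frame g x j) (Fin.cons (y m) z))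
  have h5 := h3 (Fin.cons (y m) (Fin.cons (frame g x j) z))
  simp only [curvatureSum, hη.update_add, Finset.sum_add_distrib]
  linarith

theorem covDeriv_sub_covDeriv_conj {k : ℕ} {η : RawField n M 0 k} (hη : IsTF η) (x : M)
    (v : TangentSpace (𝓡 n) x) (y θ) :
    covDeriv (opOf D) η x (Fin.cons v y) θ - covDeriv (conj g (opOf D)) η x (Fin.cons v y) θ
      = 2 * diffAct (diffTensor g (opOf D)) η x (Fin.cons v y) θ := by
  rw [hD.covDeriv_opOf hη, hD.covDeriv_conj hη]
  simp only [Pi.add_apply, Pi.sub_apply]; ring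

/-- With `C` for the commutator sum, the left side is `-2 tr ∇̂∇̂ + 2 tr KK + 2K_E`, where `-tr ∇̂∇̂
= Δ - C(∇̂∇̂)` and `W = 2C(∇̂∇̂) + 2C(KK)`. Then `tr KK + C(KK) = -2K_E` changes the coefficient of
`K_E` from `2` to `-2`. -/
theorem roughLaplacian_add {k : ℕ} {η : RawField n M 0 k} (hη : IsTF η) (ha : Alt η) :
    roughLaplacian g (opOf D) η + roughLaplacian g (conj g (opOf D)) η
      = (2 : ℝ) • hodgeLaplacian g η - weitzenbock g (curvatureSum g D) η
        - (2 : ℝ) • derivAction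
          (fun x v ↦ diffTensor g (opOf D) x (vecE g (opOf D) x) v) η := by
  ext x y θ
  have h1 := formLaplacian_eq hD.isConn_avg hD.torsionFree_avg hD.avg_metric hη ha x y θ
  have h2 := hD.weitzenbock_eq hη x y θ
  have h3 := hD.sum_diffAct_diffAct hη ha x y θ
  have hmix := fun Y ↦ congrArg (fun T : RawField n M 0 (k + 2) ↦ T x Y θ)
    (hD.covDeriv_covDeriv_mixed hη)
  have hder : derivAction (fun x v ↦ diffTensor g (opOf D) x (vecE g (opOf D) x) v) η x y θ
      = diffAct (diffTensor g (opOf D)) η x (Fin.cons (vecE g (opOf D) x) y) θ := by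
    rw [diffAct_cons, derivAction]
  have hneg : ∀ v, covDeriv (conj g (opOf D)) η x (Fin.cons (-v) y) θ
      = -covDeriv (conj g (opOf D)) η x (Fin.cons v y) θ := by
    intro v
    simpa using (hη.covDeriv hD.isConn_conj g).update_smul x (Fin.cons 0 y) θ 0 (-1) v
  -- The conjugate Laplacian contains `-E`, so the terms of lower order combine to `∇_E - ∇̄_E =
  -- 2K_E`.
  have hrough : roughLaplacian g (opOf D) η x y θ + roughLaplacian g (conj g (opOf D)) η x y θ
      = -∑ j, (covDeriv (conj g (opOf D)) (covDeriv (opOf D) η)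
            + covDeriv (opOf D) (covDeriv (conj g (opOf D)) η)) x
            (Fin.cons (frame g x j) (Fin.cons (frame g x j) y)) θ
        + (covDeriv (opOf D) η x (Fin.cons (vecE g (opOf D) x) y) θ
          - covDeriv (conj g (opOf D)) η x (Fin.cons (vecE g (opOf D) x) y) θ) := by
    simp only [roughLaplacian, formalAdjoint, traceFirst, insertFirst, hD.vecE_conj,
      covDeriv_conj_conj g hD.isConn, Pi.add_apply, Pi.neg_apply, Finset.sum_add_distrib, hneg]
    ring
  simp only [Pi.add_apply, Pi.sub_apply, Pi.smul_apply, smul_eq_mul] at hmix ⊢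
  rw [hrough]
  simp only [Pi.add_apply, hmix, hD.covDeriv_sub_covDeriv_conj hη]
  rw [h2, hder, hD.hodgeLaplacian_eq_avg, h1]
  simp only [← Finset.mul_sum, Finset.sum_add_distrib, Finset.sum_sub_distrib] at h3 ⊢
  linarith

theorem codiff_conj_eq {k : ℕ} {η : RawField n M 0 (k + 1)} (hη : IsTF η) (ha : Alt η) :
    codiff g (conj g (opOf D)) η = codiff g (avgConn (opOf D) (conj g (opOf D))) η
      - insertFirst (vecE g (opOf D)) η := by
  ext x y θ
  have hfirst : ∀ v : Fin n → TangentSpace (𝓡 n) x, ∑ j, η x (Fin.cons (v j) y) θ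
      = η x (Fin.cons (∑ j, v j) y) θ := by
    intro v
    simpa using (hη.update_sum x (Fin.cons 0 y) θ 0 Finset.univ v).symm
  have hK : ∀ j, diffAct (diffTensor g (opOf D)) η x
      (Fin.cons (frame g x j) (Fin.cons (frame g x j) y)) θ
      = -η x (Fin.cons (diffTensor g (opOf D) x (frame g x j) (frame g x j)) y) θ
        - ∑ m, η x (Fin.cons (frame g x j)
          (Function.update y m (diffTensor g (opOf D) x (y m) (frame g x j)))) θ := by
    intro j
    rw [diffAct_cons, Fin.sum_univ_succ]
    simp only [Fin.cons_zero, Fin.cons_succ, Fin.update_cons_zero, ← Fin.cons_update,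
      hD.diffTensor_symm x (y _)]
    ring
  -- Again a self-adjoint endomorphism traced against an alternating form; only the first place
  -- contributes, and it gives `ι_E`.
  have hz : ∀ m, ∑ j, η x (Fin.cons (frame g x j)
      (Function.update y m (diffTensor g (opOf D) x (y m) (frame g x j)))) θ = 0 := by
    intro m
    have hne : m.succ ≠ (0 : Fin (k + 1)) := Fin.succ_ne_zero m
    let B := hη.pairBilin x (Fin.cons 0 y) θ hne
    have hB : ∀ a b, B a b = η x (Fin.cons a (Function.update y m b)) θ := fun a b ↦ by
      simp only [B, hη.pairBilin_apply, Fin.update_cons_zero, ← Fin.cons_update]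
    simp only [← hB]
    have h2 := sum_adjoint_eq (frame_orthonormal g x) B (hD.diffTensor_inner_symm x (y m))
    have h3 : ∑ j, B (diffTensor g (opOf D) x (y m) (frame g x j)) (frame g x j)
        = -∑ j, B (frame g x j) (diffTensor g (opOf D) x (y m) (frame g x j)) := by
      rw [← Finset.sum_neg_distrib]
      exact Finset.sum_congr rfl fun j _ ↦ ha.pairBilin_swap hη x _ θ hne _ _
    linarith
  simp only [codiff, hD.covDeriv_conj hη, Pi.neg_apply, Pi.sub_apply, traceFirst, insertFirst, hK,
    Finset.sum_sub_distrib, Finset.sum_neg_distrib]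
  rw [Finset.sum_comm (s := (Finset.univ : Finset (Fin n))), Finset.sum_eq_zero fun m _ ↦ hz m,
    hfirst]
  simp only [vecE]
  ring

/-- Replacing `δ^∇̄` by `δ - ι_E` in both summands subtracts `ι_E d + d ι_E = L_E` from the Hodge
Laplacian, and `L_E = ∇_E - S_E` for the torsion-free `∇`. -/
theorem statLaplacian_eq {k : ℕ} {η : RawField n M 0 k} (hη : IsTF η) (ha : Alt η) :
    statLaplacian g D η = hodgeLaplacian g η - covAlong (opOf D) (vecE g (opOf D)) η
      + derivAction (fun x v ↦ D (vecE g (opOf D)) x v) η := by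
  have hE := hD.smoothVNear_vecE
  have hd := isTF_extD hD.isConn hD.torsionFree hη ha g
  have hda := alt_extD hD.isConn hD.torsionFree hη ha g
  have h1 := hD.codiff_conj_eq hd hda
  rw [hD.hodgeLaplacian_eq_avg]
  cases k with
  | zero =>
    -- On functions only `ι_E d` is subtracted, which is already `∇_E`; the derivation vanishes.
    ext x y θ
    simp only [statLaplacian, formLaplacian, h1, Pi.add_apply, Pi.sub_apply, insertFirst,
      covAlong, derivAction, extD_cons hD.torsionFree hη ha]
    simp
  | succ k =>
    have h2 := hD.codiff_conj_eq hη ha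
    have h3 : extD (codiff g (avgConn (opOf D) (conj g (opOf D))) η
        - insertFirst (vecE g (opOf D)) η)
        = extD (codiff g (avgConn (opOf D) (conj g (opOf D))) η)
          - extD (insertFirst (vecE g (opOf D)) η) :=
      extD_sub (hη.codiff hD.isConn_avg) (hη.insertFirst hE)
    ext x y θ
    have h4 := insertFirst_extD_add hD.isConn hD.torsionFree hη ha hE g x y θ
    simp only [statLaplacian, formLaplacian, h1, h2, h3, Pi.add_apply, Pi.sub_apply]
    change _ = _ - _ + derivAction (fun x v ↦ opOf D (vecE g (opOf D)) x v) η x y θ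
    linarith

theorem hodgeLaplacianFun_form {k : ℕ} {η : RawField n M 0 k} (hη : IsTF η) (ha : Alt η) (x : M) :
    hodgeLaplacianFun g (tensorInner g η η) x
      = 2 * tensorInner g (hodgeLaplacian g η) η x
        - tensorInner g (weitzenbock g (curvatureSum g D) η) η x
        - tensorInner g (covDeriv (opOf D) η) (covDeriv (opOf D) η) x
        - tensorInner g (covDeriv (conj g (opOf D)) η) (covDeriv (conj g (opOf D)) η) x
        - 2 * tensorInner g
            (derivAction (fun x v ↦ diffTensor g (opOf D) x (vecE g (opOf D) x) v) η) η x := by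
  have h := congrArg (fun s : RawField n M 0 k ↦ tensorInner g s η x)
    (hD.roughLaplacian_add hη ha)
  simp only [tensorInner_eq_at, Pi.add_apply, Pi.sub_apply, Pi.smul_apply, tensorInnerAt_add_left,
    tensorInnerAt_sub_left, tensorInnerAt_smul_left] at h
  rw [hD.hodgeLaplacianFun_inner_self hη]
  simp only [tensorInner_eq_at] at h ⊢
  linarith

theorem statLaplacianFun_form_hodge {k : ℕ} {η : RawField n M 0 k} (hη : IsTF η) (ha : Alt η) (x : M) :
    statLaplacianFun g D (tensorInner g η η) x
      = 2 * tensorInner g (hodgeLaplacian g η) η x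
        - tensorInner g (weitzenbock g (curvatureSum g D) η) η x
        - tensorInner g (covDeriv (opOf D) η) (covDeriv (opOf D) η) x
        - tensorInner g (covDeriv (conj g (opOf D)) η) (covDeriv (conj g (opOf D)) η) x
        - 2 * tensorInner g (covAlong (opOf D) (vecE g (opOf D)) η) η x := by
  rw [hD.statLaplacianFun_inner_self hη, hD.hodgeLaplacianFun_form hη ha]
  -- Because `∇_E - ∇̄_E = 2K_E`, the sum `2K_E + ∇_E + ∇̄_E` collapses to `2∇_E`.
  have h : covAlong (opOf D) (vecE g (opOf D)) η - covAlong (conj g (opOf D)) (vecE g (opOf D)) η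
      = (2 : ℝ) • derivAction
        (fun x v ↦ diffTensor g (opOf D) x (vecE g (opOf D) x) v) η := by
    ext x y θ
    have h1 := hD.covDeriv_sub_covDeriv_conj hη x (vecE g (opOf D) x) y θ
    rw [diffAct_cons] at h1
    exact h1
  have h2 := congrArg (fun s : RawField n M 0 k ↦ tensorInner g s η x) h
  simp only [tensorInner_eq_at, Pi.sub_apply, Pi.smul_apply,
    tensorInnerAt_sub_left, tensorInnerAt_smul_left] at h2 ⊢
  linarith

theorem statLaplacianFun_form_stat {k : ℕ} {η : RawField n M 0 k} (hη : IsTF η) (ha : Alt η) (x : M) :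
    statLaplacianFun g D (tensorInner g η η) x
      = 2 * tensorInner g (statLaplacian g D η) η x
        - tensorInner g (weitzenbock g (curvatureSum g D) η) η x
        - tensorInner g (covDeriv (opOf D) η) (covDeriv (opOf D) η) x
        - tensorInner g (covDeriv (conj g (opOf D)) η) (covDeriv (conj g (opOf D)) η) x
        - 2 * tensorInner g (derivAction (fun x v ↦ D (vecE g (opOf D)) x v) η) η x := by
  rw [hD.statLaplacianFun_form_hodge hη ha, hD.statLaplacian_eq hη ha]
  simp only [tensorInner_eq_at, Pi.add_apply, Pi.sub_apply, tensorInnerAt_add_left,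
    tensorInnerAt_sub_left]
  ring

end IsStatistical

end StatGeom

end

open StatGeom
theorem theorem10p4 {n : ℕ} {M : Type*} [TopologicalSpace M] [T2Space M]
    [ChartedSpace (EuclideanSpace ℝ (Fin n)) M] [IsManifold (𝓡 n) ∞ M]
    (g : Metric n M) (D : Connection n M) (hD : IsStatistical g D) :
    (∀ (l k : ℕ) (s : RawField n M l k), IsTensorField s → ∀ x : M,
      hodgeLaplacianFun g (tensorInner g s s) x
          = tensorInner g (roughLaplacian g (opOf D) s) s x
            + tensorInner g (roughLaplacian g (conj g (opOf D)) s) s x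
            - tensorInner g (covDeriv (opOf D) s) (covDeriv (opOf D) s) x
            - tensorInner g (covDeriv (conj g (opOf D)) s) (covDeriv (conj g (opOf D)) s) x
      ∧ statLaplacianFun g D (tensorInner g s s) x
          = tensorInner g (roughLaplacian g (opOf D) s) s x
            + tensorInner g (roughLaplacian g (conj g (opOf D)) s) s x
            - tensorInner g (covDeriv (opOf D) s) (covDeriv (opOf D) s) x
            - tensorInner g (covDeriv (conj g (opOf D)) s) (covDeriv (conj g (opOf D)) s) x
            - tensorInner g (covAlong (opOf D) (vecE g (opOf D)) s) s x
            - tensorInner g (covAlong (conj g (opOf D)) (vecE g (opOf D)) s) s x)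
    ∧ (∀ (k : ℕ) (η : RawField n M 0 k), IsForm η → ∀ x : M,
      hodgeLaplacianFun g (tensorInner g η η) x
          = 2 * tensorInner g (hodgeLaplacian g η) η x
            - tensorInner g (weitzenbock g (curvatureSum g D) η) η x
            - tensorInner g (covDeriv (opOf D) η) (covDeriv (opOf D) η) x
            - tensorInner g (covDeriv (conj g (opOf D)) η) (covDeriv (conj g (opOf D)) η) x
            - 2 * tensorInner g
                (derivAction (fun x v ↦ diffTensor g (opOf D) x (vecE g (opOf D) x) v) η) η x
      ∧ statLaplacianFun g D (tensorInner g η η) x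
          = 2 * tensorInner g (statLaplacian g D η) η x
            - tensorInner g (weitzenbock g (curvatureSum g D) η) η x
            - tensorInner g (covDeriv (opOf D) η) (covDeriv (opOf D) η) x
            - tensorInner g (covDeriv (conj g (opOf D)) η) (covDeriv (conj g (opOf D)) η) x
            - 2 * tensorInner g (derivAction (fun x v ↦ D (vecE g (opOf D)) x v) η) η x
      ∧ statLaplacianFun g D (tensorInner g η η) x
          = 2 * tensorInner g (hodgeLaplacian g η) η x
            - tensorInner g (weitzenbock g (curvatureSum g D) η) η x
            - tensorInner g (covDeriv (opOf D) η) (covDeriv (opOf D) η) x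
            - tensorInner g (covDeriv (conj g (opOf D)) η) (covDeriv (conj g (opOf D)) η) x
            - 2 * tensorInner g (covAlong (opOf D) (vecE g (opOf D)) η) η x) := by
  refine ⟨fun l k s hs x ↦ ?_, fun k η hη x ↦ ?_⟩
  · have h := hs.isTF
    refine ⟨hD.hodgeLaplacianFun_inner_self h x, ?_⟩
    rw [hD.statLaplacianFun_inner_self h, hD.hodgeLaplacianFun_inner_self h]
  · have h := hη.toIsTensorField.isTF
    have ha : Alt η := hη.alternating
    exact ⟨hD.hodgeLaplacianFun_form h ha x, hD.statLaplacianFun_form_stat h ha x,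
      hD.statLaplacianFun_form_hodge h ha x⟩
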